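/- A real-time $1$-counter Büchi automaton is a tuple $\mathcal{A}=(K,\Sigma,\Delta,q_0,F)$ with $K$ a finite set of states, $\Sigma$ a finite non-empty alphabet, $q_0\in K$, $F\subseteq K$, and $\Delta\subseteq K\times\Sigma\times\{0,1\}\times K\times\{-1,0,1\}$ such that $(q,a,0,q',j)\in\Delta$ implies $j\neq -1$. A run of $\mathcal{A}$ on $\sigma=a_1a_2\ldots\in\Sigma^\omega$ is a sequence of configurations $(q_i,c_i)_{i\ge 1}$ in $K\times\mathbb{N}$ that starts at $(q_0,0)$ and such that for every $i\ge 1$ there is $(q_i,a_i,b,q_{i+1},j)\in\Delta$ with $c_{i+1}=c_i+j$, and $b=0$ if $c_i=0$, $b=1$ if $c_i>0$. The language $L(\mathcal{A})\subseteq\Sigma^\omega$ is the set of $\sigma$ having a run in which some state of $F$ occurs infinitely often. A $2$-tape Büchi automaton is a tuple $\mathcal{B}=(K,\Sigma,\Gamma,\Delta,q_0,F)$ with $K$ a finite set of states, $\Sigma,\Gamma$ finite non-empty alphabets, $q_0\in K$, $F\subseteq K$, and $\Delta$ a finite subset of $K\times\Sigma^\star\times\Gamma^\star\times K$. The set $L(\mathcal{B})\subseteq\Sigma^\omega\times\Gamma^\omega=(\Sigma\times\Gamma)^\omega$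 consists of the pairs $(u,v)$ of infinite words for which there are transitions $(q_{i-1},u_i,v_i,q_i)\in\Delta$, $i\ge 1$, starting at $q_0$, with $u=u_1u_2u_3\ldots$, $v=v_1v_2v_3\ldots$ and some state of $F$ occurring infinitely often in $(q_i)_{i\geq 0}$. For $W\subseteq X^\omega$, the Gale–Stewart game $G(W)$ is the perfect-information game in which Player 1 and Player 2 alternately write letters $a_1,b_1,a_2,b_2,\ldots$ of $X$, Player 1 moving first; Player 1 wins iff $a_1b_1a_2b_2\ldots\in W$, otherwise Player 2 wins. The game is determined if one of the players has a winning strategy. A set $S\subseteq\mathbb{N}$ is $\Pi^1_2$ if there is a recursive relation $R$ with $n\in S\iff\forall f\in\mathbb{N}^{\mathbb{N}}\ \exists g\in\mathbb{N}^{\mathbb{N}}\ \forall m\ R(n,f{\restriction}m,g{\restriction}m)$. It is $\Pi^1_2$-complete if it is $\Pi^1_2$ and every $\Pi^1_2$ set $T\subseteq\mathbb{N}$ is reducible to $S$ by an injective total recursive function. **Theorem.** (1) There exists a recursive sequence $(\mathcal{A}_n)_{n\in\mathbb{N}}$ of real-time $1$-counter Büchi automata such that every game $G(L(\mathcal{A}_n))$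 is determined, while the set of all $n$ for which Player 1 has a winning strategy in $G(L(\mathcal{A}_n))$ is $\Pi^1_2$-complete. (2) There exists a recursive sequence $(\mathcal{B}_n)_{n\in\mathbb{N}}$ of $2$-tape Büchi automata such that every game $G(L(\mathcal{B}_n))$ is determined, while the set of all $n$ for which Player 1 has a winning strategy in $G(L(\mathcal{B}_n))$ is $\Pi^1_2$-complete. -/

import Mathlib

namespace AutomataGames

open Filter

/-! ### Gale–Stewart games -/

section Games

variable {X : Type}

/-- The first `n` rounds `(a₁, b₁), …, (aₙ, bₙ)` of the play `x = a₁ b₁ a₂ b₂ …`. -/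
def rounds (x : ℕ → X) (n : ℕ) : List (X × X) :=
  (List.range n).map fun i => (x (2 * i), x (2 * i + 1))

/-- `F : (X²)* → X` is a winning strategy for Player 1 in the game `G(W)`. -/
def IsWinning₁ (W : Set (ℕ → X)) (F : List (X × X) → X) : Prop :=
  ∀ x : ℕ → X, (∀ n, x (2 * n) = F (rounds x n)) → x ∈ W

/-- `F : (X²)* X → X` is a winning strategy for Player 2 in the game `G(W)`. -/
def IsWinning₂ (W : Set (ℕ → X)) (F : List (X × X) → X → X) : Prop :=
  ∀ x : ℕ → X, (∀ n, x (2 * n + 1) = F (rounds x n) (x (2 * n))) → x ∉ W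

def Player1Wins (W : Set (ℕ → X)) : Prop := ∃ F, IsWinning₁ W F

def Player2Wins (W : Set (ℕ → X)) : Prop := ∃ F, IsWinning₂ W F

def Determined (W : Set (ℕ → X)) : Prop := Player1Wins W ∨ Player2Wins W

end Games

/-! ### Real-time 1-counter Büchi automata -/

/-- A real-time 1-counter Büchi automaton with states `0, …, numStates - 1` and input alphabet
`{0, …, numLetters - 1}`. A transition `(q, a, b, q', j)` may be taken in state `q` on the letter
`a` if the counter is zero and `b = false`, or the counter is positive and `b = true`; it leads to
the state `q'` and adds `j ∈ {-1, 0, 1}` to the counter. There are no `λ`-transitions. -/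
structure CounterAutomaton where
  numStates : ℕ
  numLetters : ℕ
  trans : List (ℕ × ℕ × Bool × ℕ × ℤ)
  init : ℕ
  accept : List ℕ
  numLetters_pos : 0 < numLetters
  init_lt : init < numStates
  accept_lt : ∀ q ∈ accept, q < numStates
  trans_valid : ∀ q a b q' j, (q, a, b, q', j) ∈ trans →
    q < numStates ∧ a < numLetters ∧ q' < numStates ∧ (j = -1 ∨ j = 0 ∨ j = 1)
  /-- No transition decrements a counter that is zero. -/
  trans_zero : ∀ q a q' j, (q, a, false, q', j) ∈ trans → j ≠ -1

namespace CounterAutomaton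

/-- The finite description of the automaton. -/
def code (A : CounterAutomaton) : ℕ × ℕ × List (ℕ × ℕ × Bool × ℕ × ℤ) × ℕ × List ℕ :=
  (A.numStates, A.numLetters, A.trans, A.init, A.accept)

/-- The sequence of configurations `(q i, c i)` is a run on `x`. -/
def IsRun (A : CounterAutomaton) (x : ℕ → Fin A.numLetters) (q c : ℕ → ℕ) : Prop :=
  q 0 = A.init ∧ c 0 = 0 ∧
    ∀ i, ∃ j : ℤ, (q i, (x i : ℕ), decide (0 < c i), q (i + 1), j) ∈ A.trans ∧
      (c (i + 1) : ℤ) = c i + j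

/-- The accepted `ω`-language. -/
def language (A : CounterAutomaton) : Set (ℕ → Fin A.numLetters) :=
  {x | ∃ q c, A.IsRun x q c ∧ ∃ p ∈ A.accept, ∃ᶠ i in atTop, q i = p}

end CounterAutomaton

/-! ### 2-tape Büchi automata -/

/-- A 2-tape Büchi automaton with states `0, …, numStates - 1`, first alphabet
`{0, …, numLetters₁ - 1}` and second alphabet `{0, …, numLetters₂ - 1}`. A transition
`(q, u, v, q')` reads the (possibly empty) finite word `u` on the first tape and `v` on the
second. -/
structure TwoTapeAutomaton where
  numStates : ℕ
  numLetters₁ : ℕ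
  numLetters₂ : ℕ
  trans : List (ℕ × List ℕ × List ℕ × ℕ)
  init : ℕ
  accept : List ℕ
  numLetters₁_pos : 0 < numLetters₁
  numLetters₂_pos : 0 < numLetters₂
  init_lt : init < numStates
  accept_lt : ∀ q ∈ accept, q < numStates
  trans_valid : ∀ q u v q', (q, u, v, q') ∈ trans →
    q < numStates ∧ (∀ a ∈ u, a < numLetters₁) ∧ (∀ b ∈ v, b < numLetters₂) ∧ q' < numStates

/-- The concatenation of the first `m` words `w 0, w 1, …`. -/
def concatUpTo (w : ℕ → List ℕ) (m : ℕ) : List ℕ :=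
  ((List.range m).map w).flatten

/-- The infinite concatenation `w 0 . w 1 . w 2 …` is infinite and equal to the `ω`-word `x`. -/
def IsInfiniteConcat (w : ℕ → List ℕ) (x : ℕ → ℕ) : Prop :=
  (∀ m, concatUpTo w m = (List.range (concatUpTo w m).length).map x) ∧
    ∀ N, ∃ m, N ≤ (concatUpTo w m).length

namespace TwoTapeAutomaton

/-- The finite description of the automaton. -/
def code (B : TwoTapeAutomaton) :
    ℕ × ℕ × ℕ × List (ℕ × List ℕ × List ℕ × ℕ) × ℕ × List ℕ :=
  (B.numStates, B.numLetters₁, B.numLetters₂, B.trans, B.init, B.accept)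

/-- The infinitary rational relation accepted by the automaton, where a pair of `ω`-words is
identified with an `ω`-word over the product alphabet. -/
def language (B : TwoTapeAutomaton) : Set (ℕ → Fin B.numLetters₁ × Fin B.numLetters₂) :=
  {x | ∃ (q : ℕ → ℕ) (u v : ℕ → List ℕ),
    q 0 = B.init ∧ (∀ i, (q i, u i, v i, q (i + 1)) ∈ B.trans) ∧
    (∃ p ∈ B.accept, ∃ᶠ i in atTop, q i = p) ∧
    IsInfiniteConcat u (fun i => ((x i).1 : ℕ)) ∧
    IsInfiniteConcat v (fun i => ((x i).2 : ℕ))}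

end TwoTapeAutomaton

/-! ### The class `Π¹₂` of sets of natural numbers -/

/-- The initial segment `f 0, …, f (m - 1)`. -/
def initSeg (f : ℕ → ℕ) (m : ℕ) : List ℕ := (List.range m).map f

/-- `P ⊆ ℕ × ω^ω × ω^ω` is (lightface) `Π⁰₁`: its complement is recursively open. -/
def IsPi01 (P : ℕ → (ℕ → ℕ) → (ℕ → ℕ) → Prop) : Prop :=
  ∃ R : ℕ × List ℕ × List ℕ → Prop, ComputablePred R ∧
    ∀ n f g, P n f g ↔ ∀ m, R (n, initSeg f m, initSeg g m)

/-- `S ⊆ ℕ` is (lightface) `Π¹₂`. -/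
def IsPi12 (S : Set ℕ) : Prop :=
  ∃ P : ℕ → (ℕ → ℕ) → (ℕ → ℕ) → Prop, IsPi01 P ∧
    ∀ n, n ∈ S ↔ ∀ f : ℕ → ℕ, ∃ g : ℕ → ℕ, P n f g

/-- `S` is `Π¹₂`-complete: it is `Π¹₂`, and every `Π¹₂` set is reducible to it by an injective
total recursive function (in particular, many-one reducible to it). -/
def IsPi12Complete (S : Set ℕ) : Prop :=
  IsPi12 S ∧ ∀ T : Set ℕ, IsPi12 T → OneOneReducible (fun n => n ∈ T) (fun n => n ∈ S)

end AutomataGames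

/-! The winning condition is made to depend on the letters of Player 2 alone. Then Player 1 wins
exactly if every word is accepted, and otherwise Player 2 wins by writing a rejected word. So every
game is determined, and the question becomes universality of a nondeterministic automaton, a
statement "for every word there is an accepting run", which can express "for all `f` there is `g`".

Fix the complete set `universalSet`: for every `f` there is a `g` no prefix of which is refuted. A
word is meant to spell a computation that guesses `f` value by value and, at stage `t`, tests the
finite sequence with code `t` as a prefix of `g`. It displays the number of the parent of this node
followed by `t` itself; a refuted node is displayed as its own parent. Chains of such pairs starting
from the root `0` then correspond to the good `g` (`parent_prefixCode_of_forall`,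
`exists_forall_of_path`). The test is primitive recursive, so a register program with copying,
incrementing and equality tests performs it (`exists_computes_of_primrec`). Extensions have larger
codes and are displayed later, so a chain can be followed in one pass with a single number in
memory.

On a word `e₀ 1^{m₀} e₁ 1^{m₁} …` the automaton guesses either a local error, or that the displays
stop, or a chain. An error concerns one register, whose value is carried in the counter from its
last assignment to the operation that uses it. Words that do not spell an execution are thus
accepted, and an execution can only be accepted because of a chain. If `n` is in the set, every
execution has a chain ordered in time and all words are accepted (`cAccepts_of_forall`). If not, the
execution that guesses a bad `f` has no chain and its spelling is rejected (`exists_not_cAccepts`).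

In the 2-tape version Player 2 writes two words. Different words are accepted at their first
difference; on equal words a number is remembered by leaving one head in front of its block. The
parameter `n` is only the length of the first block, checked by a row of `n + 2` states, so the
automata are computable from `n`. -/

namespace AutomataGames

open Filter

/-! ### A universal `Π¹₂` set -/

/-- The first `k` entries of `l`, padded with zeros. -/
def seg (l : List ℕ) (k : ℕ) : List ℕ := (List.range k).map fun i => l.getD i 0

theorem initSeg_length (f : ℕ → ℕ) (m : ℕ) : (initSeg f m).length = m := by simp [initSeg]

theorem seg_initSeg (f : ℕ → ℕ) {k m : ℕ} (h : k ≤ m) : seg (initSeg f m) k = initSeg f k := by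
  unfold seg initSeg
  refine List.map_congr_left fun i hi => ?_
  rw [List.mem_range] at hi
  rw [List.getD_eq_getElem _ _ (by simp; omega)]
  simp

theorem primrec_seg : Primrec₂ seg :=
  Primrec.list_map (Primrec.list_range.comp Primrec.snd)
    ((Primrec.list_getD 0).comp (Primrec.fst.comp Primrec.fst) Primrec.snd).to₂

/-- At length `m = ⟨k, s⟩`, the program with index `e` halts on the first `k` entries within
`s` steps, where the input is `⟨e, x⟩`. -/
def refuted (a : ℕ × List ℕ × List ℕ) : Bool :=
  (Nat.Partrec.Code.evaln a.2.1.length.unpair.2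
    (Denumerable.ofNat Nat.Partrec.Code a.1.unpair.1)
    (Encodable.encode (a.1.unpair.2, seg a.2.1 a.2.1.length.unpair.1,
      seg a.2.2 a.2.1.length.unpair.1))).isSome

theorem primrec_refuted : Primrec refuted := by
  have hlen : Primrec fun a : ℕ × List ℕ × List ℕ => a.2.1.length.unpair :=
    Primrec.unpair.comp (Primrec.list_length.comp (Primrec.fst.comp Primrec.snd))
  have hn : Primrec fun a : ℕ × List ℕ × List ℕ => a.1.unpair :=
    Primrec.unpair.comp Primrec.fst
  refine Primrec.option_isSome.comp (Nat.Partrec.Code.primrec_evaln.comp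
    (Primrec.pair (Primrec.pair (Primrec.snd.comp hlen)
      ((Primrec.ofNat Nat.Partrec.Code).comp (Primrec.fst.comp hn)))
      (Primrec.encode.comp (Primrec.pair (Primrec.snd.comp hn) (Primrec.pair ?_ ?_)))))
  · exact primrec_seg.comp (Primrec.fst.comp Primrec.snd) (Primrec.fst.comp hlen)
  · exact primrec_seg.comp (Primrec.snd.comp Primrec.snd) (Primrec.fst.comp hlen)

def universalSet : Set ℕ :=
  {n | ∀ f : ℕ → ℕ, ∃ g : ℕ → ℕ, ∀ m, refuted (n, initSeg f m, initSeg g m) = false}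

theorem isPi12_universalSet : IsPi12 universalSet := by
  refine ⟨fun n f g => ∀ m, refuted (n, initSeg f m, initSeg g m) = false,
    ⟨fun a => refuted a = false, ⟨fun a => inferInstance, ?_⟩, fun _ _ _ => Iff.rfl⟩,
    fun _ => Iff.rfl⟩
  refine (Primrec.not.comp primrec_refuted).to_comp.of_eq fun a => ?_
  cases h : refuted a <;> simp [h]

/-- A failure of a `Π⁰₁` condition is witnessed at a finite level, and there by a halting
computation. -/
theorem exists_code_of_computablePred {R : ℕ × List ℕ × List ℕ → Prop} (hR : ComputablePred R) :
    ∃ c : Nat.Partrec.Code, ∀ a, (∃ x, x ∈ c.eval (Encodable.encode a)) ↔ ¬ R a := by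
  have h : REPred fun a => ¬ R a := hR.not.to_re
  obtain ⟨c, hc⟩ := Nat.Partrec.Code.exists_code.1 h
  refine ⟨c, fun a => ?_⟩
  simp only [hc, Encodable.encodek, Part.coe_some, Part.bind_some]
  simp [Part.mem_assert_iff]

/-- Pairing with an index for the failures of `R` is the injective reduction. As `m = ⟨k, s⟩` ranges
over all numbers, every level `k` is tested with every time bound `s`, so the bounded tests together
detect every failure. -/
theorem isPi12Complete_universalSet : IsPi12Complete universalSet := by
  refine ⟨isPi12_universalSet, ?_⟩
  rintro T ⟨P, ⟨R, hR, hP⟩, hT⟩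
  obtain ⟨c, hc⟩ := exists_code_of_computablePred hR
  refine ⟨fun n => Nat.pair (Encodable.encode c) n,
    (Primrec₂.natPair.comp (Primrec.const _) Primrec.id).to_comp,
    fun a b h => (Nat.pair_eq_pair.1 h).2, fun n => ?_⟩
  change n ∈ T ↔ Nat.pair (Encodable.encode c) n ∈ universalSet
  rw [hT]
  refine forall_congr' fun f => exists_congr fun g => ?_
  rw [hP]
  have key : ∀ m, refuted (Nat.pair (Encodable.encode c) n, initSeg f m, initSeg g m) =
      (Nat.Partrec.Code.evaln m.unpair.2 c (Encodable.encode
        (n, initSeg f m.unpair.1, initSeg g m.unpair.1))).isSome := by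
    intro m
    simp only [refuted, Nat.unpair_pair, Denumerable.ofNat_encode, initSeg_length,
      seg_initSeg _ (Nat.unpair_left_le m)]
  simp only [key]
  constructor
  · intro h m
    by_contra hs
    rw [Bool.not_eq_false, Option.isSome_iff_exists] at hs
    obtain ⟨x, hx⟩ := hs
    exact (hc _).1 ⟨x, Nat.Partrec.Code.evaln_sound hx⟩ (h m.unpair.1)
  · intro h k
    by_contra hk
    obtain ⟨x, hx⟩ := (hc (n, initSeg f k, initSeg g k)).2 hk
    obtain ⟨s, hs⟩ := Nat.Partrec.Code.evaln_complete.1 hx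
    have := h (Nat.pair k s)
    rw [Nat.unpair_pair] at this
    rw [Option.mem_def.1 hs] at this
    simp at this

/-! ### The tree of attempted witnesses -/

/-- A stage is coded by the reversed list `y` of the values of `f` seen so far, and its number is
the length of that list. -/
def stage (y : ℕ) : ℕ := (Denumerable.ofNat (List ℕ) y).length

/-- This is the code of `a :: l` when `y` codes `l`. Storing `f` in reverse makes adding a value a
single arithmetic operation. -/
def extend (a y : ℕ) : ℕ := Nat.succ (Nat.pair a y)

/-- The parent of the node introduced at the stage `y`; a node that is refuted is its own parent. -/
def parent (n y : ℕ) : ℕ :=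
  bif refuted (n,
      seg (Denumerable.ofNat (List ℕ) y).reverse (Denumerable.ofNat (List ℕ) (stage y)).length,
      (Denumerable.ofNat (List ℕ) (stage y)).reverse) then stage y
  else Encodable.encode (Denumerable.ofNat (List ℕ) (stage y)).tail

theorem primrec_stage : Primrec stage := Primrec.list_length.comp (Primrec.ofNat _)

theorem primrec_extend : Primrec₂ extend := Primrec.succ.comp₂ Primrec₂.natPair

theorem primrec_parent : Primrec₂ parent := by
  have hy : Primrec fun a : ℕ × ℕ => Denumerable.ofNat (List ℕ) a.2 :=
    (Primrec.ofNat _).comp Primrec.snd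
  have ht : Primrec fun a : ℕ × ℕ => stage a.2 := primrec_stage.comp Primrec.snd
  have hs : Primrec fun a : ℕ × ℕ => Denumerable.ofNat (List ℕ) (stage a.2) :=
    (Primrec.ofNat _).comp ht
  refine Primrec.cond (primrec_refuted.comp (Primrec.pair Primrec.fst (Primrec.pair ?_ ?_))) ht
    (Primrec.encode.comp (Primrec.list_tail.comp hs))
  · exact primrec_seg.comp (Primrec.list_reverse.comp hy) (Primrec.list_length.comp hs)
  · exact Primrec.list_reverse.comp hs

/-- The code of the reversed initial segment of length `t`. -/
def prefixCode (f : ℕ → ℕ) (t : ℕ) : ℕ := Encodable.encode (initSeg f t).reverse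

theorem prefixCode_zero (f : ℕ → ℕ) : prefixCode f 0 = 0 := by simp [prefixCode, initSeg]

theorem prefixCode_succ (f : ℕ → ℕ) (t : ℕ) :
    prefixCode f (t + 1) = extend (f t) (prefixCode f t) := by
  simp [prefixCode, initSeg, List.range_succ, extend]

theorem stage_prefixCode (f : ℕ → ℕ) (t : ℕ) : stage (prefixCode f t) = t := by
  simp [stage, prefixCode, initSeg]

/-- A child has a larger code than its parent and so appears at a later stage; this is what puts the
chain of a good `g` in temporal order. -/
theorem prefixCode_strictMono (f : ℕ → ℕ) : StrictMono (prefixCode f) :=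
  strictMono_nat_of_lt_succ fun t => by
    rw [prefixCode_succ]; exact Nat.lt_succ_of_le (Nat.right_le_pair _ _)

/-- The `t` values of `f` known at stage `t` are enough to test the node `t`. -/
theorem length_ofNat_le (t : ℕ) : (Denumerable.ofNat (List ℕ) t).length ≤ t := by
  suffices h : ∀ l : List ℕ, l.length ≤ Encodable.encode l by
    simpa using h (Denumerable.ofNat (List ℕ) t)
  intro l
  induction l with
  | nil => simp
  | cons a l ih =>
    simp only [List.length_cons, Encodable.encode_list_cons]
    exact Nat.succ_le_succ (ih.trans (Nat.right_le_pair _ _))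

theorem parent_prefixCode (n : ℕ) (f : ℕ → ℕ) (t : ℕ) :
    parent n (prefixCode f t) =
      bif refuted (n, initSeg f (Denumerable.ofNat (List ℕ) t).length,
        (Denumerable.ofNat (List ℕ) t).reverse) then t
      else Encodable.encode (Denumerable.ofNat (List ℕ) t).tail := by
  rw [parent, stage_prefixCode]
  have : (Denumerable.ofNat (List ℕ) (prefixCode f t)).reverse = initSeg f t := by
    simp [prefixCode]
  rw [this, seg_initSeg _ (length_ofNat_le t)]

/-- A good witness gives an infinite path through the tree. -/
theorem parent_prefixCode_of_forall {n : ℕ} {f g : ℕ → ℕ}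
    (h : ∀ m, refuted (n, initSeg f m, initSeg g m) = false) (i : ℕ) :
    parent n (prefixCode f (prefixCode g (i + 1))) = prefixCode g i := by
  have e : Denumerable.ofNat (List ℕ) (prefixCode g (i + 1)) = (initSeg g (i + 1)).reverse := by
    simp [prefixCode]
  rw [parent_prefixCode, e, List.reverse_reverse, List.length_reverse, initSeg_length, h]
  simp [prefixCode, initSeg, List.range_succ]

/-- An infinite path through the tree gives a good witness. -/
theorem exists_forall_of_path {n : ℕ} {f v : ℕ → ℕ} (h0 : v 0 = 0) (hpos : ∀ i, 0 < v (i + 1))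
    (h : ∀ i, parent n (prefixCode f (v (i + 1))) = v i) :
    ∃ g : ℕ → ℕ, ∀ m, refuted (n, initSeg f m, initSeg g m) = false := by
  -- A repetition would propagate down the path: if `v (i + 1) = v (i + 2)`, then taking parents
  -- gives `v i = v (i + 1)`, and finally `v 0 = v 1`. Hence no node of the path is refuted.
  have hne : ∀ i, v i ≠ v (i + 1) := by
    intro i
    induction i with
    | zero => rw [h0]; exact (hpos 0).ne
    | succ i ih =>
      intro e
      have h1 := h (i + 1)
      rw [← e, h i] at h1
      exact ih h1
  have hgood : ∀ i, refuted (n, initSeg f (Denumerable.ofNat (List ℕ) (v (i + 1))).length,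
        (Denumerable.ofNat (List ℕ) (v (i + 1))).reverse) = false ∧
      Encodable.encode (Denumerable.ofNat (List ℕ) (v (i + 1))).tail = v i := by
    intro i
    have h1 := h i
    rw [parent_prefixCode] at h1
    cases hr : refuted (n, initSeg f (Denumerable.ofNat (List ℕ) (v (i + 1))).length,
        (Denumerable.ofNat (List ℕ) (v (i + 1))).reverse)
    · rw [hr] at h1; exact ⟨rfl, h1⟩
    · rw [hr] at h1; exact absurd h1.symm (hne i)
  refine ⟨fun i => (Denumerable.ofNat (List ℕ) (v (i + 1))).headD 0, ?_⟩
  set g : ℕ → ℕ := fun i => (Denumerable.ofNat (List ℕ) (v (i + 1))).headD 0 with hg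
  -- Each step of the path adds one value at the head of the list, so the nodes are the prefixes of
  -- `g`.
  have hl : ∀ i, Denumerable.ofNat (List ℕ) (v i) = (initSeg g i).reverse := by
    intro i
    induction i with
    | zero => rw [h0]; simp [initSeg]
    | succ i ih =>
      have h2 : (Denumerable.ofNat (List ℕ) (v (i + 1))).tail = (initSeg g i).reverse := by
        rw [← ih, ← (hgood i).2, Denumerable.ofNat_encode]
      have h3 : Denumerable.ofNat (List ℕ) (v (i + 1)) ≠ [] := by
        intro e
        have := congrArg Encodable.encode e
        rw [Denumerable.encode_ofNat, Encodable.encode_list_nil] at this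
        exact (hpos i).ne' this
      have h4 : g i = (Denumerable.ofNat (List ℕ) (v (i + 1))).headD 0 := rfl
      revert h2 h3 h4
      cases Denumerable.ofNat (List ℕ) (v (i + 1)) with
      | nil => simp
      | cons a l =>
        intro h2 _ h4
        simp only [List.tail_cons, List.headD_cons] at h2 h4
        simp [initSeg, List.range_succ, h2, h4]
  intro m
  obtain _ | i := m
  -- At level zero the time bound is zero, so nothing is refuted.
  · simp [refuted, initSeg, Nat.Partrec.Code.evaln]
  have := (hgood i).1
  rwa [hl, List.reverse_reverse, List.length_reverse, initSeg_length] at this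

/-! ### Nondeterministic register programs -/

/-- The operation `(d, cs)` assigns to the register `d` some number `m` with `m = r j + δ` for all
`(j, δ)` in `cs`. -/
abbrev Op : Type := ℕ × List (ℕ × Bool)

/-- With no constraint the operation is a free guess, with one it copies or increments, and with two
it tests an equality. -/
def Op.Ok (o : Op) (r : ℕ → ℕ) (m : ℕ) : Prop := ∀ c ∈ o.2, m = r c.1 + c.2.toNat

inductive Prog : Type
  | op (o : Op) : Prog
  | seq (p q : Prog) : Prog
  | loop (p : Prog) : Prog

namespace Prog

/-- The input-output relation of a program. -/
def Rel : Prog → (ℕ → ℕ) → (ℕ → ℕ) → Prop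
  | op o => fun r r' => ∃ m, o.Ok r m ∧ r' = Function.update r o.1 m
  | seq p q => fun r r' => ∃ r₁, p.Rel r r₁ ∧ q.Rel r₁ r'
  | loop p => Relation.ReflTransGen p.Rel

/-- Provided that the register `1` is zero, `p` stores `F r` in the register `o` and preserves the
other registers below `s`. -/
def Computes (p : Prog) (o s : ℕ) (F : (ℕ → ℕ) → ℕ) : Prop :=
  ∀ r, r 1 = 0 → (∃ r', p.Rel r r') ∧
    ∀ r', p.Rel r r' → r' o = F r ∧ ∀ j < s, j ≠ o → r' j = r j

theorem computes_op (o s : ℕ) {i : ℕ} (δ : Bool) :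
    (op (o, [(i, δ)])).Computes o s fun r => r i + δ.toNat := by
  intro r _
  refine ⟨⟨_, r i + δ.toNat, by simp [Op.Ok], rfl⟩, ?_⟩
  rintro r' ⟨m, hm, rfl⟩
  have : m = r i + δ.toNat := by simpa [Op.Ok] using hm
  exact ⟨by simp [this], fun j _ hj => by simp [hj]⟩

/-- The values are computed one after another, with workspace from `s + n` on. By `hG` the results
stored earlier do not disturb the later ones. -/
theorem exists_computes_family {n s : ℕ} {G : Fin n → (ℕ → ℕ) → ℕ} (hs : 1 < s)
    (hG : ∀ i r r', (∀ j < s, r' j = r j) → G i r' = G i r)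
    (h : ∀ i : Fin n, ∃ p : Prog, p.Computes (s + i) (s + n) (G i)) (k : ℕ) (hk : k ≤ n) :
    ∃ p : Prog, ∀ r, r 1 = 0 → (∃ r', p.Rel r r') ∧ ∀ r', p.Rel r r' →
      (∀ i : Fin n, (i : ℕ) < k → r' (s + i) = G i r) ∧ ∀ j < s, r' j = r j := by
  induction k with
  | zero =>
    -- Copying a register to itself serves as the empty program.
    refine ⟨op (0, [(0, false)]), fun r hr => ?_⟩
    obtain ⟨h1, h2⟩ := computes_op 0 s (i := 0) false r hr
    refine ⟨h1, fun r' hr' => ⟨by simp, fun j hj => ?_⟩⟩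
    by_cases h0 : j = 0
    · subst h0; simpa using (h2 r' hr').1
    · exact (h2 r' hr').2 j hj h0
  | succ k ih =>
    obtain ⟨p, hp⟩ := ih (by omega)
    obtain ⟨q, hq⟩ := h ⟨k, by omega⟩
    refine ⟨seq p q, fun r hr => ?_⟩
    obtain ⟨⟨r₁, h1⟩, h2⟩ := hp r hr
    refine ⟨?_, ?_⟩
    · obtain ⟨⟨r₂, h3⟩, -⟩ := hq r₁ (((h2 r₁ h1).2 1 hs).trans hr)
      exact ⟨r₂, r₁, h1, h3⟩
    · rintro r₂ ⟨r₁, h1, h3⟩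
      obtain ⟨h4, h5⟩ := h2 r₁ h1
      obtain ⟨h6, h7⟩ := (hq r₁ ((h5 1 hs).trans hr)).2 r₂ h3
      refine ⟨fun i hi => ?_, fun j hj => (h7 j (by omega) (by simp; omega)).trans (h5 j hj)⟩
      by_cases hik : (i : ℕ) = k
      · subst hik
        exact h6.trans (hG _ _ _ h5)
      · rw [h7 (s + i) (by omega) (by simp; omega)]
        exact h4 i (by omega)

/-- The register `s` counts the iterations, `s + 1` accumulates, and `s + 2` receives the new value.
The loop may be left at any moment, but the equality test after it blocks unless the count equals
the argument, so the nondeterminism cannot change the result. -/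
theorem exists_computes_prec {n s o : ℕ} {f : List.Vector ℕ n → ℕ} {g : List.Vector ℕ (n + 2) → ℕ}
    {ρ : Fin (n + 1) → ℕ} (hρ : ∀ i, ρ i < s) (hs : 1 < s)
    {pf pg : Prog}
    (hf : pf.Computes (s + 1) (s + 3) fun r => f (List.Vector.ofFn fun i : Fin n => r (ρ i.succ)))
    (hg : pg.Computes (s + 2) (s + 3) fun r =>
      g (r s ::ᵥ r (s + 1) ::ᵥ List.Vector.ofFn fun i : Fin n => r (ρ i.succ))) :
    ∃ p : Prog, p.Computes o s fun r =>
      Nat.rec (f (List.Vector.ofFn fun i : Fin n => r (ρ i.succ)))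
        (fun y IH => g (y ::ᵥ IH ::ᵥ List.Vector.ofFn fun i : Fin n => r (ρ i.succ)))
        (r (ρ 0)) := by
  set body : Prog := seq pg (seq (op (s + 1, [(s + 2, false)])) (op (s, [(s, true)]))) with hbody
  have body_spec : ∀ r, r 1 = 0 → (∃ r', body.Rel r r') ∧ ∀ r', body.Rel r r' →
      r' s = r s + 1 ∧
      r' (s + 1) = g (r s ::ᵥ r (s + 1) ::ᵥ List.Vector.ofFn fun i : Fin n => r (ρ i.succ)) ∧
      ∀ j < s, r' j = r j := by
    intro r hr
    refine ⟨?_, ?_⟩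
    · obtain ⟨⟨r₁, h1⟩, h2⟩ := hg r hr
      exact ⟨_, r₁, h1, _, ⟨r₁ (s + 2), by simp [Op.Ok], rfl⟩, ⟨_, by simp [Op.Ok]; rfl, rfl⟩⟩
    · rintro r' ⟨r₁, h1, r₂, ⟨m, hm, rfl⟩, ⟨m', hm', rfl⟩⟩
      obtain ⟨h2, h3⟩ := (hg r hr).2 r₁ h1
      have e1 : m = r₁ (s + 2) := by simpa [Op.Ok] using hm
      have e2 : m' = r₁ s + 1 := by simpa [Op.Ok] using hm'
      refine ⟨by simp [e2, h3 s], by simp [e1, h2], fun j hj => ?_⟩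
      rw [Function.update_of_ne (by simp; omega), Function.update_of_ne (by simp; omega)]
      exact h3 j (by omega) (by omega)
  have loop_sound : ∀ r r', r 1 = 0 → r s = 0 →
      r (s + 1) = f (List.Vector.ofFn fun i : Fin n => r (ρ i.succ)) →
      Relation.ReflTransGen body.Rel r r' →
      r' (s + 1) = Nat.rec (f (List.Vector.ofFn fun i : Fin n => r (ρ i.succ)))
        (fun y IH => g (y ::ᵥ IH ::ᵥ List.Vector.ofFn fun i : Fin n => r (ρ i.succ))) (r' s) ∧
      ∀ j < s, r' j = r j := by
    intro r r' h1 h0 hacc hrel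
    induction hrel with
    | refl => simp [h0, hacc]
    | tail _ hst ih =>
      obtain ⟨ih1, ih2⟩ := ih
      obtain ⟨e1, e2, e3⟩ := (body_spec _ ((ih2 1 hs).trans h1)).2 _ hst
      refine ⟨?_, fun j hj => (e3 j hj).trans (ih2 j hj)⟩
      rw [e1, e2, ih1]
      simp only [ih2 _ (hρ _)]
  have loop_total : ∀ r, r 1 = 0 → r s = 0 →
      r (s + 1) = f (List.Vector.ofFn fun i : Fin n => r (ρ i.succ)) → ∀ N,
      ∃ r', Relation.ReflTransGen body.Rel r r' ∧ r' s = N := by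
    intro r h1 h0 hacc N
    induction N with
    | zero => exact ⟨r, .refl, h0⟩
    | succ N ih =>
      obtain ⟨r₁, h2, h3⟩ := ih
      have h4 := (loop_sound r r₁ h1 h0 hacc h2).2 1 hs
      obtain ⟨⟨r₂, h5⟩, h6⟩ := body_spec r₁ (h4.trans h1)
      exact ⟨r₂, h2.tail h5, by rw [(h6 r₂ h5).1, h3]⟩
  -- Register `1` supplies the initial zero of the count; the operation with two constraints is the
  -- exit test.
  refine ⟨seq (op (s, [(1, false)])) (seq pf (seq (loop body)
    (seq (op (s, [(s, false), (ρ 0, false)])) (op (o, [(s + 1, false)]))))), fun r hr => ?_⟩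
  have hρ0 := hρ 0
  have init_spec : ∀ r₁, pf.Rel (Function.update r s 0) r₁ → r₁ 1 = 0 ∧ r₁ s = 0 ∧
      r₁ (s + 1) = f (List.Vector.ofFn fun i : Fin n => r₁ (ρ i.succ)) ∧ ∀ j < s, r₁ j = r j := by
    intro r₁ h
    obtain ⟨h1, h2⟩ := (hf (Function.update r s 0) (by
      rw [Function.update_of_ne (by omega)]; exact hr)).2 r₁ h
    have h3 : ∀ j < s, r₁ j = r j := fun j hj => by
      rw [h2 j (by omega) (by omega), Function.update_of_ne (by omega)]
    have h4 : ∀ j < s, Function.update r s 0 j = r₁ j := fun j hj => by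
      rw [h3 j hj, Function.update_of_ne (by omega)]
    refine ⟨(h3 1 hs).trans hr, ?_, ?_, h3⟩
    · rw [h2 s (by omega) (by omega), Function.update_self]
    · rw [h1]; simp only [h4 _ (hρ _)]
  refine ⟨?_, ?_⟩
  · obtain ⟨⟨r₁, h1⟩, -⟩ := hf (Function.update r s 0) (by
      rw [Function.update_of_ne (by omega)]; exact hr)
    obtain ⟨a1, a2, a3, a4⟩ := init_spec r₁ h1
    obtain ⟨r₂, h2, h3⟩ := loop_total r₁ a1 a2 a3 (r (ρ 0))
    have h4 := (loop_sound r₁ r₂ a1 a2 a3 h2).2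
    refine ⟨_, _, ⟨0, by simp [Op.Ok, hr], rfl⟩, r₁, h1, r₂, h2, _, ⟨r₂ s, ?_, rfl⟩,
      ⟨_, by simp [Op.Ok]; rfl, rfl⟩⟩
    simp [Op.Ok, h3, h4 _ hρ0, a4 _ hρ0]
  · rintro r' ⟨_, ⟨m, hm, rfl⟩, r₁, h1, r₂, h2, _, ⟨m₂, hm₂, rfl⟩, ⟨m₃, hm₃, rfl⟩⟩
    have e0 : m = 0 := by simpa [Op.Ok, hr] using hm
    subst e0
    obtain ⟨a1, a2, a3, a4⟩ := init_spec r₁ h1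
    obtain ⟨b1, b2⟩ := loop_sound r₁ r₂ a1 a2 a3 h2
    have e2 : m₂ = r₂ s ∧ m₂ = r₂ (ρ 0) := by simpa [Op.Ok] using hm₂
    have e3 : m₃ = r₂ (s + 1) := by simpa [Op.Ok] using hm₃
    refine ⟨?_, fun j hj hjo => ?_⟩
    · rw [Function.update_self, e3, b1, ← e2.1, e2.2, b2 _ hρ0, a4 _ hρ0]
      simp only [a4 _ (hρ _)]
    · rw [Function.update_of_ne hjo, Function.update_of_ne (by simp; omega), b2 j hj, a4 j hj]

/-- Induction on the primitive recursive definition. Leaving the argument registers `ρ`, the output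
`o` and the start `s` of the free workspace arbitrary lets subprograms be compiled onto fresh
registers. -/
theorem exists_computes_of_primrec {n : ℕ} {f : List.Vector ℕ n → ℕ} (hf : Nat.Primrec' f) :
    ∀ (ρ : Fin n → ℕ) (o s : ℕ), (∀ i, ρ i < s) → 1 < s →
      ∃ p : Prog, p.Computes o s fun r => f (List.Vector.ofFn fun i => r (ρ i)) := by
  induction hf with
  | zero =>
    intro ρ o s _ _
    refine ⟨op (o, [(1, false)]), fun r hr => ?_⟩
    simpa [hr] using computes_op o s (i := 1) false r hr
  | succ =>
    intro ρ o s _ _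
    exact ⟨op (o, [(ρ 0, true)]), computes_op o s true⟩
  | get i =>
    intro ρ o s _ _
    refine ⟨op (o, [(ρ i, false)]), ?_⟩
    simpa using computes_op o s (i := ρ i) false
  | @comp m n f g _ _ ihf ihg =>
    intro ρ o s hρ hs
    obtain ⟨p, hp⟩ := exists_computes_family (n := n) (s := s)
      (G := fun i r => g i (List.Vector.ofFn fun i => r (ρ i))) hs
      (fun i r r' h => by simp only [h _ (hρ _)])
      (fun i => ihg i ρ (s + i) (s + n) (fun j => (hρ j).trans_le (by omega)) (by omega))
      n le_rfl
    obtain ⟨q, hq⟩ := ihf (fun i => s + i) o (s + n) (fun i => by simp) (by omega)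
    refine ⟨seq p q, fun r hr => ?_⟩
    obtain ⟨⟨r₁, h1⟩, h2⟩ := hp r hr
    refine ⟨?_, ?_⟩
    · obtain ⟨⟨r₂, h3⟩, -⟩ := hq r₁ (((h2 r₁ h1).2 1 hs).trans hr)
      exact ⟨r₂, r₁, h1, h3⟩
    · rintro r₂ ⟨r₁, h1, h3⟩
      obtain ⟨h4, h5⟩ := h2 r₁ h1
      obtain ⟨h6, h7⟩ := (hq r₁ ((h5 1 hs).trans hr)).2 r₂ h3
      refine ⟨?_, fun j hj hjo => (h7 j (by omega) hjo).trans (h5 j hj)⟩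
      rw [h6]
      simp only [h4 _ (Fin.is_lt _)]
  | @prec n f g _ _ ihf ihg =>
    intro ρ o s hρ hs
    obtain ⟨pf, hpf⟩ := ihf (fun i => ρ i.succ) (s + 1) (s + 3)
      (fun i => (hρ _).trans_le (by omega)) (by omega)
    obtain ⟨pg, hpg⟩ := ihg (Fin.cons s (Fin.cons (s + 1) fun i => ρ i.succ)) (s + 2) (s + 3)
      (fun i => by
        refine Fin.cases ?_ (fun i => Fin.cases ?_ (fun i => ?_) i) i
        · simp
        · simp
        · simpa using (hρ i.succ).trans_le (by omega)) (by omega)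
    exact exists_computes_prec hρ hs hpf hpg

end Prog

/-! ### Gluing finite paths -/

theorem exists_block {p : ℕ → ℕ} (hp : StrictMono p) (h0 : p 0 = 0) (t : ℕ) :
    ∃ k, p k ≤ t ∧ t < p (k + 1) := by
  induction t with
  | zero => exact ⟨0, h0.le, by have := hp Nat.zero_lt_one; rwa [h0] at this⟩
  | succ t ih =>
    obtain ⟨k, h1, h2⟩ := ih
    by_cases h : t + 1 < p (k + 1)
    · exact ⟨k, by omega, h⟩
    · exact ⟨k + 1, by omega, by have := hp (Nat.lt_succ_self (k + 1)); simp at this; omega⟩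

theorem block_unique {p : ℕ → ℕ} (hp : StrictMono p) {t k k' : ℕ} (h1 : p k ≤ t)
    (h2 : t < p (k + 1)) (h1' : p k' ≤ t) (h2' : t < p (k' + 1)) : k = k' := by
  have a := hp.lt_iff_lt.1 (h1.trans_lt h2')
  have b := hp.lt_iff_lt.1 (h1'.trans_lt h2)
  omega

/-- The finite sequences `u k 0, …, u k (L k - 1)` are joined into an infinite one, in which the
`k`-th sequence begins at the position `p k`. -/
theorem exists_glue {Z : Type*} (L : ℕ → ℕ) (hL : ∀ k, 0 < L k) (u : ℕ → ℕ → Z) :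
    ∃ (p : ℕ → ℕ) (w : ℕ → Z), StrictMono p ∧ p 0 = 0 ∧ (∀ k, p (k + 1) = p k + L k) ∧
      ∀ k i, i < L k → w (p k + i) = u k i := by
  let p : ℕ → ℕ := fun k => Nat.rec 0 (fun k x => x + L k) k
  have hsucc : ∀ k, p (k + 1) = p k + L k := fun k => rfl
  have hp : StrictMono p := strictMono_nat_of_lt_succ fun k => by
    rw [hsucc]; exact Nat.lt_add_of_pos_right (hL k)
  choose blk hb1 hb2 using exists_block hp rfl
  refine ⟨p, fun t => u (blk t) (t - p (blk t)), hp, rfl, hsucc, fun k i hi => ?_⟩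
  have : blk (p k + i) = k :=
    block_unique hp (hb1 _) (hb2 _) (by omega) (by rw [hsucc]; omega)
  simp only [this]
  congr 1
  omega

theorem exists_path_of_transGen {Z : Type*} {step : Z → Z → Prop} {a b : Z}
    (h : Relation.TransGen step a b) :
    ∃ (L : ℕ) (u : ℕ → Z), 0 < L ∧ u 0 = a ∧ u L = b ∧ ∀ i < L, step (u i) (u (i + 1)) := by
  induction h with
  | single h =>
    rename_i b
    exact ⟨1, fun i => if i = 0 then a else b, by simp, by simp, by simp, by simpa using h⟩
  | tail hab hs ih =>
    rename_i c
    obtain ⟨L, u, hL, h0, h1, h2⟩ := ih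
    refine ⟨L + 1, fun i => if i ≤ L then u i else c, by omega, by simp [h0], by simp,
      fun i hi => ?_⟩
    by_cases hiL : i = L
    · subst hiL; simpa [h1] using hs
    · simpa [show i ≤ L by omega, show i + 1 ≤ L by omega] using h2 i (by omega)

/-- Infinite runs are built from milestones, each reached from the preceding one. That at least one
step lies between them makes the glued path infinite and the visiting times increasing. -/
theorem exists_infinite_path {Z : Type*} {step : Z → Z → Prop} {z : ℕ → Z}
    (h : ∀ i, Relation.TransGen step (z i) (z (i + 1))) :
    ∃ (p : ℕ → ℕ) (w : ℕ → Z), StrictMono p ∧ p 0 = 0 ∧ (∀ i, w (p i) = z i) ∧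
      ∀ i, step (w i) (w (i + 1)) := by
  choose L u hL h0 h1 h2 using fun i => exists_path_of_transGen (h i)
  obtain ⟨p, w, hp, hp0, hps, hw⟩ := exists_glue L hL u
  have hz : ∀ i, w (p i) = z i := fun i => by simpa [h0] using hw i 0 (hL i)
  refine ⟨p, w, hp, hp0, hz, fun t => ?_⟩
  obtain ⟨k, hk1, hk2⟩ := exists_block hp hp0 t
  obtain ⟨i, rfl⟩ := Nat.exists_eq_add_of_le hk1
  rw [hps] at hk2
  have hi : i < L k := by omega
  rw [hw k i hi]
  by_cases hi1 : i + 1 < L k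
  · rw [add_assoc, hw k _ hi1]; exact h2 k i hi
  · have e : p k + i + 1 = p (k + 1) := by rw [hps]; omega
    have := h2 k i hi
    rwa [show i + 1 = L k by omega, h1, ← hz, ← e] at this

/-! ### Positions in a program -/

namespace Prog

/-- Occurrences of operations; a loop has an additional idle operation at its head. -/
inductive Pos : Prog → Type
  | here (o : Op) : Pos (op o)
  | left {p : Prog} (q : Prog) (x : Pos p) : Pos (seq p q)
  | right (p : Prog) {q : Prog} (x : Pos q) : Pos (seq p q)
  | head (p : Prog) : Pos (loop p)
  | inside {p : Prog} (x : Pos p) : Pos (loop p)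

def opAt : {p : Prog} → Pos p → Op
  | _, .here o => o
  | _, .left _ x => opAt x
  | _, .right _ x => opAt x
  | _, .head _ => (0, [(0, false)])
  | _, .inside x => opAt x

/-- A loop is entered and left at its idle head, so that zero iterations are a path as well. -/
def first : (p : Prog) → Pos p
  | op o => .here o
  | seq p q => .left q p.first
  | loop p => .head p

def last : (p : Prog) → Pos p
  | op o => .here o
  | seq p q => .right p q.last
  | loop p => .head p

inductive Follow : {p : Prog} → Pos p → Pos p → Prop
  | left {p : Prog} (q : Prog) {x y : Pos p} : Follow x y → Follow (Pos.left q x) (.left q y)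
  | right (p : Prog) {q : Prog} {x y : Pos q} : Follow x y → Follow (Pos.right p x) (.right p y)
  | cross (p q : Prog) : Follow (Pos.left q p.last) (.right p q.first)
  | enter (p : Prog) : Follow (Pos.head p) (.inside p.first)
  | leave (p : Prog) : Follow (Pos.inside p.last) (.head p)
  | inside {p : Prog} {x y : Pos p} : Follow x y → Follow (Pos.inside x) (.inside y)

theorem finite_pos (p : Prog) : Finite (Pos p) := by
  induction p with
  | op o => exact Finite.of_surjective (fun _ : Unit => Pos.here o) (by rintro ⟨⟩; exact ⟨(), rfl⟩)
  | seq p q ihp ihq =>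
    refine Finite.of_surjective (Sum.elim (Pos.left q) (Pos.right p)) ?_
    intro x
    cases x with
    | left _ x => exact ⟨.inl x, rfl⟩
    | right _ x => exact ⟨.inr x, rfl⟩
  | loop p ih =>
    refine Finite.of_surjective (fun o : Option (Pos p) => o.elim (Pos.head p) Pos.inside) ?_
    intro x
    cases x with
    | head => exact ⟨none, rfl⟩
    | inside x => exact ⟨some x, rfl⟩

/-- A finite execution from the position `x` to the position `z`, both included. -/
inductive Path {p : Prog} : Pos p → (ℕ → ℕ) → Pos p → (ℕ → ℕ) → Prop
  | single {x : Pos p} {r : ℕ → ℕ} {m : ℕ} (h : (opAt x).Ok r m) :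
      Path x r x (Function.update r (opAt x).1 m)
  | cons {x y z : Pos p} {r r' : ℕ → ℕ} {m : ℕ} (h : (opAt x).Ok r m) (hf : Follow x y)
      (ht : Path y (Function.update r (opAt x).1 m) z r') : Path x r z r'

theorem Path.map {p q : Prog} {φ : Pos p → Pos q} (hop : ∀ x, opAt (φ x) = opAt x)
    (hφ : ∀ x y, Follow x y → Follow (φ x) (φ y)) {x z : Pos p} {r r' : ℕ → ℕ}
    (h : Path x r z r') : Path (φ x) r (φ z) r' := by
  induction h with
  | single h => rw [← hop] at h ⊢; exact .single h
  | cons h hf _ ih => rw [← hop] at h ih; exact .cons h (hφ _ _ hf) ih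

theorem Path.trans {p : Prog} {x y z w : Pos p} {r r₁ r' : ℕ → ℕ} (h : Path x r y r₁)
    (hf : Follow y z) (h' : Path z r₁ w r') : Path x r w r' := by
  induction h with
  | single h => exact .cons h hf h'
  | cons h hf' _ ih => exact .cons h hf' (ih hf h')

theorem ok_idle {r : ℕ → ℕ} {m : ℕ} : Op.Ok (0, [(0, false)]) r m ↔ m = r 0 := by simp [Op.Ok]

theorem path_of_rel {p : Prog} {r r' : ℕ → ℕ} (h : p.Rel r r') :
    Path p.first r p.last r' := by
  induction p generalizing r r' with
  | op o => obtain ⟨m, hm, rfl⟩ := h; exact Path.single (x := Pos.here o) hm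
  | seq p q ihp ihq =>
    obtain ⟨r₁, h1, h2⟩ := h
    exact ((ihp h1).map (φ := Pos.left q) (fun _ => rfl) fun _ _ => .left q).trans (.cross p q)
      ((ihq h2).map (φ := Pos.right p) (fun _ => rfl) fun _ _ => .right p)
  | loop p ih =>
    have idle : ∀ r, Path (Pos.head p) r (Pos.head p) r := fun r => by
      simpa [opAt] using Path.single (x := Pos.head p) (ok_idle.2 (rfl : r 0 = r 0))
    induction h with
    | refl => exact idle r
    | tail _ hs ih' =>
      exact (ih'.trans (.enter p) ((ih hs).map (φ := Pos.inside) (fun _ => rfl)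
        fun _ _ => .inside)).trans (.leave p) (idle _)

/-- Control never returns from the second part to the first, so a path that starts in the first part
has exactly one crossing, and it splits there. -/
theorem path_seq {p q : Prog} {x : Pos (seq p q)} {z : Pos (seq p q)} {r r' : ℕ → ℕ}
    (h : Path x r z r') : ∀ zq, z = .right p zq →
      (∀ xp, x = .left q xp → ∃ r₁, Path xp r p.last r₁ ∧ Path q.first r₁ zq r') ∧
      ∀ xq, x = .right p xq → Path xq r zq r' := by
  induction h with
  | single h =>
    rintro zq rfl
    exact ⟨by rintro xp ⟨⟩, by rintro xq ⟨⟩; exact .single h⟩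
  | cons h hf _ ih =>
    rintro zq rfl
    obtain ⟨ih1, ih2⟩ := ih zq rfl
    refine ⟨?_, ?_⟩
    · rintro xp rfl
      cases hf with
      | left _ hf =>
        obtain ⟨r₁, a, b⟩ := ih1 _ rfl
        exact ⟨r₁, .cons h hf a, b⟩
      | cross => exact ⟨_, .single h, ih2 _ rfl⟩
    · rintro xq rfl
      cases hf with
      | right _ hf => exact .cons h hf (ih2 _ rfl)

/-- Every return to the head completes an iteration. A path that starts inside the body first
finishes the current iteration, which is the second clause needed for the induction. -/
theorem path_loop {p : Prog} (hp : ∀ r r', Path p.first r p.last r' → p.Rel r r')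
    {x z : Pos (loop p)} {r r' : ℕ → ℕ} (h : Path x r z r') (hz : z = .head p) :
      (x = .head p → Relation.ReflTransGen p.Rel r r') ∧
      ∀ y, x = .inside y → ∃ r₁, Path y r p.last r₁ ∧ Relation.ReflTransGen p.Rel r₁ r' := by
  have idle : ∀ (r : ℕ → ℕ) m, (opAt (Pos.head p)).Ok r m →
      Function.update r (opAt (Pos.head p)).1 m = r := by
    intro r m h
    rw [ok_idle.1 h]
    exact Function.update_eq_self _ _
  induction h with
  | single h =>
    subst hz
    exact ⟨fun _ => by rw [idle _ _ h], by rintro y ⟨⟩⟩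
  | cons h hf _ ih =>
    obtain ⟨ih1, ih2⟩ := ih hz
    refine ⟨?_, ?_⟩
    · rintro rfl
      cases hf with
      | enter =>
        obtain ⟨r₁, a, b⟩ := ih2 _ rfl
        rw [idle _ _ h] at a
        exact .head (hp _ _ a) b
    · rintro y rfl
      cases hf with
      | leave => exact ⟨_, .single h, ih1 rfl⟩
      | inside hf =>
        obtain ⟨r₁, a, b⟩ := ih2 _ rfl
        exact ⟨r₁, .cons h hf a, b⟩

theorem rel_of_path {p : Prog} {r r' : ℕ → ℕ} (h : Path p.first r p.last r') : p.Rel r r' := by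
  induction p generalizing r r' with
  | op o =>
    generalize hx : first (op o) = x at h
    cases h with
    | single h => exact ⟨_, h, rfl⟩
    | cons _ hf _ => subst hx; cases hf
  | seq p q ihp ihq =>
    obtain ⟨r₁, a, b⟩ := (path_seq h _ rfl).1 _ rfl
    exact ⟨r₁, ihp a, ihq b⟩
  | loop p ih => exact (path_loop (fun _ _ => ih) h rfl).1 rfl

end Prog

/-! ### Systems of operations and their infinite executions -/

/-- A control graph whose vertices are operations. -/
structure OpSystem (E : Type) where
  op : E → Op
  Follow : E → E → Prop
  init : E
  par : E
  chi : E
  op_init : (op init).2 = []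
  par_ne_init : par ≠ init
  par_ne_chi : par ≠ chi

namespace OpSystem

variable {E : Type} (S : OpSystem E)

/-- The registers before the `k`-th operation. -/
def regs (e : ℕ → E) (m : ℕ → ℕ) : ℕ → ℕ → ℕ
  | 0 => 0
  | k + 1 => Function.update (regs e m k) (S.op (e k)).1 (m k)

/-- An infinite execution that starts with storing `n` and performs `par` infinitely often. -/
structure IsExec (n : ℕ) (e : ℕ → E) (m : ℕ → ℕ) : Prop where
  init : e 0 = S.init
  input : m 0 = n
  follow : ∀ k, S.Follow (e k) (e (k + 1))
  ok : ∀ k, (S.op (e k)).Ok (S.regs e m k) (m k)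
  par : ∃ᶠ k in atTop, e k = S.par

/-- The operations `par` and `chi` are performed in succession with the values `v` and `w`. -/
def Linked (e : ℕ → E) (m : ℕ → ℕ) (v w : ℕ) : Prop :=
  ∃ k, e k = S.par ∧ e (k + 1) = S.chi ∧ m k = v ∧ m (k + 1) = w

def HasChain (e : ℕ → E) (m : ℕ → ℕ) : Prop :=
  ∃ v : ℕ → ℕ, v 0 = 0 ∧ ∀ i, S.Linked e m (v i) (v (i + 1))

-- A later `par` cannot coincide with the `chi` of an earlier link, so the block of that `chi` can
-- be read completely before the next comparison.
variable {S} in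
theorem lt_of_par_chi {e : ℕ → E} {k k' : ℕ} (h : e (k + 1) = S.chi) (h' : e k' = S.par)
    (hk : k < k') : k + 1 < k' := by
  refine lt_of_le_of_ne hk ?_
  rintro rfl
  exact S.par_ne_chi (h'.symm.trans h)

/-- The links occur in temporal order, as a one-way device needs. Members of the set provide this
strong form and non-members exclude even `HasChain`, so it suffices that acceptance of executions
lies between the two. -/
def HasOrderedChain (e : ℕ → E) (m : ℕ → ℕ) : Prop :=
  ∃ k : ℕ → ℕ, StrictMono k ∧ (∀ i, e (k i) = S.par ∧ e (k i + 1) = S.chi) ∧ m (k 0) = 0 ∧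
    ∀ i, m (k i + 1) = m (k (i + 1))

end OpSystem

/-! ### The system that enumerates the tree of attempted witnesses -/

/-- The registers are: `0` the input, `1` zero, `2` the code of the current stage, `3` the next value
of `f`, `4` and `5` the parent and the node of the current stage. -/
structure IsCore (core : Prog) : Prop where
  total : ∀ r, r 1 = 0 → ∃ r', core.Rel r r'
  spec : ∀ r r', r 1 = 0 → core.Rel r r' → r' 0 = r 0 ∧ r' 1 = 0 ∧ r' 2 = extend (r 3) (r 2) ∧
    r' 4 = parent (r 0) (r' 2) ∧ r' 5 = stage (r' 2)

/-- The code of the stage is advanced first; parent and node are then computed from the new code.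
Registers from `6` on are workspace. -/
theorem exists_isCore : ∃ core : Prog, IsCore core := by
  obtain ⟨p, hp⟩ := Prog.exists_computes_of_primrec (Nat.Primrec'.prim_iff₂.2 primrec_extend)
    ![3, 2] 2 6 (by decide) (by decide)
  obtain ⟨q, hq⟩ := Prog.exists_computes_of_primrec (Nat.Primrec'.prim_iff₂.2 primrec_parent)
    ![0, 2] 4 6 (by decide) (by decide)
  obtain ⟨w, hw⟩ := Prog.exists_computes_of_primrec (Nat.Primrec'.prim_iff₁.2 primrec_stage)
    ![2] 5 6 (by decide) (by decide)
  refine ⟨.seq p (.seq q w), ⟨fun r hr => ?_, fun r r' hr => ?_⟩⟩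
  · obtain ⟨⟨r₁, h1⟩, h1'⟩ := hp r hr
    have hr₁ := ((h1' r₁ h1).2 1 (by decide) (by decide)).trans hr
    obtain ⟨⟨r₂, h2⟩, h2'⟩ := hq r₁ hr₁
    have hr₂ := ((h2' r₂ h2).2 1 (by decide) (by decide)).trans hr₁
    obtain ⟨⟨r₃, h3⟩, -⟩ := hw r₂ hr₂
    exact ⟨r₃, r₁, h1, r₂, h2, h3⟩
  · rintro ⟨r₁, h1, r₂, h2, h3⟩
    obtain ⟨a, a'⟩ := (hp r hr).2 r₁ h1
    have hr₁ := (a' 1 (by decide) (by decide)).trans hr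
    obtain ⟨b, b'⟩ := (hq r₁ hr₁).2 r₂ h2
    have hr₂ := (b' 1 (by decide) (by decide)).trans hr₁
    obtain ⟨c, c'⟩ := (hw r₂ hr₂).2 r' h3
    replace a : r₁ 2 = extend (r 3) (r 2) := a
    replace b : r₂ 4 = parent (r₁ 0) (r₁ 2) := b
    replace c : r' 5 = stage (r₂ 2) := c
    have a0 := a' 0 (by decide) (by decide)
    have b0 := b' 0 (by decide) (by decide)
    have c0 := c' 0 (by decide) (by decide)
    have b2 := b' 2 (by decide) (by decide)
    have c2 := c' 2 (by decide) (by decide)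
    refine ⟨by rw [c0, b0, a0], (c' 1 (by decide) (by decide)).trans hr₂, by rw [c2, b2, a], ?_, ?_⟩
    · rw [c' 4 (by decide) (by decide), b, c2, b2, a0]
    · rw [c, c2]

inductive TreeOp (P : Type) : Type
  | init : TreeOp P
  | guess : TreeOp P
  | core (x : P) : TreeOp P
  | par : TreeOp P
  | chi : TreeOp P

theorem TreeOp.finite (P : Type) [Finite P] : Finite (TreeOp P) := by
  refine Finite.of_surjective (fun x : P ⊕ Fin 4 =>
    x.elim TreeOp.core ![.init, .guess, .par, .chi]) ?_
  rintro (_ | _ | x | _ | _)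
  · exact ⟨.inr 0, rfl⟩
  · exact ⟨.inr 1, rfl⟩
  · exact ⟨.inl x, rfl⟩
  · exact ⟨.inr 2, rfl⟩
  · exact ⟨.inr 3, rfl⟩

inductive TreeFollow (c : Prog) : TreeOp (Prog.Pos c) → TreeOp (Prog.Pos c) → Prop
  | init : TreeFollow c .init .guess
  | guess : TreeFollow c .guess (.core c.first)
  | core {x y : Prog.Pos c} : Prog.Follow x y → TreeFollow c (.core x) (.core y)
  | par : TreeFollow c (.core c.last) .par
  | chi : TreeFollow c .par .chi
  | next : TreeFollow c .chi .guess

/-- `init` and `guess` are unconstrained: they take in the parameter and the next value of `f`.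
`par` and `chi` only display registers `4` and `5` as adjacent blocks; their targets `6` and `7` are
scratch registers of the core. -/
def treeSystem (c : Prog) : OpSystem (TreeOp (Prog.Pos c)) where
  op
    | .init => (0, [])
    | .guess => (3, [])
    | .core x => Prog.opAt x
    | .par => (6, [(4, false)])
    | .chi => (7, [(5, false)])
  Follow := TreeFollow c
  init := .init
  par := .par
  chi := .chi
  op_init := rfl
  par_ne_init := by rintro ⟨⟩
  par_ne_chi := by rintro ⟨⟩

/-! ### Executions of the tree system, for members and for non-members -/

section Executions

variable {c : Prog} (hc : IsCore c) {n : ℕ} {e : ℕ → TreeOp (Prog.Pos c)} {m : ℕ → ℕ}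

/-- The core might loop forever; the occurrence of `par` at time `b` excludes this, and control can
get there only through the last position of the core. -/
theorem exists_par_of_core (h : (treeSystem c).IsExec n e m) {b : ℕ} (hb : e b = .par) (d : ℕ) :
    ∀ a x, a + d = b → e a = .core x → ∃ k, a < k ∧ e k = .par ∧
      Prog.Path x ((treeSystem c).regs e m a) c.last ((treeSystem c).regs e m k) := by
  induction d with
  | zero => rintro a x rfl hx; rw [Nat.add_zero, hx] at hb; cases hb
  | succ d ih =>
    intro a x hab hx
    have hf := h.follow a
    have hok := h.ok a
    have hreg : (treeSystem c).regs e m (a + 1) =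
      Function.update ((treeSystem c).regs e m a) (Prog.opAt x).1 (m a) := by
      simp [OpSystem.regs, hx, treeSystem]
    rw [hx] at hf hok
    generalize hy : e (a + 1) = y at hf
    cases hf with
    | core hf =>
      obtain ⟨k, hk, h1, h2⟩ := ih (a + 1) _ (by omega) hy
      exact ⟨k, by omega, h1, .cons hok hf (hreg ▸ h2)⟩
    | par => exact ⟨a + 1, by omega, hy, hreg ▸ .single hok⟩

/-- Since `par` recurs, every guess is followed by a completed round of the core and the display of
a link. -/
theorem exists_next_guess (h : (treeSystem c).IsExec n e m) (k : ℕ) (hk : e k = .guess) :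
    ∃ k', k < k' ∧ e k' = .par ∧ e (k' + 1) = .chi ∧ e (k' + 2) = .guess ∧
      c.Rel ((treeSystem c).regs e m (k + 1)) ((treeSystem c).regs e m k') := by
  obtain ⟨b, hb, hpar⟩ := (frequently_atTop.1 h.par) (k + 1)
  have hf := h.follow k
  rw [hk] at hf
  generalize hy : e (k + 1) = y at hf
  cases hf
  obtain ⟨k', h1, h2, h3⟩ := exists_par_of_core h hpar (b - (k + 1)) (k + 1) _ (by omega) hy
  refine ⟨k', by omega, h2, ?_⟩
  have hf := h.follow k'
  rw [h2] at hf
  generalize hy : e (k' + 1) = y at hf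
  cases hf
  have hf := h.follow (k' + 1)
  rw [hy] at hf
  generalize hz : e (k' + 1 + 1) = z at hf
  cases hf
  exact ⟨rfl, rfl, Prog.rel_of_path h3⟩

-- The successive guesses form a function `f`, for which some `g` is good. The prefixes of `g` are
-- nodes with increasing codes, displayed at increasing times.
include hc in
theorem hasOrderedChain_of_mem (hn : n ∈ universalSet) (h : (treeSystem c).IsExec n e m) :
    (treeSystem c).HasOrderedChain e m := by
  choose! K hK hpar hchi hguess hrel using exists_next_guess h
  set R := (treeSystem c).regs e m with hR
  have regs_succ : ∀ k, R (k + 1) =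
    Function.update (R k) ((treeSystem c).op (e k)).1 (m k) := fun k => rfl
  -- `G t` is the time of the guess of `f t`; the first one comes right after `init`, at time `1`.
  let G : ℕ → ℕ := fun t => (fun k => K k + 2)^[t] 1
  have G_succ : ∀ t, G (t + 1) = K (G t) + 2 := fun t => Function.iterate_succ_apply' _ _ _
  have e1 : e 1 = .guess := by
    have hf := h.follow 0
    rw [h.init] at hf
    generalize hy : e (0 + 1) = y at hf
    cases hf; rfl
  have hG : ∀ t, e (G t) = .guess := by
    intro t
    induction t with
    | zero => exact e1
    | succ t ih => rw [G_succ]; exact hguess _ ih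
  let f : ℕ → ℕ := fun t => m (G t)
  have after_guess : ∀ t, R (G t + 1) = Function.update (R (G t)) 3 (f t) := fun t => by
    rw [regs_succ, hG]; rfl
  have inv : ∀ t, R (G t) 0 = n ∧ R (G t) 1 = 0 ∧ R (G t) 2 = prefixCode f t := by
    intro t
    induction t with
    | zero =>
      have : R (G 0) = Function.update (0 : ℕ → ℕ) 0 n := by
        change R (0 + 1) = _
        rw [regs_succ, h.init, h.input]; rfl
      rw [this, prefixCode_zero]
      exact ⟨rfl, rfl, rfl⟩
    | succ t ih =>
      obtain ⟨i0, i1, i2⟩ := ih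
      obtain ⟨s0, s1, s2, -, -⟩ := hc.spec _ _ (by rw [after_guess]; simpa using i1) (hrel _ (hG t))
      rw [after_guess] at s0 s2
      rw [G_succ, regs_succ, regs_succ, hpar _ (hG t), hchi _ (hG t), prefixCode_succ]
      simp [treeSystem, s0, s1, s2, i0, i2]
  -- The guess of `f t` leads to stage `t + 1`, so the node `w > 0` is displayed in round `w - 1`.
  -- The root `0` is never displayed as a node, only as a parent.
  have out : ∀ t, m (K (G t)) = parent n (prefixCode f (t + 1)) ∧ m (K (G t) + 1) = t + 1 := by
    intro t
    obtain ⟨i0, i1, i2⟩ := inv t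
    obtain ⟨s0, s1, s2, s4, s5⟩ := hc.spec _ _ (by rw [after_guess]; simpa using i1)
      (hrel _ (hG t))
    rw [after_guess] at s0 s2 s4
    have o1 := h.ok (K (G t))
    have o2 := h.ok (K (G t) + 1)
    rw [hpar _ (hG t)] at o1
    rw [hchi _ (hG t)] at o2
    have o1' : m (K (G t)) = R (K (G t)) 4 := o1 (4, false) (List.mem_singleton.2 rfl)
    have o2' : m (K (G t) + 1) = R (K (G t) + 1) 5 := o2 (5, false) (List.mem_singleton.2 rfl)
    rw [regs_succ, hpar _ (hG t)] at o2'
    have s2' : R (K (G t)) 2 = prefixCode f (t + 1) := by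
      rw [s2, prefixCode_succ]; simp [i2]
    refine ⟨by rw [o1', s4, s2']; simp [i0], ?_⟩
    rw [o2', ← stage_prefixCode f (t + 1), ← s2', ← s5]
    simp [treeSystem]
  obtain ⟨g, hg⟩ := hn f
  have hKG : StrictMono fun t => K (G t) := strictMono_nat_of_lt_succ fun t => by
    have := hK _ (hG (t + 1))
    rw [G_succ] at this ⊢
    omega
  have hpos : ∀ i, 0 < prefixCode g (i + 1) := fun i =>
    (Nat.zero_le _).trans_lt (prefixCode_strictMono g (Nat.lt_succ_self i))
  have hsub : ∀ i, prefixCode g (i + 1) - 1 + 1 = prefixCode g (i + 1) := fun i =>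
    Nat.sub_add_cancel (hpos i)
  refine ⟨fun i => K (G (prefixCode g (i + 1) - 1)), ?_, fun i => ⟨hpar _ (hG _), hchi _ (hG _)⟩,
    ?_, ?_⟩
  · refine hKG.comp (strictMono_nat_of_lt_succ fun i => ?_)
    have := prefixCode_strictMono g (Nat.lt_succ_self (i + 1))
    have := hpos i
    simp only [Nat.succ_eq_add_one] at *
    omega
  · rw [(out _).1, hsub, parent_prefixCode_of_forall hg, prefixCode_zero]
  · intro i
    rw [(out _).1, (out _).2, hsub, hsub, parent_prefixCode_of_forall hg]

/-- The configuration graph of the executions in which the guessed values are those of `f`. -/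
def TreeStep (c : Prog) (n : ℕ) (f : ℕ → ℕ) (z z' : TreeOp (Prog.Pos c) × (ℕ → ℕ)) : Prop :=
  ∃ m, ((treeSystem c).op z.1).Ok z.2 m ∧ z'.2 = Function.update z.2 ((treeSystem c).op z.1).1 m ∧
    TreeFollow c z.1 z'.1 ∧ (z.1 = .guess → m = f (stage (z.2 2))) ∧ (z.1 = .init → m = n)

theorem transGen_of_path {f : ℕ → ℕ} {x z : Prog.Pos c} {r r' : ℕ → ℕ}
    (h : Prog.Path x r z r') (hz : z = c.last) :
    Relation.TransGen (TreeStep c n f) (.core x, r) (.par, r') := by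
  induction h with
  | single h =>
    subst hz
    exact .single ⟨_, h, rfl, .par, by rintro ⟨⟩, by rintro ⟨⟩⟩
  | cons h hf _ ih =>
    exact .head ⟨_, h, rfl, .core hf, by rintro ⟨⟩, by rintro ⟨⟩⟩ (ih hz)

include hc in
theorem exists_transGen_guess (f : ℕ → ℕ) (r : ℕ → ℕ) (hr : r 1 = 0) :
    ∃ r', r' 1 = 0 ∧ Relation.TransGen (TreeStep c n f) (.guess, r) (.par, r') := by
  have h1 : Function.update r 3 (f (stage (r 2))) 1 = 0 := by simpa using hr
  obtain ⟨r', h'⟩ := hc.total _ h1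
  refine ⟨r', (hc.spec _ _ h1 h').2.1, .head ?_ (transGen_of_path (Prog.path_of_rel h') rfl)⟩
  exact ⟨f (stage (r 2)), by simp [Op.Ok, treeSystem], rfl, .guess, fun _ => rfl, by rintro ⟨⟩⟩

include hc in
theorem exists_transGen_par (f : ℕ → ℕ) (r : ℕ → ℕ) (hr : r 1 = 0) :
    ∃ r', r' 1 = 0 ∧ Relation.TransGen (TreeStep c n f) (.par, r) (.par, r') := by
  obtain ⟨r', h1, h2⟩ := exists_transGen_guess (n := n) hc f
    (Function.update (Function.update r 6 (r 4)) 7 (r 5)) (by simpa using hr)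
  refine ⟨r', h1, .head (b := (.chi, Function.update r 6 (r 4))) ?_ (.head ?_ h2)⟩
  · exact ⟨r 4, by simp [Op.Ok, treeSystem], rfl, .chi, by rintro ⟨⟩, by rintro ⟨⟩⟩
  · exact ⟨r 5, by simp [Op.Ok, treeSystem], rfl, .next, by rintro ⟨⟩, by rintro ⟨⟩⟩

-- The milestones are the visits to `par`; each can be continued to another one because the core
-- always has a terminating computation.
include hc in
theorem exists_isExec (n : ℕ) (f : ℕ → ℕ) : ∃ e m, (treeSystem c).IsExec n e m ∧
    ∀ k, e k = .guess → m k = f (stage ((treeSystem c).regs e m k 2)) := by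
  choose next hnext1 hnext2 using exists_transGen_par (n := n) hc f
  obtain ⟨r₁, hr₁, h₁⟩ := exists_transGen_guess (n := n) hc f (Function.update 0 0 n) (by simp)
  let ρ : ℕ → {r : ℕ → ℕ // r 1 = 0} := fun t =>
    Nat.rec ⟨r₁, hr₁⟩ (fun _ r => ⟨next r.1 r.2, hnext1 r.1 r.2⟩) t
  let z : ℕ → TreeOp (Prog.Pos c) × (ℕ → ℕ) := fun t =>
    Nat.casesOn t (.init, 0) fun t => (.par, (ρ t).1)
  obtain ⟨p, w, hp, hp0, hwz, hw⟩ := exists_infinite_path (step := TreeStep c n f) (z := z) (by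
    rintro (_ | t)
    · exact .head ⟨n, by rintro _ ⟨⟩, rfl, .init, by rintro ⟨⟩, fun _ => rfl⟩ h₁
    · exact hnext2 _ _)
  choose m h1 h2 h3 h4 h5 using hw
  have w0 : w 0 = (.init, 0) := by have := hwz 0; rwa [hp0] at this
  have hreg : ∀ k, (treeSystem c).regs (fun k => (w k).1) m k = (w k).2 := by
    intro k
    induction k with
    | zero => rw [w0]; rfl
    | succ k ih => rw [OpSystem.regs, ih, h2]
  refine ⟨fun k => (w k).1, m, ⟨by simp only [w0]; rfl, h5 0 (by rw [w0]), h3, ?_, ?_⟩, ?_⟩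
  · intro k; rw [hreg]; exact h1 k
  · refine frequently_atTop.2 fun N => ⟨p (N + 1), ?_, ?_⟩
    · exact (Nat.le_succ N).trans (hp.id_le (N + 1))
    · simp only [hwz]; rfl
  · intro k hk; rw [hreg]; exact h4 k hk

-- A link is displayed only after a completed round with the prescribed guesses, so the displayed
-- numbers are genuine.
include hc in
theorem linked_of_guess_eq {f : ℕ → ℕ} (h : (treeSystem c).IsExec n e m)
    (hf : ∀ k, e k = .guess → m k = f (stage ((treeSystem c).regs e m k 2))) {v w : ℕ}
    (hl : (treeSystem c).Linked e m v w) : 0 < w ∧ v = parent n (prefixCode f w) := by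
  set R := (treeSystem c).regs e m with hR
  have regs_succ : ∀ k, R (k + 1) =
    Function.update (R k) ((treeSystem c).op (e k)).1 (m k) := fun k => rfl
  let Good : (ℕ → ℕ) → ℕ → Prop := fun r t => r 0 = n ∧ r 1 = 0 ∧ r 2 = prefixCode f t
  -- Inside the core the invariant remembers the registers `r` at its entrance and says that every
  -- path from here to the end yields a result of the core on `r`.
  have inv : ∀ k, match e (k + 1) with
      | .init => False
      | .guess => ∃ t, Good (R (k + 1)) t
      | .core x => ∃ r t, Good r t ∧ r 3 = f t ∧
          ∀ r', Prog.Path x (R (k + 1)) c.last r' → c.Rel r r'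
      | .par => ∃ r t, Good r t ∧ r 3 = f t ∧ c.Rel r (R (k + 1))
      | .chi => ∃ t, Good (R (k + 1)) t := by
    intro k
    induction k with
    | zero =>
      have hfo := h.follow 0
      rw [h.init] at hfo
      generalize hy : e (0 + 1) = y at hfo
      cases hfo
      refine ⟨0, ?_⟩
      rw [regs_succ, h.init, h.input]
      exact ⟨rfl, rfl, (prefixCode_zero f).symm⟩
    | succ k ih =>
      have hfo := h.follow (k + 1)
      have hok := h.ok (k + 1)
      have hre := regs_succ (k + 1)
      generalize hx : e (k + 1) = x at hfo ih hok hre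
      generalize hy : e (k + 1 + 1) = y at hfo
      cases hfo with
      | init => exact ih.elim
      | guess =>
        obtain ⟨t, g0, g1, g2⟩ := ih
        refine ⟨R (k + 1 + 1), t, ?_, ?_, fun r' hr' => Prog.rel_of_path hr'⟩
        · rw [hre]; exact ⟨g0, g1, g2⟩
        · have := hf _ hx
          rw [g2, stage_prefixCode] at this
          rw [hre, this]; rfl
      | core hfo =>
        obtain ⟨r, t, g, h3, hr⟩ := ih
        exact ⟨r, t, g, h3, fun r' hr' => hr r' (.cons hok hfo (by rw [hre] at hr'; exact hr'))⟩
      | par =>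
        obtain ⟨r, t, g, h3, hr⟩ := ih
        exact ⟨r, t, g, h3, hr _ (by rw [hre]; exact .single hok)⟩
      | chi =>
        obtain ⟨r, t, ⟨g0, g1, g2⟩, h3, hr⟩ := ih
        obtain ⟨s0, s1, s2, -, -⟩ := hc.spec _ _ g1 hr
        refine ⟨t + 1, ?_⟩
        rw [hre]
        exact ⟨s0.trans g0, s1, s2.trans (by rw [h3, g2, prefixCode_succ])⟩
      | next =>
        obtain ⟨t, g⟩ := ih
        exact ⟨t, by rw [hre]; exact g⟩
  obtain ⟨k, hk, hk1, rfl, rfl⟩ := hl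
  obtain _ | k := k
  · rw [h.init] at hk; cases hk
  have ik := inv k
  have o1 := h.ok (k + 1)
  have o2 := h.ok (k + 1 + 1)
  have hre := regs_succ (k + 1)
  rw [hk] at ik o1 hre
  rw [hk1] at o2
  obtain ⟨r, t, ⟨g0, g1, g2⟩, h3, hr⟩ := ik
  obtain ⟨s0, s1, s2, s4, s5⟩ := hc.spec _ _ g1 hr
  rw [h3, g2, ← prefixCode_succ] at s2
  rw [s2] at s4 s5
  rw [g0] at s4
  rw [stage_prefixCode] at s5
  have o1' : m (k + 1) = R (k + 1) 4 := o1 (4, false) (List.mem_singleton.2 rfl)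
  have o2' : m (k + 1 + 1) = R (k + 1 + 1) 5 := o2 (5, false) (List.mem_singleton.2 rfl)
  have : m (k + 1 + 1) = t + 1 := by rw [o2', hre, ← s5]; rfl
  rw [this]
  exact ⟨by omega, o1'.trans s4⟩

-- Let the execution guess an `f` without good `g`: a chain would be an infinite path through the
-- tree and produce such a `g`.
include hc in
theorem exists_isExec_not_hasChain (hn : n ∉ universalSet) :
    ∃ e m, (treeSystem c).IsExec n e m ∧ ¬ (treeSystem c).HasChain e m := by
  simp only [universalSet, Set.mem_ofPred_eq, not_forall] at hn
  obtain ⟨f, hf⟩ := hn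
  obtain ⟨e, m, h, hg⟩ := exists_isExec hc n f
  refine ⟨e, m, h, ?_⟩
  rintro ⟨v, h0, hv⟩
  exact hf (exists_forall_of_path h0 (fun i => (linked_of_guess_eq hc h hg (hv i)).1)
    fun i => (linked_of_guess_eq hc h hg (hv i)).2.symm)

end Executions

/-- A finite system of operations decides the universal `Π¹₂` set. -/
theorem exists_opSystem : ∃ (E : Type) (_ : Finite E) (S : OpSystem E),
    (∀ n ∈ universalSet, ∀ e m, S.IsExec n e m → S.HasOrderedChain e m) ∧
    ∀ n ∉ universalSet, ∃ e m, S.IsExec n e m ∧ ¬ S.HasChain e m := by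
  obtain ⟨c, hc⟩ := exists_isCore
  have := Prog.finite_pos c
  exact ⟨_, TreeOp.finite _, treeSystem c, fun n hn e m h => hasOrderedChain_of_mem hc hn h,
    fun n hn => exists_isExec_not_hasChain hc hn⟩

/-! ### Spelling executions as infinite words -/

/-- The word `y` is `e₀ 1^{m₀} e₁ 1^{m₁} …`, where the letter `1` is `none`, and the letter `eₖ` is
at the position `p k`. -/
structure IsSpelling {E : Type} (y : ℕ → Option E) (p : ℕ → ℕ) (e : ℕ → E) (m : ℕ → ℕ) : Prop where
  zero : p 0 = 0
  succ : ∀ k, p (k + 1) = p k + m k + 1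
  letter : ∀ k, y (p k) = some (e k)
  tick : ∀ k i, i < m k → y (p k + 1 + i) = none

/-- If letters other than `1` recur, all blocks are finite, so the word spells some pair of
sequences, lawful or not. -/
theorem exists_isSpelling_of_word {E : Type} {y : ℕ → Option E} (h0 : y 0 ≠ none)
    (h : ∃ᶠ t in atTop, y t ≠ none) : ∃ p e m, IsSpelling y p e m := by
  have hd : ∀ t, ∃ d, y (t + 1 + d) ≠ none ∧ ∀ i < d, y (t + 1 + i) = none := by
    intro t
    have ex : ∃ d, y (t + 1 + d) ≠ none := by
      obtain ⟨b, hb, hy⟩ := frequently_atTop.1 h (t + 1)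
      exact ⟨b - (t + 1), by rwa [Nat.add_sub_cancel' hb]⟩
    classical
    exact ⟨Nat.find ex, Nat.find_spec ex, fun i hi => not_not.1 (Nat.find_min ex hi)⟩
  choose D hD1 hD2 using hd
  let p : ℕ → ℕ := fun k => Nat.rec 0 (fun _ t => t + D t + 1) k
  have hp : ∀ k, y (p k) ≠ none := by
    rintro (_ | k)
    · exact h0
    · have := hD1 (p k)
      rwa [add_right_comm] at this
  choose e he using fun k => Option.ne_none_iff_exists'.1 (hp k)
  exact ⟨p, e, fun k => D (p k), rfl, fun k => rfl, he, fun k i hi => hD2 _ _ hi⟩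

theorem exists_isSpelling {E : Type} (e : ℕ → E) (m : ℕ → ℕ) : ∃ y p, IsSpelling y p e m := by
  obtain ⟨p, y, -, h0, hs, h⟩ := exists_glue (fun k => m k + 1) (fun k => Nat.succ_pos _)
    (fun k i => if i = 0 then some (e k) else none)
  refine ⟨y, p, h0, hs, fun k => by simpa using h k 0 (by omega), fun k i hi => ?_⟩
  rw [add_assoc, add_comm 1 i, h k (i + 1) (by omega)]
  simp

namespace IsSpelling

variable {E : Type} {y : ℕ → Option E} {p : ℕ → ℕ} {e : ℕ → E} {m : ℕ → ℕ}

theorem strictMono (h : IsSpelling y p e m) : StrictMono p :=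
  strictMono_nat_of_lt_succ fun k => by rw [h.succ]; omega

theorem exists_pos (h : IsSpelling y p e m) (t : ℕ) : ∃ k i, i ≤ m k ∧ t + 1 = p k + 1 + i := by
  obtain ⟨k, h1, h2⟩ := exists_block h.strictMono h.zero t
  rw [h.succ] at h2
  exact ⟨k, t - p k, by omega, by omega⟩

/-- Induction along the word: `P t k i` is a statement about the position `t = p k + 1 + i`, which
comes after `i` of the `m k` letters `1` that follow `eₖ`. -/
theorem induction (h : IsSpelling y p e m) {P : ℕ → ℕ → ℕ → Prop} (base : P 1 0 0)
    (tick : ∀ t k i, i < m k → y t = none → P t k i → P (t + 1) k (i + 1))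
    (next : ∀ t k, y t = some (e (k + 1)) → P t k (m k) → P (t + 1) (k + 1) 0) :
    ∀ k i, i ≤ m k → P (p k + 1 + i) k i := by
  have inner : ∀ k, P (p k + 1) k 0 → ∀ i, i ≤ m k → P (p k + 1 + i) k i := by
    intro k hk i
    induction i with
    | zero => intro _; exact hk
    | succ i ih => intro hi; exact tick _ k i hi (h.tick k i hi) (ih (by omega))
  intro k
  refine inner k ?_
  induction k with
  | zero => rw [h.zero]; exact base
  | succ k ih =>
    refine next _ k (h.letter (k + 1)) ?_
    rw [h.succ, add_right_comm]
    exact inner k ih _ le_rfl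

/-- If `par` occurs infinitely often in the word, it does so in the execution. -/
theorem frequently_par (h : IsSpelling y p e m) {S : OpSystem E}
    (hy : ∃ᶠ t in atTop, y t = some S.par) : ∃ᶠ k in atTop, e k = S.par := by
  refine frequently_atTop.2 fun N => ?_
  obtain ⟨t, ht, hyt⟩ := frequently_atTop.1 hy (p N)
  obtain ⟨k, h1, h2⟩ := exists_block h.strictMono h.zero t
  have hk : N ≤ k := by
    have := h.strictMono.lt_iff_lt.1 (ht.trans_lt h2)
    omega
  refine ⟨k, hk, ?_⟩
  rcases h1.eq_or_lt with h3 | h3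
  · rw [← h3, h.letter] at hyt
    exact Option.some.inj hyt
  · rw [h.succ] at h2
    have := h.tick k (t - (p k + 1)) (by omega)
    rw [Nat.add_sub_cancel' (by omega), hyt] at this
    cases this

theorem exists_par_ge (h : IsSpelling y p e m) {S : OpSystem E}
    (hpar : ∃ᶠ k in atTop, e k = S.par) (t : ℕ) : ∃ t' ≥ t, y t' = some S.par := by
  obtain ⟨k, hk, he⟩ := frequently_atTop.1 hpar t
  exact ⟨p k, hk.trans (h.strictMono.id_le k), by rw [h.letter, he]⟩

end IsSpelling

/-! ### The 1-counter automaton, on the words written by Player 2 -/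

/-- The flag `load` says that the current block is being added to the counter, and `acc` that a link
has just been completed. In `cmp true` one letter `1` is still to be read for the increment; `bcmp`
matches the counter with a block of `par`. -/
inductive CState (E : Type) (K : ℕ) : Type
  | sink : CState E K
  | start : CState E K
  | skip : CState E K
  | quiet : CState E K
  | fol (e : E) : CState E K
  | hold (j : Fin K) (load : Bool) : CState E K
  | cmp (δ : Bool) : CState E K
  | br (load acc : Bool) : CState E K
  | bcmp : CState E K
  | pre (i : ℕ) : CState E K

def CState.IsBranch {E : Type} {K : ℕ} : CState E K → Prop
  | .br _ _ => True
  | .bcmp => True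
  | _ => False

inductive CState.IsAccepting {E : Type} {K : ℕ} : CState E K → Prop
  | sink : IsAccepting .sink
  | quiet : IsAccepting .quiet
  | br (load : Bool) : IsAccepting (.br load true)

/-- The automaton accepts if it finds a violation of the rules of an execution (states `start`,
`skip`, `fol`, `hold`, `cmp`, `pre`), if `par` is eventually not performed (state `quiet`) or if
there is a chain (states `br`, `bcmp`). The state `hold j` keeps the register `j` in the counter,
`cmp` compares it with a block, and `pre i` checks that the first block has length `n`. -/
inductive CTrans {E : Type} (S : OpSystem E) (n K : ℕ) :
    CState E K → Option E → Bool → CState E K → ℤ → Prop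
  | sink (a b) : CTrans S n K .sink a b .sink 0
  | start_sink {a} (h : a ≠ some S.init) (b) : CTrans S n K .start a b .sink 0
  | start_skip (b) : CTrans S n K .start (some S.init) b .skip 0
  | start_quiet (b) : CTrans S n K .start (some S.init) b .quiet 0
  | start_fol (b) : CTrans S n K .start (some S.init) b (.fol S.init) 0
  | start_load (j : Fin K) (h : (S.op S.init).1 = j) (b) :
      CTrans S n K .start (some S.init) b (.hold j true) 0
  | start_hold (j : Fin K) (h : (S.op S.init).1 ≠ j) (b) :
      CTrans S n K .start (some S.init) b (.hold j false) 0
  | start_pre (b) : CTrans S n K .start (some S.init) b (.pre 0) 0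
  | start_br (b) : CTrans S n K .start (some S.init) b (.br false false) 0
  | skip (a b) : CTrans S n K .skip a b .skip 0
  | skip_quiet (a b) : CTrans S n K .skip a b .quiet 0
  | skip_fol (e b) : CTrans S n K .skip (some e) b (.fol e) 0
  | skip_load (e) (j : Fin K) (h : (S.op e).1 = j) (b) :
      CTrans S n K .skip (some e) b (.hold j true) 0
  | quiet {a} (h : a ≠ some S.par) (b) : CTrans S n K .quiet a b .quiet 0
  | fol_tick (e b) : CTrans S n K (.fol e) none b (.fol e) 0
  | fol_sink {e e'} (h : ¬ S.Follow e e') (b) : CTrans S n K (.fol e) (some e') b .sink 0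
  | hold_tick (j load b) : CTrans S n K (.hold j load) none b (.hold j load) load.toNat
  -- Another assignment to `j` cannot be passed, so the counter holds the most recent value of `j`.
  | hold_op (j : Fin K) (load) {e} (h : (S.op e).1 ≠ j) (b) :
      CTrans S n K (.hold j load) (some e) b (.hold j false) 0
  | hold_cmp (j : Fin K) (load) {e δ} (h : ((j : ℕ), δ) ∈ (S.op e).2) (b) :
      CTrans S n K (.hold j load) (some e) b (.cmp δ) 0
  | cmp_succ (b) : CTrans S n K (.cmp true) none b (.cmp false) 0
  | cmp_succ_sink (e b) : CTrans S n K (.cmp true) (some e) b .sink 0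
  | cmp_tick : CTrans S n K (.cmp false) none true (.cmp false) (-1)
  | cmp_tick_sink : CTrans S n K (.cmp false) none false .sink 0
  | cmp_op_sink (e) : CTrans S n K (.cmp false) (some e) true .sink 0
  | br_tick (load acc b) : CTrans S n K (.br load acc) none b (.br load false) load.toNat
  | br_op (load acc e b) : CTrans S n K (.br load acc) (some e) b (.br false false) 0
  | br_par (load acc b) : CTrans S n K (.br load acc) (some S.par) b .bcmp 0
  | bcmp_tick : CTrans S n K .bcmp none true .bcmp (-1)
  -- The zero test kills the run unless the block of `par` equals the stored number. Within the
  -- branch, acceptance occurs only here.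
  | bcmp_chi : CTrans S n K .bcmp (some S.chi) false (.br true true) 0
  -- A first block of the right length leads to `pre (n + 1)`, which is a dead end; only an error
  -- reaches `sink`.
  | pre_next {i a} (h : i ≤ n) (ha : i < n ↔ a = none) (b) :
      CTrans S n K (.pre i) a b (.pre (i + 1)) 0
  | pre_sink {i a} (h : i ≤ n) (ha : ¬ (i < n ↔ a = none)) (b) :
      CTrans S n K (.pre i) a b .sink 0

section Counter

variable {E : Type} {S : OpSystem E} {n K : ℕ} {y : ℕ → Option E} {p : ℕ → ℕ} {e : ℕ → E}
  {m : ℕ → ℕ}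

structure IsCRun (S : OpSystem E) (n K : ℕ) (y : ℕ → Option E) (q : ℕ → CState E K) (c : ℕ → ℕ) :
    Prop where
  state_zero : q 0 = .start
  counter_zero : c 0 = 0
  step : ∀ t, ∃ j : ℤ, CTrans S n K (q t) (y t) (decide (0 < c t)) (q (t + 1)) j ∧
    (c (t + 1) : ℤ) = c t + j
  accepting : ∃ᶠ t in atTop, (q t).IsAccepting

def CAccepts (S : OpSystem E) (n K : ℕ) (y : ℕ → Option E) : Prop := ∃ q c, IsCRun S n K y q c

/-! #### Accepted executions have chains -/

/-- What is known about the configuration after `i` letters of the `k`-th block. -/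
def CInv (S : OpSystem E) (n : ℕ) (e : ℕ → E) (m : ℕ → ℕ) (k i : ℕ) (c : ℕ) : CState E K → Prop
  | .sink => False
  | .start => False
  | .skip => c = 0
  | .quiet => True
  | .fol e' => e' = e k
  | .hold j true => (S.op (e k)).1 = j ∧ c = i
  | .hold j false => (S.op (e k)).1 ≠ j ∧ c = S.regs e m k j
  | .cmp δ => c + δ.toNat + i = m k
  | .br _ _ => True
  | .bcmp => True
  | .pre i' => (k = 0 ∧ i' = i) ∨ i' = n + 1

/-- On the spelling of a genuine execution every check succeeds, so `sink`, whose clause is `False`,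
is never reached. -/
theorem cInv (hy : IsSpelling y p e m) (he : S.IsExec n e m) {q : ℕ → CState E K} {c : ℕ → ℕ}
    (hr : IsCRun S n K y q c) : ∀ k i, i ≤ m k →
      CInv S n e m k i (c (p k + 1 + i)) (q (p k + 1 + i)) := by
  refine hy.induction (P := fun t k i => CInv S n e m k i (c t) (q t)) ?_ ?_ ?_
  · obtain ⟨j, hj, hc⟩ := hr.step 0
    have y0 : y 0 = some S.init := by have := hy.letter 0; rwa [hy.zero, he.init] at this
    rw [hr.state_zero, y0] at hj
    rw [hr.counter_zero] at hc
    generalize q (0 + 1) = q' at hj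
    have hi := he.init
    cases hj <;> simp_all [CInv, OpSystem.regs]
  · intro t k i hi hyt hinv
    obtain ⟨j, hj, hc⟩ := hr.step t
    rw [hyt] at hj
    generalize q (t + 1) = q' at hj
    generalize q t = q₀ at hj hinv
    generalize hb : decide (0 < c t) = b at hj
    have hin := he.input
    cases hj with
    | hold_tick j load =>
      cases load <;> simp_all [CInv]
      omega
    | pre_next h ha =>
      simp only [CInv] at hinv ⊢
      omega
    | pre_sink h ha =>
      simp only [CInv, iff_true, not_lt] at hinv ha ⊢
      rcases hinv with ⟨rfl, rfl⟩ | h'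
      · omega
      · omega
    | _ => simp_all [CInv] <;> omega
  · intro t k hyt hinv
    obtain ⟨j, hj, hc⟩ := hr.step t
    rw [hyt] at hj
    generalize q (t + 1) = q' at hj
    generalize q t = q₀ at hj hinv
    generalize hb : decide (0 < c t) = b at hj
    -- At the end of a block the counter equals the register, whether this block has just assigned
    -- it or it was carried along.
    have hval : ∀ (j : Fin K) load, CInv S n e m k (m k) (c t) (.hold j load) →
        c t = S.regs e m (k + 1) j := by
      rintro j (_ | _) ⟨h1, h2⟩
      · rw [h2, OpSystem.regs, Function.update_of_ne (Ne.symm h1)]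
      · rw [h2, OpSystem.regs, ← h1, Function.update_self]
    generalize he' : e (k + 1) = e' at hj
    generalize ha : some e' = a at hj
    cases hj with
    | fol_sink h =>
      cases ha
      simp only [CInv] at hinv
      exact h (by rw [hinv, ← he']; exact he.follow k)
    | hold_op j load h =>
      cases ha
      refine ⟨by rwa [he'], ?_⟩
      rw [← hval j load hinv]
      simpa using hc
    | hold_cmp j load h =>
      cases ha
      have := he.ok (k + 1) _ (by rw [he']; exact h)
      rw [← hval j load hinv] at this
      simp only [CInv]
      simp at hc this
      omega
    | pre_next h ha' =>
      subst ha
      have hin := he.input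
      simp only [CInv, reduceCtorEq, iff_false, not_lt] at hinv ha' ⊢
      omega
    | pre_sink h ha' =>
      subst ha
      have hin := he.input
      simp only [CInv, reduceCtorEq, iff_false, not_lt] at hinv ha' ⊢
      rcases hinv with ⟨rfl, rfl⟩ | h'
      · omega
      · omega
    | _ => simp_all [CInv]

/-- The choice between following a chain and looking for a defect is made on the first letter and is
final. -/
theorem CTrans.isBranch_iff {q q' : CState E K} {a b j} (h : CTrans S n K q a b q' j)
    (hq : q ≠ .start) : q'.IsBranch ↔ q.IsBranch := by
  cases h <;> simp_all [CState.IsBranch]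

/-- In a branch state, the automaton has the number `v` in memory. -/
def CBranchInv (S : OpSystem E) (e : ℕ → E) (m : ℕ → ℕ) (v k i c : ℕ) : CState E K → Prop
  | .br true _ => e k = S.chi ∧ c = i ∧ v = m k
  | .br false _ => c = v
  | .bcmp => e k = S.par ∧ c + i = v
  | _ => False

/-- Memory changes only by completing a link, and an accepting state is entered only in that way. -/
theorem cBranchInv_step (hy : IsSpelling y p e m) {q : ℕ → CState E K} {c : ℕ → ℕ}
    (hr : IsCRun S n K y q c) {v k i : ℕ} (hi : i ≤ m k)
    (h : CBranchInv S e m v k i (c (p k + 1 + i)) (q (p k + 1 + i))) :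
    ∃ w k' i', i' ≤ m k' ∧ p k + 1 + i + 1 = p k' + 1 + i' ∧
      CBranchInv S e m w k' i' (c (p k + 1 + i + 1)) (q (p k + 1 + i + 1)) ∧
      (v = w ∧ ¬ (q (p k + 1 + i + 1)).IsAccepting ∨ S.Linked e m v w) := by
  generalize ht : p k + 1 + i = t at h
  obtain ⟨j, hj, hc⟩ := hr.step t
  rcases hi.lt_or_eq with hlt | rfl
  · have hyt := hy.tick k i hlt
    rw [ht] at hyt
    rw [hyt] at hj
    refine ⟨v, k, i + 1, hlt, by omega, ?_⟩
    generalize q (t + 1) = q' at hj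
    generalize q t = q₀ at hj h
    generalize hb : decide (0 < c t) = b at hj
    cases hj with
    | br_tick load acc =>
      refine ⟨?_, .inl ⟨rfl, by rintro ⟨⟩⟩⟩
      cases load <;> simp_all [CBranchInv]
      omega
    | bcmp_tick =>
      refine ⟨?_, .inl ⟨rfl, by rintro ⟨⟩⟩⟩
      simp_all [CBranchInv]
      omega
    | _ => exact h.elim
  · have hyt := hy.letter (k + 1)
    have hs := hy.succ k
    rw [show p (k + 1) = t by omega] at hyt
    rw [hyt] at hj
    have hmem : ∀ load acc, CBranchInv S e m v k (m k) (c t) (.br load acc : CState E K) →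
        c t = v := by
      rintro (_ | _) acc h
      · exact h
      · exact h.2.1.trans h.2.2.symm
    generalize q (t + 1) = q' at hj
    generalize q t = q₀ at hj h
    generalize hb : decide (0 < c t) = b at hj
    generalize he' : e (k + 1) = e' at hj
    generalize ha : some e' = a at hj
    cases hj with
    | br_op load acc =>
      refine ⟨v, k + 1, 0, Nat.zero_le _, by omega, ?_, .inl ⟨rfl, by rintro ⟨⟩⟩⟩
      simp only [CBranchInv]
      have := hmem _ _ h
      omega
    | br_par load acc =>
      refine ⟨v, k + 1, 0, Nat.zero_le _, by omega, ?_, .inl ⟨rfl, by rintro ⟨⟩⟩⟩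
      cases ha
      have := hmem _ _ h
      exact ⟨he', by omega⟩
    | bcmp_chi =>
      cases ha
      refine ⟨m (k + 1), k + 1, 0, Nat.zero_le _, by omega, ⟨he', ?_, rfl⟩, .inr ?_⟩
      · simp at hb
        omega
      · simp at hb
        exact ⟨k, h.1, he', by have := h.2; omega, rfl⟩
    | br_tick => cases ha
    | bcmp_tick => cases ha
    | _ => exact h.elim

theorem exists_seq_of_step {α : Type*} {P : α → Prop} {R : α → α → Prop} {a : α} (ha : P a)
    (h : ∀ a, P a → ∃ b, P b ∧ R a b) : ∃ f : ℕ → α, f 0 = a ∧ ∀ i, R (f i) (f (i + 1)) := by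
  choose! g hg1 hg2 using h
  have hP : ∀ i, P (g^[i] a) := by
    intro i
    induction i with
    | zero => exact ha
    | succ i ih => rw [Function.iterate_succ_apply']; exact hg1 _ ih
  exact ⟨fun i => g^[i] a, rfl, fun i => by
    simp only [Function.iterate_succ_apply']; exact hg2 _ (hP i)⟩

/-- Outside the branch acceptance would need `sink`, excluded by the invariant, or `quiet`, excluded
because `par` recurs. In the branch, recurring acceptance yields infinitely many consecutive links,
beginning with the number `0`. -/
theorem hasChain_of_cAccepts (hy : IsSpelling y p e m) (he : S.IsExec n e m)
    (h : CAccepts S n K y) : S.HasChain e m := by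
  obtain ⟨q, c, hr⟩ := h
  have inv : ∀ t, ∃ k i, i ≤ m k ∧ t + 1 = p k + 1 + i ∧
      CInv S n e m k i (c (t + 1)) (q (t + 1)) := by
    intro t
    obtain ⟨k, i, hi, ht⟩ := hy.exists_pos t
    exact ⟨k, i, hi, ht, ht ▸ cInv hy he hr k i hi⟩
  have hne : ∀ t, q (t + 1) ≠ .start ∧ q (t + 1) ≠ .sink := by
    intro t
    obtain ⟨k, i, -, -, h⟩ := inv t
    constructor <;> intro hq <;> rw [hq] at h <;> exact h
  have hbr : ∀ t, (q (t + 1)).IsBranch ↔ (q 1).IsBranch := by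
    intro t
    induction t with
    | zero => rfl
    | succ t ih =>
      obtain ⟨j, hj, -⟩ := hr.step (t + 1)
      exact (hj.isBranch_iff (hne t).1).trans ih
  by_cases h1 : (q 1).IsBranch
  · have start : CBranchInv S e m 0 0 0 (c 1) (q 1) := by
      obtain ⟨j, hj, hc⟩ := hr.step 0
      rw [hr.state_zero] at hj
      rw [hr.counter_zero] at hc
      change CTrans S n K .start (y 0) _ (q 1) j at hj
      change (c 1 : ℤ) = (0 : ℕ) + j at hc
      generalize q 1 = q' at hj h1
      generalize decide (0 < c 0) = b at hj
      generalize y 0 = a at hj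
      cases hj with
      | start_br => simpa [CBranchInv] using hc
      | _ => exact h1.elim
    let P : ℕ × ℕ → Prop := fun a => ∃ k i, i ≤ m k ∧ a.1 = p k + 1 + i ∧
      CBranchInv S e m a.2 k i (c a.1) (q a.1)
    -- Induction on the distance to some later accepting configuration; a link must be completed by
    -- then.
    have climb : ∀ d (a : ℕ × ℕ), P a → (q (a.1 + 1 + d)).IsAccepting →
        ∃ b, P b ∧ S.Linked e m a.2 b.2 := by
      intro d
      induction d with
      | zero =>
        rintro ⟨t, v⟩ ⟨k, i, hi, rfl, hinv⟩ hacc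
        obtain ⟨w, k', i', hi', ht', hinv', hl⟩ := cBranchInv_step hy hr hi hinv
        rcases hl with ⟨-, hl⟩ | hl
        · exact absurd hacc hl
        · exact ⟨⟨_, w⟩, ⟨k', i', hi', ht', hinv'⟩, hl⟩
      | succ d ih =>
        rintro ⟨t, v⟩ ⟨k, i, hi, rfl, hinv⟩ hacc
        obtain ⟨w, k', i', hi', ht', hinv', hl⟩ := cBranchInv_step hy hr hi hinv
        rcases hl with ⟨rfl, hl⟩ | hl
        · exact ih ⟨p k + 1 + i + 1, v⟩ ⟨k', i', hi', ht', hinv'⟩ (by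
            convert hacc using 2; simp only; omega)
        · exact ⟨⟨_, w⟩, ⟨k', i', hi', ht', hinv'⟩, hl⟩
    have hP0 : P (1, 0) := ⟨0, 0, Nat.zero_le _, by simp [hy.zero], start⟩
    obtain ⟨f, hf0, hf⟩ := exists_seq_of_step (R := fun a b => S.Linked e m a.2 b.2) hP0 (by
      intro a ha
      obtain ⟨T, hT, hacc⟩ := frequently_atTop.1 hr.accepting (a.1 + 1)
      exact climb (T - (a.1 + 1)) a ha (by rwa [Nat.add_sub_cancel' hT]))
    exact ⟨fun i => (f i).2, by simp only [hf0], hf⟩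
  · exfalso
    obtain ⟨T, hT, hacc⟩ := frequently_atTop.1 hr.accepting 1
    obtain ⟨t, rfl⟩ := Nat.exists_eq_add_of_le' hT
    have hquiet : q (t + 1) = .quiet := by
      have h2 := (hne t).2
      have h3 := (hbr t).not.2 h1
      generalize q (t + 1) = q' at hacc h2 h3
      cases hacc with
      | sink => exact absurd rfl h2
      | quiet => rfl
      | br => exact absurd trivial h3
    have hstay : ∀ d, q (t + 1 + d) = .quiet ∧ y (t + 1 + d) ≠ some S.par := by
      have hstep : ∀ t, q t = .quiet → q (t + 1) = .quiet ∧ y t ≠ some S.par := by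
        intro t ht
        obtain ⟨j, hj, -⟩ := hr.step t
        rw [ht] at hj
        generalize q (t + 1) = q' at hj
        cases hj with
        | quiet h => exact ⟨rfl, h⟩
      intro d
      induction d with
      | zero => exact ⟨hquiet, (hstep _ hquiet).2⟩
      | succ d ih =>
        have := (hstep _ ih.1).1
        exact ⟨this, (hstep _ this).2⟩
    obtain ⟨t', ht', hp⟩ := hy.exists_par_ge he.par (t + 1)
    obtain ⟨d, rfl⟩ := Nat.exists_eq_add_of_le ht'
    exact (hstay d).2 hp

/-! #### Violations and ordered chains are accepted -/

/-- One step between configurations; the first component is the time. -/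
def CStep (S : OpSystem E) (n K : ℕ) (y : ℕ → Option E) (z z' : ℕ × CState E K × ℕ) : Prop :=
  z'.1 = z.1 + 1 ∧ ∃ j : ℤ, CTrans S n K z.2.1 (y z.1) (decide (0 < z.2.2)) z'.2.1 j ∧
    (z'.2.2 : ℤ) = z.2.2 + j

/-- Time is a component of the configurations, so the glued path reads the word letter by letter. -/
theorem cAccepts_of_transGen {z : ℕ → ℕ × CState E K × ℕ} (h0 : z 0 = (0, .start, 0))
    (h : ∀ i, Relation.TransGen (CStep S n K y) (z i) (z (i + 1)))
    (hacc : ∀ i, (z (i + 1)).2.1.IsAccepting) : CAccepts S n K y := by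
  obtain ⟨p, w, hp, hp0, hwz, hw⟩ := exists_infinite_path h
  have w0 : w 0 = (0, .start, 0) := by rw [← h0, ← hwz, hp0]
  have htime : ∀ t, (w t).1 = t := by
    intro t
    induction t with
    | zero => rw [w0]
    | succ t ih => rw [(hw t).1, ih]
  refine ⟨fun t => (w t).2.1, fun t => (w t).2.2, by simp [w0], by simp [w0], fun t => ?_, ?_⟩
  · have := (hw t).2
    rwa [htime] at this
  · refine frequently_atTop.2 fun N => ⟨p (N + 1), (Nat.le_succ N).trans (hp.id_le (N + 1)), ?_⟩
    simp only [hwz]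
    exact hacc N

/-- The configuration is reached from the initial one. -/
def CReach (S : OpSystem E) (n K : ℕ) (y : ℕ → Option E) (t : ℕ) (q : CState E K) (c : ℕ) : Prop :=
  Relation.TransGen (CStep S n K y) (0, .start, 0) (t, q, c)

theorem cStep_intro {t c c' : ℕ} {a : Option E} {b : Bool} {q q' : CState E K} {j : ℤ}
    (h : CTrans S n K q a b q' j) (ha : y t = a) (hb : decide (0 < c) = b) (hc : (c' : ℤ) = c + j) :
    CStep S n K y (t, q, c) (t + 1, q', c') := by
  subst ha hb
  exact ⟨rfl, j, h, hc⟩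

theorem CReach.accepts_of_sink {t c : ℕ} (h : CReach S n K y t .sink c) : CAccepts S n K y := by
  refine cAccepts_of_transGen
    (z := fun i => Nat.casesOn i (0, .start, 0) fun i => (t + i, .sink, c)) rfl ?_
    fun i => .sink
  rintro (_ | i)
  · exact h
  · exact .single (cStep_intro (.sink _ _) rfl rfl (by simp))

theorem CReach.ticks {t c : ℕ} {q : CState E K} {δ d : ℕ} (h : CReach S n K y t q c)
    (hq : ∀ b, CTrans S n K q none b q δ) (hy : ∀ i < d, y (t + i) = none) :
    CReach S n K y (t + d) q (c + δ * d) := by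
  induction d with
  | zero => exact h
  | succ d ih =>
    refine (ih fun i hi => hy i (by omega)).tail
      (cStep_intro (hq _) (hy d (by omega)) rfl ?_)
    push_cast
    ring

section Complete

theorem cReach_skip (h0 : y 0 = some S.init) (t : ℕ) : CReach S n K y (t + 1) .skip 0 := by
  induction t with
  | zero => exact .single (cStep_intro (.start_skip _) h0 rfl (by simp))
  | succ t ih => exact ih.tail (cStep_intro (.skip _ _) rfl rfl (by simp))

theorem cAccepts_of_start (h0 : y 0 ≠ some S.init) : CAccepts S n K y :=
  CReach.accepts_of_sink (t := 1) (c := 0)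
    (.single (cStep_intro (.start_sink h0 _) rfl rfl (by simp)))

theorem cAccepts_of_quiet (h0 : y 0 = some S.init) (h : ¬ ∃ᶠ t in atTop, y t = some S.par) :
    CAccepts S n K y := by
  rw [not_frequently, eventually_atTop] at h
  obtain ⟨N, hN⟩ := h
  refine cAccepts_of_transGen
    (z := fun i => Nat.casesOn i (0, .start, 0) fun i => (N + 1 + 1 + i, .quiet, 0)) rfl ?_
    fun i => .quiet
  rintro (_ | i)
  · exact (cReach_skip h0 N).tail (cStep_intro (.skip_quiet _ _) rfl rfl (by simp))
  · exact .single (cStep_intro (.quiet (hN _ (by omega)) _) rfl rfl (by simp))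

theorem cReach_fol (hy : IsSpelling y p e m) (hinit : e 0 = S.init) (k : ℕ) :
    CReach S n K y (p k + 1) (.fol (e k)) 0 := by
  have h0 : y 0 = some S.init := by have := hy.letter 0; rwa [hy.zero, hinit] at this
  obtain _ | k := k
  · rw [hy.zero, hinit]
    exact .single (cStep_intro (.start_fol _) h0 rfl (by simp))
  · have h := cReach_skip (n := n) (K := K) h0 (p k + m k)
    rw [← hy.succ] at h
    exact h.tail (cStep_intro (.skip_fol _ _) (hy.letter _) rfl (by simp))

theorem cAccepts_of_not_follow (hy : IsSpelling y p e m) (hinit : e 0 = S.init) {k : ℕ}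
    (h : ¬ S.Follow (e k) (e (k + 1))) : CAccepts S n K y := by
  have h1 := (cReach_fol (n := n) (K := K) hy hinit k).ticks (δ := 0) (d := m k)
    (fun b => .fol_tick _ b) (hy.tick k)
  rw [add_right_comm, ← hy.succ] at h1
  exact CReach.accepts_of_sink (c := 0)
    (h1.tail (cStep_intro (.fol_sink h _) (hy.letter _) rfl (by simp)))

theorem cAccepts_of_input (hy : IsSpelling y p e m) (hinit : e 0 = S.init) (h : m 0 ≠ n) :
    CAccepts S n K y := by
  have h0 : y 0 = some S.init := by have := hy.letter 0; rwa [hy.zero, hinit] at this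
  have hp : ∀ i, i ≤ m 0 → i ≤ n → CReach S n K y (1 + i) (.pre i) 0 := by
    intro i
    induction i with
    | zero => intro _ _; exact .single (cStep_intro (.start_pre _) h0 rfl (by simp))
    | succ i ih =>
      intro h1 h2
      have hyi := hy.tick 0 i h1
      rw [hy.zero, zero_add] at hyi
      exact (ih (by omega) (by omega)).tail
        (cStep_intro (.pre_next (by omega) (iff_of_true (by omega) rfl) _) hyi rfl (by simp))
  rcases lt_or_gt_of_ne h with h | h
  · have hyi := hy.letter 1
    have hs := hy.succ 0
    rw [show p 1 = 1 + m 0 by rw [hs, hy.zero]; omega] at hyi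
    exact CReach.accepts_of_sink (c := 0) ((hp _ le_rfl h.le).tail
      (cStep_intro (.pre_sink h.le (by simp [h]) _) hyi rfl (by simp)))
  · have hyi := hy.tick 0 n h
    rw [hy.zero, zero_add] at hyi
    exact CReach.accepts_of_sink (c := 0) ((hp n h.le le_rfl).tail
      (cStep_intro (.pre_sink le_rfl (by simp) _) hyi rfl (by simp)))

/-- Loading starts at the most recent assignment to `j`, or, if there is none, the counter starts
with the initial value `0`. -/
theorem cReach_hold (hy : IsSpelling y p e m) (hinit : e 0 = S.init) (j : Fin K) (k : ℕ) :
    ∃ load, CReach S n K y (p (k + 1)) (.hold j load) (S.regs e m (k + 1) j) := by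
  have h0 : y 0 = some S.init := by have := hy.letter 0; rwa [hy.zero, hinit] at this
  have load : ∀ k, (S.op (e k)).1 = j → CReach S n K y (p k + 1) (.hold j true) 0 →
      CReach S n K y (p (k + 1)) (.hold j true) (S.regs e m (k + 1) j) := by
    intro k hk h
    have h1 := h.ticks (δ := 1) (d := m k) (fun b => .hold_tick j true b) (hy.tick k)
    rw [add_right_comm, ← hy.succ] at h1
    rw [OpSystem.regs, ← hk, Function.update_self]
    simpa using h1
  have keep : ∀ k, (S.op (e k)).1 ≠ j →
      CReach S n K y (p k + 1) (.hold j false) (S.regs e m k j) →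
      CReach S n K y (p (k + 1)) (.hold j false) (S.regs e m (k + 1) j) := by
    intro k hk h
    have h1 := h.ticks (δ := 0) (d := m k) (fun b => .hold_tick j false b) (hy.tick k)
    rw [add_right_comm, ← hy.succ] at h1
    rw [OpSystem.regs, Function.update_of_ne (Ne.symm hk)]
    simpa using h1
  induction k with
  | zero =>
    by_cases hk : (S.op (e 0)).1 = j
    · refine ⟨_, load 0 hk ?_⟩
      rw [hy.zero]
      exact .single (cStep_intro (.start_load j (hinit ▸ hk) _) h0 rfl (by simp))
    · refine ⟨_, keep 0 hk ?_⟩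
      rw [hy.zero]
      exact .single (cStep_intro (.start_hold j (hinit ▸ hk) _) h0 rfl (by simp [OpSystem.regs]))
  | succ k ih =>
    by_cases hk : (S.op (e (k + 1))).1 = j
    · have h := cReach_skip (n := n) (K := K) h0 (p k + m k)
      rw [← hy.succ] at h
      exact ⟨_, load _ hk (h.tail
        (cStep_intro (.skip_load _ j hk _) (hy.letter _) rfl (by simp)))⟩
    · obtain ⟨_, h⟩ := ih
      exact ⟨_, keep _ hk (h.tail
        (cStep_intro (.hold_op j _ hk _) (hy.letter _) rfl (by simp)))⟩

/-- Counter and block are used up together; if they do not match, one ends before the other and the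
automaton moves to `sink`. -/
theorem CReach.accepts_of_cmp {d : ℕ} {e' : E} : ∀ {t c : ℕ} {δ : Bool},
    CReach S n K y t (.cmp δ) c → (∀ i < d, y (t + i) = none) → y (t + d) = some e' →
    d ≠ c + δ.toNat → CAccepts S n K y := by
  induction d with
  | zero =>
    intro t c δ h _ he hd
    cases δ with
    | false =>
      exact accepts_of_sink (c := c)
        (h.tail (cStep_intro (.cmp_op_sink _) he (by simp at hd ⊢; omega) (by simp)))
    | true =>
      exact accepts_of_sink (c := c) (h.tail (cStep_intro (.cmp_succ_sink _ _) he rfl (by simp)))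
  | succ d ih =>
    intro t c δ h hn he hd
    have hn' : ∀ i < d, y (t + 1 + i) = none := fun i hi => by
      rw [add_assoc, add_comm 1]; exact hn (i + 1) (by omega)
    have he' : y (t + 1 + d) = some e' := by rw [add_assoc, add_comm 1]; exact he
    have h0 : y t = none := hn 0 (by omega)
    cases δ with
    | true =>
      exact ih (c := c) (h.tail (cStep_intro (.cmp_succ _) h0 rfl (by simp))) hn' he'
        (by simp at hd ⊢; omega)
    | false =>
      obtain _ | c := c
      · exact accepts_of_sink (c := 0)
          (h.tail (cStep_intro .cmp_tick_sink h0 (by simp) (by simp)))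
      · exact ih (c := c) (h.tail (cStep_intro .cmp_tick h0 (by simp) (by simp))) hn' he'
          (by simp at hd ⊢; omega)

theorem cAccepts_of_not_ok (hK : ∀ e, ∀ x ∈ (S.op e).2, x.1 < K) (hy : IsSpelling y p e m)
    (hinit : e 0 = S.init) {k : ℕ} (h : ¬ (S.op (e k)).Ok (S.regs e m k) (m k)) :
    CAccepts S n K y := by
  simp only [Op.Ok, not_forall] at h
  obtain ⟨⟨j, δ⟩, hmem, hne⟩ := h
  -- The first operation has no constraints, so a violated one has a block before it.
  obtain _ | k := k
  · rw [hinit, S.op_init] at hmem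
    cases hmem
  obtain ⟨load, hr⟩ := cReach_hold (n := n) hy hinit ⟨j, hK _ _ hmem⟩ k
  refine CReach.accepts_of_cmp (d := m (k + 1)) (hr.tail
    (cStep_intro (.hold_cmp _ load hmem _) (hy.letter _) rfl (by simp)))
    (hy.tick _) (e' := e (k + 1 + 1)) ?_ hne
  rw [← hy.letter, hy.succ (k + 1), add_right_comm]

theorem cStep_br_ticks {t c d : ℕ} {load acc : Bool} (hy : ∀ i < d, y (t + i) = none) :
    ∃ acc', Relation.ReflTransGen (CStep S n K y) (t, .br load acc, c)
      (t + d, .br load acc', c + load.toNat * d) := by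
  induction d with
  | zero => exact ⟨acc, .refl⟩
  | succ d ih =>
    obtain ⟨acc', h⟩ := ih fun i hi => hy i (by omega)
    refine ⟨false, h.tail (cStep_intro (.br_tick _ _ _) (hy d (by omega)) rfl ?_)⟩
    push_cast
    ring

theorem cStep_br_blocks (hy : IsSpelling y p e m) {c k : ℕ} {load acc : Bool} (d : ℕ) :
    ∃ load' acc', Relation.ReflTransGen (CStep S n K y) (p k, .br load acc, c)
      (p (k + d), .br load' acc', c) := by
  induction d with
  | zero => exact ⟨_, _, .refl⟩
  | succ d ih =>
    obtain ⟨load', acc', h⟩ := ih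
    obtain ⟨acc'', h'⟩ := cStep_br_ticks (S := S) (n := n) (K := K) (c := c) (load := false)
      (acc := false) (hy.tick (k + d))
    refine ⟨false, acc'', (h.tail (cStep_intro (.br_op _ _ _ _) (hy.letter _) rfl (c' := c)
      (by simp))).trans ?_⟩
    rw [add_right_comm, ← hy.succ, add_assoc] at h'
    simpa using h'

theorem cStep_bcmp_ticks {t d : ℕ} (hy : ∀ i < d, y (t + i) = none) :
    Relation.ReflTransGen (CStep S n K y) (t, .bcmp, d) (t + d, .bcmp, 0) := by
  induction d generalizing t with
  | zero => exact .refl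
  | succ d ih =>
    refine .head (cStep_intro .bcmp_tick (hy 0 (by omega)) (by simp) (c' := d) (by simp)) ?_
    have := ih (t := t + 1) fun i hi => by rw [add_assoc, add_comm 1]; exact hy _ (by omega)
    rwa [add_assoc, add_comm 1] at this

theorem cStep_match (hy : IsSpelling y p e m) {k : ℕ} {load acc : Bool} (h1 : e k = S.par)
    (h2 : e (k + 1) = S.chi) :
    Relation.TransGen (CStep S n K y) (p k, .br load acc, m k)
      (p (k + 1) + 1, .br true true, 0) := by
  have h := cStep_bcmp_ticks (S := S) (n := n) (K := K) (hy.tick k)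
  rw [add_right_comm, ← hy.succ] at h
  exact .head' (cStep_intro (.br_par _ _ _) (h1 ▸ hy.letter k) rfl (by simp))
    (h.tail (cStep_intro .bcmp_chi (h2 ▸ hy.letter (k + 1)) (by simp) (by simp)))

/-- The milestones are the accepting configurations right after each `chi`. In between, its block is
loaded, other blocks are passed, and the next `par` is matched. The first match uses the initial
counter `0`. -/
theorem cAccepts_of_hasOrderedChain (hy : IsSpelling y p e m) (hinit : e 0 = S.init)
    (h : S.HasOrderedChain e m) : CAccepts S n K y := by
  obtain ⟨k, hk, hpc, hm0, hm⟩ := h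
  have h0 : y 0 = some S.init := by have := hy.letter 0; rwa [hy.zero, hinit] at this
  refine cAccepts_of_transGen (z := fun i => Nat.casesOn i (0, .start, 0)
    fun i => (p (k i + 1) + 1, .br true true, 0)) rfl ?_ fun i => .br true
  rintro (_ | i)
  · have hk0 : k 0 ≠ 0 := by
      intro h
      have := (hpc 0).1
      rw [h, hinit] at this
      exact S.par_ne_init this.symm
    obtain ⟨acc, a1⟩ := cStep_br_ticks (S := S) (n := n) (K := K) (c := 0) (load := false)
      (acc := false) (hy.tick 0)
    rw [add_right_comm, ← hy.succ, hy.zero] at a1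
    obtain ⟨load', acc', a2⟩ := cStep_br_blocks (S := S) (n := n) (K := K) (c := 0)
      (load := false) (acc := acc) (k := 0 + 1) hy (k 0 - 1)
    rw [show 0 + 1 + (k 0 - 1) = k 0 by omega] at a2
    have a3 := cStep_match (n := n) (K := K) (load := load') (acc := acc') hy (hpc 0).1 (hpc 0).2
    rw [hm0] at a3
    refine .head (cStep_intro (.start_br _) h0 rfl (c' := 0) (by simp)) ?_
    refine .trans_right (a1.trans ?_) a3
    simpa using a2
  · obtain ⟨acc, a1⟩ := cStep_br_ticks (S := S) (n := n) (K := K) (c := 0) (load := true)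
      (acc := true) (hy.tick (k i + 1))
    rw [add_right_comm, ← hy.succ] at a1
    obtain ⟨load', acc', a2⟩ := cStep_br_blocks (S := S) (n := n) (K := K) (c := m (k i + 1))
      (load := true) (acc := acc) (k := k i + 1 + 1) hy (k (i + 1) - (k i + 1 + 1))
    have hlt := OpSystem.lt_of_par_chi (hpc i).2 (hpc (i + 1)).1 (hk (Nat.lt_succ_self i))
    rw [Nat.add_sub_cancel' hlt] at a2
    have a3 := cStep_match (n := n) (K := K) (load := load') (acc := acc') hy (hpc (i + 1)).1
      (hpc (i + 1)).2
    rw [← hm] at a3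
    refine .trans_right (.trans ?_ a2) a3
    simpa using a1

/-- A word without the right first letter or with finitely many `par` is accepted at once. Any other
spells a candidate execution: either one of the rules fails and the corresponding check accepts, or
there is an ordered chain. -/
theorem cAccepts_of_forall (hK : ∀ e, ∀ x ∈ (S.op e).2, x.1 < K)
    (h : ∀ e m, S.IsExec n e m → S.HasOrderedChain e m) (y : ℕ → Option E) :
    CAccepts S n K y := by
  by_cases h0 : y 0 = some S.init
  swap
  · exact cAccepts_of_start h0
  by_cases hpar : ∃ᶠ t in atTop, y t = some S.par
  swap
  · exact cAccepts_of_quiet h0 hpar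
  obtain ⟨p, e, m, hy⟩ := exists_isSpelling_of_word (y := y) (by rw [h0]; simp)
    (hpar.mono fun t ht => by rw [ht]; simp)
  have hinit : e 0 = S.init := by
    have := hy.letter 0
    rw [hy.zero, h0] at this
    exact (Option.some.inj this).symm
  by_contra hacc
  have hexec : S.IsExec n e m := by
    refine ⟨hinit, ?_, fun k => ?_, fun k => ?_, hy.frequently_par hpar⟩
    · by_contra hn
      exact hacc (cAccepts_of_input hy hinit hn)
    · by_contra hn
      exact hacc (cAccepts_of_not_follow hy hinit hn)
    · by_contra hn
      exact hacc (cAccepts_of_not_ok hK hy hinit hn)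
  exact hacc (cAccepts_of_hasOrderedChain hy hinit (h e m hexec))

theorem exists_not_cAccepts (h : ∃ e m, S.IsExec n e m ∧ ¬ S.HasChain e m) :
    ∃ y : ℕ → Option E, ¬ CAccepts S n K y := by
  obtain ⟨e, m, he, hc⟩ := h
  obtain ⟨y, p, hy⟩ := exists_isSpelling e m
  exact ⟨y, fun hacc => hc (hasChain_of_cAccepts hy he hacc)⟩

end Complete

end Counter

/-! ### Games in which only the letters of Player 2 matter -/

section Solitaire

variable {X : Type}

/-- The play in which Player 1 uses the strategy `F` and Player 2 writes `y`. -/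
def roundsAgainst (F : List (X × X) → X) (y : ℕ → X) : ℕ → List (X × X)
  | 0 => []
  | n + 1 => roundsAgainst F y n ++ [(F (roundsAgainst F y n), y n)]

/-- Against a winning strategy of Player 1, Player 2 is still free to write any `y`. -/
theorem mem_of_player1Wins {W : Set (ℕ → X)} {L : Set (ℕ → X)}
    (hW : ∀ x, x ∈ W ↔ (fun t => x (2 * t + 1)) ∈ L) (h : Player1Wins W) (y : ℕ → X) : y ∈ L := by
  obtain ⟨F, hF⟩ := h
  let x : ℕ → X := fun t => if t % 2 = 0 then F (roundsAgainst F y (t / 2)) else y (t / 2)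
  have h0 : ∀ n, x (2 * n) = F (roundsAgainst F y n) := fun n => by simp [x]
  have h1 : ∀ n, x (2 * n + 1) = y n := fun n => by
    have : (2 * n + 1) / 2 = n := by omega
    simp [x, Nat.add_mod, this]
  have hr : ∀ n, rounds x n = roundsAgainst F y n := by
    intro n
    induction n with
    | zero => rfl
    | succ n ih =>
      rw [roundsAgainst, ← ih, rounds, List.range_succ, List.map_append, ← rounds]
      simp [h0, h1, ih]
  have := (hW x).1 (hF x fun n => by rw [h0, hr])
  simpa only [h1] using this

theorem player1Wins_of_forall [Nonempty X] {W : Set (ℕ → X)} {L : Set (ℕ → X)}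
    (hW : ∀ x, x ∈ W ↔ (fun t => x (2 * t + 1)) ∈ L) (h : ∀ y, y ∈ L) : Player1Wins W :=
  ⟨fun _ => Classical.arbitrary X, fun x _ => (hW x).2 (h _)⟩

theorem player2Wins_of_notMem {W : Set (ℕ → X)} {L : Set (ℕ → X)}
    (hW : ∀ x, x ∈ W ↔ (fun t => x (2 * t + 1)) ∈ L) {y : ℕ → X} (h : y ∉ L) : Player2Wins W := by
  refine ⟨fun l _ => y l.length, fun x hx hmem => h ?_⟩
  have : (fun t => x (2 * t + 1)) = y := funext fun t => by rw [hx]; simp [rounds]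
  rw [← this]
  exact (hW x).1 hmem

end Solitaire

/-! ### Numbering the states -/

/-- With the states `pre i` numbered consecutively above all others, the part of the automaton that
varies with `n` has an explicit arithmetic description. -/
theorem exists_numbering {Q : Type} {pre : ℕ → Q} (hpre : Function.Injective pre)
    (hfin : {q | q ∉ Set.range pre}.Finite) : ∃ (B : ℕ) (num : Q → ℕ), Function.Injective num ∧
      (∀ i, num (pre i) = B + i) ∧ ∀ q, q ∉ Set.range pre → num q < B := by
  classical
  have := hfin.to_subtype
  let ε := Finite.equivFin {q | q ∉ Set.range pre}
  let num : Q → ℕ := fun q => if h : ∃ i, pre i = q then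
    Nat.card {q | q ∉ Set.range pre} + h.choose else (ε ⟨q, h⟩ : ℕ)
  have h1 : ∀ i, num (pre i) = Nat.card {q | q ∉ Set.range pre} + i := by
    intro i
    have h : ∃ j, pre j = pre i := ⟨i, rfl⟩
    simp only [num, dif_pos h]
    rw [hpre h.choose_spec]
  have h2 : ∀ q (h : q ∉ Set.range pre), num q = ε ⟨q, h⟩ := fun q h => dif_neg h
  refine ⟨_, num, ?_, h1, fun q h => by rw [h2 q h]; exact Fin.is_lt _⟩
  intro q q' hq
  by_cases h : q ∈ Set.range pre <;> by_cases h' : q' ∈ Set.range pre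
  · obtain ⟨i, rfl⟩ := h
    obtain ⟨i', rfl⟩ := h'
    rw [h1, h1] at hq
    rw [Nat.add_left_cancel hq]
  · obtain ⟨i, rfl⟩ := h
    rw [h1, h2 q' h'] at hq
    have := (ε ⟨q', h'⟩).is_lt
    omega
  · obtain ⟨i', rfl⟩ := h'
    rw [h1, h2 q h] at hq
    have := (ε ⟨q, h⟩).is_lt
    omega
  · rw [h2 q h, h2 q' h'] at hq
    exact congrArg Subtype.val (ε.injective (Fin.ext hq))

theorem CState.pre_injective (E : Type) (K : ℕ) :
    Function.Injective (CState.pre : ℕ → CState E K) := fun _ _ h => by cases h; rfl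

theorem CState.finite_notMem_range_pre (E : Type) [Finite E] (K : ℕ) :
    {q : CState E K | q ∉ Set.range CState.pre}.Finite := by
  refine (Set.finite_range (fun x : Fin 5 ⊕ E ⊕ (Fin K × Bool) ⊕ Bool ⊕ (Bool × Bool) =>
    match x with
    | .inl i => ![CState.sink, .start, .skip, .quiet, .bcmp] i
    | .inr (.inl e) => .fol e
    | .inr (.inr (.inl (j, b))) => .hold j b
    | .inr (.inr (.inr (.inl b))) => .cmp b
    | .inr (.inr (.inr (.inr (b, b')))) => .br b b')).subset ?_
  rintro (_ | _ | _ | _ | e | ⟨j, b⟩ | b | ⟨b, b'⟩ | _ | i) hq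
  · exact ⟨.inl 0, rfl⟩
  · exact ⟨.inl 1, rfl⟩
  · exact ⟨.inl 2, rfl⟩
  · exact ⟨.inl 3, rfl⟩
  · exact ⟨.inr (.inl e), rfl⟩
  · exact ⟨.inr (.inr (.inl (j, b))), rfl⟩
  · exact ⟨.inr (.inr (.inr (.inl b))), rfl⟩
  · exact ⟨.inr (.inr (.inr (.inr (b, b')))), rfl⟩
  · exact ⟨.inl 4, rfl⟩
  · exact absurd ⟨i, rfl⟩ hq

/-! ### The 1-counter automata of the games -/

section CounterGame

variable {E : Type} (S : OpSystem E) (K : ℕ) {k : ℕ} (ε : Option E ≃ Fin k) (num : CState E K → ℕ)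

/-- The transitions of the game automaton, which ignores the letters of Player 1; the second
component of a state tells whether the letter of Player 2 is next. -/
inductive GTrans (n : ℕ) : CState E K × Bool → Fin k → Bool → CState E K × Bool → ℤ → Prop
  | ignore {q : CState E K} (h : ∀ i, q = .pre i → i ≤ n) (a b) :
      GTrans n (q, false) a b (q, true) 0
  | read {q q' : CState E K} {a b j} (h : CTrans S n K q (ε.symm a) b q' j) :
      GTrans n (q, true) a b (q', false) j

def gnum (q : CState E K × Bool) : ℕ := 2 * num q.1 + q.2.toNat

variable {K num} in
theorem gnum_injective (h : Function.Injective num) : Function.Injective (gnum K num) := by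
  rintro ⟨q, b⟩ ⟨q', b'⟩ hq
  simp only [gnum] at hq
  cases b <;> cases b' <;> simp at hq
  · rw [h (show num q = num q' by omega)]
  · omega
  · omega
  · rw [h (show num q = num q' by omega)]

/-- The transitions that do not depend on `n`. -/
def fixedTrans : Set (ℕ × ℕ × Bool × ℕ × ℤ) :=
  {x | ∃ q a b q' j, q.1 ∉ Set.range CState.pre ∧ GTrans S K ε 0 q a b q' j ∧
    x = (gnum K num q, (a : ℕ), b, gnum K num q', j)}

def letterBits (k : ℕ) : List (ℕ × Bool) := (List.range k).product [false, true]

theorem mem_letterBits {k : ℕ} {x : ℕ × Bool} : x ∈ letterBits k ↔ x.1 < k := by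
  obtain ⟨a, b⟩ := x
  cases b <;> simp [letterBits, List.product]

/-- The transitions from the states `pre i` with `i ≤ n`. -/
def chainTrans (k B tick sink n : ℕ) : List (ℕ × ℕ × Bool × ℕ × ℤ) :=
  (List.range (n + 1)).flatMap fun i =>
    ((letterBits k).map fun x => (2 * (B + i), x.1, x.2, 2 * (B + i) + 1, (0 : ℤ))) ++
    ((letterBits k).map fun x => (2 * (B + i) + 1, x.1, x.2,
      if i < n then (if x.1 = tick then 2 * (B + (i + 1)) else sink)
      else (if x.1 = tick then sink else 2 * (B + (i + 1))), (0 : ℤ)))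

theorem primrec_chainTrans (k B tick sink : ℕ) : Primrec (chainTrans k B tick sink) := by
  unfold chainTrans
  have hi : Primrec fun p : (ℕ × ℕ) × (ℕ × Bool) => B + p.1.2 :=
    Primrec.nat_add.comp (Primrec.const _) (Primrec.snd.comp Primrec.fst)
  have hd : Primrec fun p : (ℕ × ℕ) × (ℕ × Bool) => 2 * (B + p.1.2) :=
    Primrec.nat_mul.comp (Primrec.const _) hi
  have hd' : Primrec fun p : (ℕ × ℕ) × (ℕ × Bool) => 2 * (B + (p.1.2 + 1)) :=
    Primrec.nat_mul.comp (Primrec.const _) (Primrec.succ.comp hi)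
  have hx : Primrec fun p : (ℕ × ℕ) × (ℕ × Bool) => p.2.1 := Primrec.fst.comp Primrec.snd
  have hb : Primrec fun p : (ℕ × ℕ) × (ℕ × Bool) => p.2.2 := Primrec.snd.comp Primrec.snd
  have hlt : PrimrecPred fun p : (ℕ × ℕ) × (ℕ × Bool) => p.1.2 < p.1.1 :=
    Primrec.nat_lt.comp (Primrec.snd.comp Primrec.fst) (Primrec.fst.comp Primrec.fst)
  have ht : PrimrecPred fun p : (ℕ × ℕ) × (ℕ × Bool) => p.2.1 = tick :=
    Primrec.eq.comp hx (Primrec.const _)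
  refine Primrec.list_flatMap (Primrec.list_range.comp Primrec.succ) (Primrec.list_append.comp
    (Primrec.list_map (Primrec.const _) ?_) (Primrec.list_map (Primrec.const _) ?_))
  · exact hd.pair (hx.pair (hb.pair ((Primrec.succ.comp hd).pair (Primrec.const _))))
  · exact (Primrec.succ.comp hd).pair (hx.pair (hb.pair (Primrec.pair
      (Primrec.ite hlt (Primrec.ite ht hd' (Primrec.const _))
        (Primrec.ite ht (Primrec.const _) hd')) (Primrec.const _))))

variable {S K num ε}

/-- The parameter `n` governs only the transitions leaving the states `pre i`, so the remaining ones
form one list common to all `n`. -/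
theorem CTrans.of_notMem {n n' : ℕ} {q q' : CState E K} {a b j} (h : CTrans S n K q a b q' j)
    (hq : q ∉ Set.range CState.pre) : CTrans S n' K q a b q' j := by
  cases h with
  | pre_next => exact absurd ⟨_, rfl⟩ hq
  | pre_sink => exact absurd ⟨_, rfl⟩ hq
  | _ => constructor <;> assumption

/-- The row of states `pre i` can be entered only at `pre 0`; this makes the common part finite. -/
theorem CTrans.target {n : ℕ} {q q' : CState E K} {a b j} (h : CTrans S n K q a b q' j)
    (hq : q ∉ Set.range CState.pre) : q' ∉ Set.range CState.pre ∨ q' = .pre 0 := by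
  cases h with
  | pre_next => exact absurd ⟨_, rfl⟩ hq
  | pre_sink => exact absurd ⟨_, rfl⟩ hq
  | start_pre => exact .inr rfl
  | _ => left; rintro ⟨i, hi⟩; cases hi

theorem CTrans.change {n : ℕ} {q q' : CState E K} {a b j} (h : CTrans S n K q a b q' j) :
    (j = -1 ∨ j = 0 ∨ j = 1) ∧ (b = false → j ≠ -1) := by
  cases h with
  | hold_tick j load => cases load <;> simp
  | br_tick load => cases load <;> simp
  | _ => simp

theorem mem_fixedTrans_or_chainTrans {B : ℕ} (hB : ∀ i, num (.pre i) = B + i) {n : ℕ}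
    {x : ℕ × ℕ × Bool × ℕ × ℤ} :
    (x ∈ fixedTrans S K ε num ∨ x ∈ chainTrans k B (ε none) (2 * num .sink) n) ↔
      ∃ q a b q' j, GTrans S K ε n q a b q' j ∧
        x = (gnum K num q, (a : ℕ), b, gnum K num q', j) := by
  constructor
  · rintro (⟨q, a, b, q', j, hq, h, rfl⟩ | h)
    · refine ⟨q, a, b, q', j, ?_, rfl⟩
      cases h with
      | ignore h => exact .ignore (fun i hi => absurd ⟨i, hi.symm⟩ hq) _ _
      | read h => exact .read (h.of_notMem hq)
    · simp only [chainTrans, List.mem_flatMap, List.mem_range, List.mem_append, List.mem_map,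
        mem_letterBits] at h
      obtain ⟨i, hi, ⟨⟨a, b⟩, ha, rfl⟩ | ⟨⟨a, b⟩, ha, rfl⟩⟩ := h
      · refine ⟨(.pre i, false), ⟨a, ha⟩, b, (.pre i, true), 0,
          .ignore (fun i' h => by cases h; omega) _ _, ?_⟩
        simp [gnum, hB]
      · have htick : ε.symm ⟨a, ha⟩ = none ↔ a = (ε none : ℕ) := by
          rw [Equiv.symm_apply_eq, Fin.ext_iff]
        by_cases hc : i < n ↔ ε.symm ⟨a, ha⟩ = none
        · refine ⟨(.pre i, true), ⟨a, ha⟩, b, (.pre (i + 1), false), 0,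
            .read (.pre_next (by omega) hc _), ?_⟩
          rw [htick] at hc
          by_cases hin : i < n <;> simp [gnum, hB, hin, ← hc]
        · refine ⟨(.pre i, true), ⟨a, ha⟩, b, (.sink, false), 0,
            .read (.pre_sink (by omega) hc _), ?_⟩
          rw [htick] at hc
          by_cases hin : i < n <;> by_cases ht : a = (ε none : ℕ) <;> simp_all [gnum]
  · rintro ⟨q, a, b, q', j, h, rfl⟩
    by_cases hq : q.1 ∈ Set.range CState.pre
    · right
      simp only [chainTrans, List.mem_flatMap, List.mem_range, List.mem_append, List.mem_map,
        mem_letterBits]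
      obtain ⟨i, hi⟩ := hq
      have htick : ε.symm a = none ↔ (a : ℕ) = (ε none : ℕ) := by
        rw [Equiv.symm_apply_eq, Fin.ext_iff]
      cases h with
      | ignore h =>
        cases hi
        exact ⟨i, Nat.lt_succ_of_le (h i rfl), .inl ⟨(a, b), a.is_lt, by simp [gnum, hB]⟩⟩
      | read h =>
        cases hi
        cases h with
        | pre_next h hc =>
          refine ⟨i, Nat.lt_succ_of_le h, .inr ⟨(a, b), a.is_lt, ?_⟩⟩
          rw [htick] at hc
          by_cases hin : i < n <;> simp [gnum, hB, hin, ← hc]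
        | pre_sink h hc =>
          refine ⟨i, Nat.lt_succ_of_le h, .inr ⟨(a, b), a.is_lt, ?_⟩⟩
          rw [htick] at hc
          by_cases hin : i < n <;> by_cases ht : (a : ℕ) = (ε none : ℕ) <;> simp_all [gnum]
    · left
      refine ⟨q, a, b, q', j, hq, ?_, rfl⟩
      cases h with
      | ignore h => exact .ignore (fun i hi => absurd ⟨i, hi.symm⟩ hq) _ _
      | read h => exact .read (h.of_notMem hq)

theorem finite_fixedTrans {B : ℕ} (hB : ∀ i, num (.pre i) = B + i)
    (hlt : ∀ q, q ∉ Set.range CState.pre → num q < B) : (fixedTrans S K ε num).Finite := by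
  refine ((Set.finite_lt_nat (2 * B + 2)).prod ((Set.finite_lt_nat k).prod
    ((Set.finite_univ (α := Bool)).prod ((Set.finite_lt_nat (2 * B + 2)).prod
      (Set.toFinite {-1, 0, (1 : ℤ)}))))).subset ?_
  rintro _ ⟨q, a, b, q', j, hq, h, rfl⟩
  have h1 := hlt _ hq
  cases h with
  | ignore h =>
    simp only [gnum, Set.mem_prod, Set.mem_ofPred_eq, Set.mem_univ, Fin.is_lt, true_and]
    simp
    simp only at h1
    omega
  | @read q q' _ _ _ h =>
    have h2 := h.change.1
    have h3 : num q' ≤ B := by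
      rcases h.target hq with h | rfl
      · exact (hlt _ h).le
      · simp [hB]
    simp only [gnum, Set.mem_prod, Set.mem_ofPred_eq, Set.mem_univ, Fin.is_lt, true_and]
    simp
    simp only at h1
    exact ⟨by omega, by omega, by omega⟩

theorem CState.isAccepting_iff {q : CState E K} : q.IsAccepting ↔
    q ∈ [CState.sink, .quiet, .br false true, .br true true] := by
  constructor
  · rintro (_ | _ | (_ | _)) <;> simp
  · intro h
    simp only [List.mem_cons, List.not_mem_nil, or_false] at h
    rcases h with rfl | rfl | rfl | rfl <;> constructor

theorem CState.IsAccepting.notMem {q : CState E K} (h : q.IsAccepting) :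
    q ∉ Set.range CState.pre := by
  rintro ⟨i, rfl⟩
  cases h

theorem frequently_mem_list {α : Type*} {l : List α} {q : ℕ → α} :
    (∃ᶠ t in atTop, q t ∈ l) ↔ ∃ a ∈ l, ∃ᶠ t in atTop, q t = a := by
  induction l with
  | nil => simp
  | cons a l ih => simp [frequently_or_distrib, ih]

/-- The automaton of the game with the parameter `n`. -/
noncomputable def gameAutomaton {B : ℕ} (hB : ∀ i, num (.pre i) = B + i)
    (hlt : ∀ q, q ∉ Set.range CState.pre → num q < B) (S : OpSystem E) (ε : Option E ≃ Fin k)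
    (n : ℕ) : CounterAutomaton where
  -- The last state of the row is `pre (n + 1)`, with number `B + n + 1`; the factor `2` accounts
  -- for the player whose letter is next.
  numStates := 2 * (B + n + 2)
  numLetters := k
  trans := (finite_fixedTrans (S := S) (ε := ε) hB hlt).toFinset.toList ++
    chainTrans k B (ε none) (2 * num .sink) n
  init := 2 * num .start
  accept := [CState.sink, .quiet, .br false true, .br true true].map fun q => 2 * num q
  numLetters_pos := Fin.pos (ε none)
  init_lt := by
    have := hlt .start (by rintro ⟨i, hi⟩; cases hi)
    omega
  accept_lt := by
    intro q hq
    obtain ⟨q, hq', rfl⟩ := List.mem_map.1 hq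
    have := hlt q (CState.isAccepting_iff.2 hq').notMem
    omega
  trans_valid := by
    intro q a b q' j h
    rw [List.mem_append, Finset.mem_toList, Set.Finite.mem_toFinset,
      mem_fixedTrans_or_chainTrans hB] at h
    obtain ⟨s, a, b, s', j, h, he⟩ := h
    obtain ⟨rfl, rfl, rfl, rfl, rfl⟩ : _ ∧ _ ∧ _ ∧ _ ∧ _ := by simpa using he
    have hbound : ∀ (q : CState E K) d, (∀ i, q = .pre i → i ≤ n + 1) →
        gnum K num (q, d) < 2 * (B + n + 2) := by
      intro q d hq
      have hd : d.toNat ≤ 1 := Bool.toNat_le d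
      by_cases h : q ∈ Set.range CState.pre
      · obtain ⟨i, rfl⟩ := h
        have := hq i rfl
        simp only [gnum, hB]
        omega
      · have := hlt q h
        simp only [gnum]
        omega
    cases h with
    | ignore h =>
      exact ⟨hbound _ _ fun i hi => (h i hi).trans (by omega), a.is_lt,
        hbound _ _ fun i hi => (h i hi).trans (by omega), by simp⟩
    | @read q q' _ _ _ h =>
      refine ⟨hbound _ _ ?_, a.is_lt, hbound _ _ ?_, h.change.1⟩
      · rintro i rfl
        cases h <;> omega
      · rintro i rfl
        generalize ε.symm a = a' at h
        cases h <;> omega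
  trans_zero := by
    intro q a q' j h
    rw [List.mem_append, Finset.mem_toList, Set.Finite.mem_toFinset,
      mem_fixedTrans_or_chainTrans hB] at h
    obtain ⟨s, a, b, s', j, h, he⟩ := h
    obtain ⟨rfl, rfl, rfl, rfl, rfl⟩ : _ ∧ _ ∧ _ ∧ _ ∧ _ := by simpa using he
    cases h with
    | ignore h => simp
    | read h => exact h.change.2 rfl

variable {B : ℕ} {hB : ∀ i, num (.pre i) = B + i}
    {hlt : ∀ q, q ∉ Set.range CState.pre → num q < B}

/-- The common transitions are chosen noncomputably, but as a constant list; only the row of states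
`pre i` and the number of states vary. -/
theorem computable_gameAutomaton : Computable fun n => (gameAutomaton hB hlt S ε n).code := by
  refine Primrec.to_comp (Primrec.pair ?_ (Primrec.pair (Primrec.const _) (Primrec.pair ?_
    (Primrec.pair (Primrec.const _) (Primrec.const _)))))
  · exact Primrec.nat_mul.comp (Primrec.const 2) (Primrec.succ.comp (Primrec.succ.comp
      (Primrec.nat_add.comp (Primrec.const B) Primrec.id)))
  · exact Primrec.list_append.comp (Primrec.const _) (primrec_chainTrans _ _ _ _)

theorem mem_trans_gameAutomaton {n : ℕ} {x : ℕ × ℕ × Bool × ℕ × ℤ} :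
    x ∈ (gameAutomaton hB hlt S ε n).trans ↔ ∃ q a b q' j, GTrans S K ε n q a b q' j ∧
        x = (gnum K num q, (a : ℕ), b, gnum K num q', j) := by
  rw [← mem_fixedTrans_or_chainTrans hB, ← Set.Finite.mem_toFinset (finite_fixedTrans hB hlt),
    ← Finset.mem_toList, ← List.mem_append]
  rfl

/-- At even times the automaton only skips a letter of Player 1, so the even times of a run form a
run on the letters of Player 2, and conversely. -/
theorem mem_language_gameAutomaton (hnum : Function.Injective num) {n : ℕ} (x : ℕ → Fin k) :
    x ∈ (gameAutomaton hB hlt S ε n).language ↔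
      CAccepts S n K fun t => ε.symm (x (2 * t + 1)) := by
  have hacc : (gameAutomaton hB hlt S ε n).accept =
    [CState.sink, .quiet, .br false true, .br true true].map fun q => 2 * num q := rfl
  constructor
  · rintro ⟨q, c, ⟨hq0, hc0, hstep⟩, r, hr, hfreq⟩
    rw [hacc, List.mem_map] at hr
    obtain ⟨r, hr, rfl⟩ := hr
    have hstep' : ∀ t, ∃ s s' j, q t = gnum K num s ∧ q (t + 1) = gnum K num s' ∧
        GTrans S K ε n s (x t) (decide (0 < c t)) s' j ∧ (c (t + 1) : ℤ) = c t + j := by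
      intro t
      obtain ⟨j, hj, hcj⟩ := hstep t
      rw [mem_trans_gameAutomaton] at hj
      obtain ⟨s, a, b, s', j', h, he⟩ := hj
      simp only [Prod.mk.injEq] at he
      obtain ⟨h1, h2, h3, h4, h5⟩ := he
      refine ⟨s, s', j', h1, h4, ?_, h5 ▸ hcj⟩
      rw [h3, show x t = a from Fin.ext h2]
      exact h
    choose s s' j h1 h2 h3 h4 using hstep'
    -- The end of one step and the beginning of the next have the same number, so injectivity
    -- identifies them.
    have hs : ∀ t, s' t = s (t + 1) := fun t =>
      gnum_injective hnum ((h2 t).symm.trans (h1 (t + 1)))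
    simp only [hs] at h3
    have s0 : s 0 = (.start, false) := by
      refine gnum_injective hnum ((h1 0).symm.trans (hq0.trans ?_))
      simp [gnum, gameAutomaton]
    have hround : ∀ t, (s t).2 = false → s (t + 1) = ((s t).1, true) ∧ c (t + 1) = c t := by
      intro t ht
      have h := h3 t
      have hc := h4 t
      generalize s (t + 1) = u' at h
      generalize s t = u at h ht
      generalize decide (0 < c t) = b at h
      generalize j t = j' at h hc
      cases h with
      | ignore => exact ⟨rfl, by simpa using hc⟩
      | read => cases ht
    have hround' : ∀ t, (s t).2 = true → (s (t + 1)).2 = false ∧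
        CTrans S n K (s t).1 (ε.symm (x t)) (decide (0 < c t)) (s (t + 1)).1 (j t) := by
      intro t ht
      have h := h3 t
      generalize s (t + 1) = u' at h ⊢
      generalize s t = u at h ht ⊢
      generalize decide (0 < c t) = b at h ⊢
      generalize j t = j' at h ⊢
      cases h with
      | ignore => cases ht
      | read h => exact ⟨rfl, h⟩
    have heven : ∀ t, (s (2 * t)).2 = false := by
      intro t
      induction t with
      | zero => rw [mul_zero, s0]
      | succ t ih => exact (hround' (2 * t + 1) (by rw [(hround _ ih).1])).1
    refine ⟨fun t => (s (2 * t)).1, fun t => c (2 * t), ?_, hc0, fun t => ⟨j (2 * t + 1), ?_, ?_⟩, ?_⟩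
    · simp [s0]
    · obtain ⟨e1, e2⟩ := hround _ (heven t)
      have := (hround' (2 * t + 1) (by rw [e1])).2
      rwa [e1, e2] at this
    · have := h4 (2 * t + 1)
      rw [(hround _ (heven t)).2] at this
      exact this
    · refine frequently_atTop.2 fun N => ?_
      obtain ⟨T, hT, hq⟩ := frequently_atTop.1 hfreq (2 * N)
      -- Accepting states have second component `false`, so they occur at even times only.
      have hsT : s T = (r, false) := by
        refine gnum_injective hnum ((h1 T).symm.trans (hq.trans ?_))
        simp [gnum]
      obtain ⟨t, rfl | rfl⟩ : ∃ t, T = 2 * t ∨ T = 2 * t + 1 := ⟨T / 2, by omega⟩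
      · refine ⟨t, by omega, ?_⟩
        rw [hsT]
        exact CState.isAccepting_iff.2 hr
      · rw [(hround _ (heven t)).1] at hsT
        cases hsT
  · rintro ⟨q, c, hq0, hc0, hstep, hfreq⟩
    have hodd : ∀ t, (2 * t + 1) / 2 = t := fun t => by omega
    -- An infinite run never visits the dead end `pre (n + 1)`, so the skipping transition is
    -- available.
    have hpre : ∀ t i, q t = .pre i → i ≤ n := by
      intro t i hi
      obtain ⟨j, hj, -⟩ := hstep t
      rw [hi] at hj
      generalize ε.symm (x (2 * t + 1)) = a at hj
      generalize q (t + 1) = q' at hj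
      cases hj <;> assumption
    simp only [CState.isAccepting_iff] at hfreq
    obtain ⟨r, hr, hfreq⟩ := frequently_mem_list.1 hfreq
    refine ⟨fun t => gnum K num (q (t / 2), decide (t % 2 = 1)), fun t => c (t / 2),
      ⟨?_, by simpa using hc0, fun T => ?_⟩, 2 * num r, ?_, ?_⟩
    · simp [gnum, hq0, gameAutomaton]
    · simp only [mem_trans_gameAutomaton]
      obtain ⟨t, rfl | rfl⟩ : ∃ t, T = 2 * t ∨ T = 2 * t + 1 := ⟨T / 2, by omega⟩
      · refine ⟨0, ⟨_, _, _, _, _, .ignore (hpre t) (x (2 * t)) (decide (0 < c t)), ?_⟩, ?_⟩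
        · simp [hodd, Nat.add_mod]
        · simp [hodd]
      · obtain ⟨j, hj, hcj⟩ := hstep t
        have h2 : (2 * t + 1 + 1) / 2 = t + 1 := by omega
        have h3 : (2 * t + 1 + 1) % 2 = 0 := by omega
        refine ⟨j, ⟨_, _, _, _, _, .read hj, ?_⟩, ?_⟩
        · simp [hodd, h2, h3, Nat.add_mod]
        · simpa [hodd, h2] using hcj
    · rw [hacc]
      exact List.mem_map.2 ⟨r, hr, rfl⟩
    · refine frequently_atTop.2 fun N => ?_
      obtain ⟨t, ht, hq⟩ := frequently_atTop.1 hfreq N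
      exact ⟨2 * t, by omega, by simp [gnum, hq]⟩

end CounterGame

theorem exists_register_bound {E : Type} [Finite E] (S : OpSystem E) :
    ∃ K, ∀ e, ∀ x ∈ (S.op e).2, x.1 < K := by
  have hfin : (⋃ e, {j | ∃ x ∈ (S.op e).2, x.1 = j}).Finite :=
    Set.finite_iUnion fun e => (S.op e).2.finite_toSet.image Prod.fst
  obtain ⟨K, hK⟩ := hfin.bddAbove
  exact ⟨K + 1, fun e x hx => Nat.lt_succ_of_le (hK (Set.mem_iUnion.2 ⟨e, x, hx, rfl⟩))⟩

theorem exists_counterAutomata : ∃ A : ℕ → CounterAutomaton,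
    Computable (fun n => (A n).code) ∧ (∀ n, Determined (A n).language) ∧
      IsPi12Complete {n | Player1Wins (A n).language} := by
  obtain ⟨E, _, S, hin, hout⟩ := exists_opSystem
  obtain ⟨K, hK⟩ := exists_register_bound S
  obtain ⟨B, num, hnum, hB, hlt⟩ := exists_numbering (CState.pre_injective E K)
    (CState.finite_notMem_range_pre E K)
  let ε := Finite.equivFin (Option E)
  let L : ℕ → Set (ℕ → Fin (Nat.card (Option E))) := fun n =>
    {y | CAccepts S n K fun t => ε.symm (y t)}
  have hL : ∀ n x, x ∈ (gameAutomaton hB hlt S ε n).language ↔ (fun t => x (2 * t + 1)) ∈ L n :=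
    fun n x => mem_language_gameAutomaton hnum x
  have h1 : ∀ n ∈ universalSet, Player1Wins (gameAutomaton hB hlt S ε n).language := fun n hn =>
    @player1Wins_of_forall _ ⟨ε none⟩ _ _ (hL n) fun y => cAccepts_of_forall hK (hin n hn) _
  have h2 : ∀ n ∉ universalSet, ∃ y, y ∉ L n := fun n hn => by
    obtain ⟨y, hy⟩ := exists_not_cAccepts (K := K) (hout n hn)
    exact ⟨fun t => ε (y t), by simpa [L] using hy⟩
  refine ⟨gameAutomaton hB hlt S ε, computable_gameAutomaton, fun n => ?_, ?_⟩
  · by_cases hn : n ∈ universalSet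
    · exact .inl (h1 n hn)
    · obtain ⟨y, hy⟩ := h2 n hn
      exact .inr (player2Wins_of_notMem (hL n) hy)
  · convert isPi12Complete_universalSet using 1
    ext n
    refine ⟨fun h => ?_, h1 n⟩
    by_contra hn
    obtain ⟨y, hy⟩ := h2 n hn
    exact hy (mem_of_player1Wins (hL n) h y)

/-! ### The 2-tape automaton, on the words written by Player 2 -/

inductive TState (E : Type) (K : ℕ) : Type
  | sink : TState E K
  | start : TState E K
  | skip : TState E K
  | quiet : TState E K
  | fol (e : E) : TState E K
  | hold (j : Fin K) : TState E K
  | cmp (δ : Bool) : TState E K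
  | br (mem acc : Bool) : TState E K
  | bcmp (mem : Bool) : TState E K
  | pre (i : ℕ) : TState E K

def TState.IsBranch {E : Type} {K : ℕ} : TState E K → Prop
  | .br _ _ => True
  | .bcmp _ => True
  | _ => False

inductive TState.IsAccepting {E : Type} {K : ℕ} : TState E K → Prop
  | sink : IsAccepting .sink
  | quiet : IsAccepting .quiet
  | br (mem : Bool) : IsAccepting (.br mem true)

/-- The automaton follows the same plan as the 1-counter automaton, on two copies of one word. A
number is kept in memory by leaving a head at the beginning of its block: the first head in the
states `hold` and `cmp`, and in the states `br mem` and `bcmp mem` the first head if `mem = true`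
and the second one otherwise. -/
inductive TTrans {E : Type} (S : OpSystem E) (n K : ℕ) :
    TState E K → List (Option E) → List (Option E) → TState E K → Prop
  | sink (a b) : TTrans S n K .sink [a] [b] .sink
  | start_sink {a} (h : a ≠ some S.init) (b) : TTrans S n K .start [a] [b] .sink
  | start_copy {b} (h : b ≠ some S.init) : TTrans S n K .start [some S.init] [b] .sink
  | start_skip : TTrans S n K .start [some S.init] [some S.init] .skip
  | start_quiet (b) : TTrans S n K .start [some S.init] [b] .quiet
  | start_fol (b) : TTrans S n K .start [some S.init] [b] (.fol S.init)
  | start_load (j : Fin K) (h : (S.op S.init).1 = j) :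
      TTrans S n K .start [some S.init] [some S.init] (.hold j)
  -- The first head stays at position `0`, in front of a letter other than `1`: an empty block,
  -- standing for the initial value `0`.
  | start_hold (j : Fin K) (h : (S.op S.init).1 ≠ j) :
      TTrans S n K .start [] [some S.init] (.hold j)
  | start_pre (b) : TTrans S n K .start [some S.init] [b] (.pre 0)
  | start_br : TTrans S n K .start [] [some S.init] (.br true false)
  | skip (a) : TTrans S n K .skip [a] [a] .skip
  | skip_copy {a b} (h : a ≠ b) : TTrans S n K .skip [a] [b] .sink
  | skip_quiet (a b) : TTrans S n K .skip [a] [b] .quiet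
  | skip_fol (e b) : TTrans S n K .skip [some e] [b] (.fol e)
  | skip_load (e) (j : Fin K) (h : (S.op e).1 = j) :
      TTrans S n K .skip [some e] [some e] (.hold j)
  | quiet {a} (h : a ≠ some S.par) (b) : TTrans S n K .quiet [a] [b] .quiet
  | fol_tick (e b) : TTrans S n K (.fol e) [none] [b] (.fol e)
  | fol_sink {e e'} (h : ¬ S.Follow e e') (b) : TTrans S n K (.fol e) [some e'] [b] .sink
  | hold_tick (j) : TTrans S n K (.hold j) [] [none] (.hold j)
  | hold_op (j : Fin K) {e} (h : (S.op e).1 ≠ j) :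
      TTrans S n K (.hold j) [] [some e] (.hold j)
  | hold_cmp (j : Fin K) {e δ} (h : ((j : ℕ), δ) ∈ (S.op e).2) :
      TTrans S n K (.hold j) [] [some e] (.cmp δ)
  | cmp_succ : TTrans S n K (.cmp true) [] [none] (.cmp false)
  | cmp_succ_sink (e) : TTrans S n K (.cmp true) [] [some e] .sink
  | cmp_tick : TTrans S n K (.cmp false) [none] [none] (.cmp false)
  | cmp_tick_sink (e) : TTrans S n K (.cmp false) [some e] [none] .sink
  | cmp_op_sink (e) : TTrans S n K (.cmp false) [none] [some e] .sink
  | br_move₁ (acc a) : TTrans S n K (.br true acc) [] [a] (.br true false)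
  | br_move₂ (acc a) : TTrans S n K (.br false acc) [a] [] (.br false false)
  | br_par₁ (acc) : TTrans S n K (.br true acc) [] [some S.par] (.bcmp true)
  | br_par₂ (acc) : TTrans S n K (.br false acc) [some S.par] [] (.bcmp false)
  | bcmp_tick (mem) : TTrans S n K (.bcmp mem) [none] [none] (.bcmp mem)
  -- The heads exchange roles: the one that read `chi` is now in front of the new number, and the
  -- former memory head goes on searching. Thus both heads advance forever.
  | bcmp_chi₁ (e) : TTrans S n K (.bcmp true) [some e] [some S.chi] (.br false true)
  | bcmp_chi₂ (e) : TTrans S n K (.bcmp false) [some S.chi] [some e] (.br true true)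
  | pre_next {i a} (h : i ≤ n) (ha : i < n ↔ a = none) :
      TTrans S n K (.pre i) [a] [] (.pre (i + 1))
  | pre_sink {i a} (h : i ≤ n) (ha : ¬ (i < n ↔ a = none)) :
      TTrans S n K (.pre i) [a] [] .sink

/-- The word `u` is read from `y` at the position `h`. -/
def Reads {α : Type} (y : ℕ → α) : ℕ → List α → Prop
  | _, [] => True
  | h, a :: u => y h = a ∧ Reads y (h + 1) u

section TwoTape

variable {E : Type} {S : OpSystem E} {n K : ℕ} {y₁ y₂ y : ℕ → Option E} {p : ℕ → ℕ} {e : ℕ → E}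
  {m : ℕ → ℕ}

/-- One step between configurations, which consist of a state and the positions of the heads. -/
def TStep (S : OpSystem E) (n K : ℕ) (y₁ y₂ : ℕ → Option E) (z z' : TState E K × ℕ × ℕ) : Prop :=
  ∃ u v, TTrans S n K z.1 u v z'.1 ∧ Reads y₁ z.2.1 u ∧ Reads y₂ z.2.2 v ∧
    z'.2.1 = z.2.1 + u.length ∧ z'.2.2 = z.2.2 + v.length

structure IsTRun (S : OpSystem E) (n K : ℕ) (y₁ y₂ : ℕ → Option E) (z : ℕ → TState E K × ℕ × ℕ) :
    Prop where
  zero : z 0 = (.start, 0, 0)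
  step : ∀ t, TStep S n K y₁ y₂ (z t) (z (t + 1))
  accepting : ∃ᶠ t in atTop, (z t).1.IsAccepting
  unbounded₁ : ∀ N, ∃ t, N ≤ (z t).2.1
  unbounded₂ : ∀ N, ∃ t, N ≤ (z t).2.2

def TAccepts (S : OpSystem E) (n K : ℕ) (y₁ y₂ : ℕ → Option E) : Prop := ∃ z, IsTRun S n K y₁ y₂ z

/-- At the position `h` there are `v` letters `1`, followed by another letter. -/
def IsBlock (y : ℕ → Option E) (h v : ℕ) : Prop :=
  (∀ i < v, y (h + i) = none) ∧ ∃ e, y (h + v) = some e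

theorem IsBlock.of_none {h v : ℕ} (hb : IsBlock y h v) (hy : y h = none) :
    ∃ v', v = v' + 1 ∧ IsBlock y (h + 1) v' := by
  obtain ⟨h1, e, he⟩ := hb
  obtain _ | v := v
  · rw [Nat.add_zero, hy] at he
    cases he
  · refine ⟨v, rfl, fun i hi => ?_, e, ?_⟩
    · rw [add_assoc, add_comm 1]; exact h1 _ (by omega)
    · rw [add_assoc, add_comm 1]; exact he

theorem IsBlock.of_some {h v : ℕ} (hb : IsBlock y h v) {e : E} (hy : y h = some e) : v = 0 := by
  by_contra hv
  have := hb.1 0 (by omega)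
  rw [Nat.add_zero, hy] at this
  cases this

namespace IsSpelling

theorem isBlock (h : IsSpelling y p e m) (k : ℕ) : IsBlock y (p k + 1) (m k) :=
  ⟨h.tick k, e (k + 1), by rw [← h.letter, h.succ, add_right_comm]⟩

theorem isBlock_zero (h : IsSpelling y p e m) : IsBlock y 0 0 :=
  ⟨fun _ h => absurd h (Nat.not_lt_zero _), e 0, by rw [← h.letter 0, h.zero]⟩

theorem lt_of_none (h : IsSpelling y p e m) {k i : ℕ} (hi : i ≤ m k)
    (hn : y (p k + 1 + i) = none) : i < m k := by
  refine lt_of_le_of_ne hi ?_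
  rintro rfl
  obtain ⟨e, he⟩ := (h.isBlock k).2
  rw [he] at hn
  cases hn

theorem eq_of_some (h : IsSpelling y p e m) {k i : ℕ} {e' : E} (hi : i ≤ m k)
    (hs : y (p k + 1 + i) = some e') : i = m k ∧ e' = e (k + 1) ∧ p k + 1 + i = p (k + 1) := by
  rcases hi.lt_or_eq with hlt | rfl
  · rw [h.tick k i hlt] at hs
    cases hs
  · have e1 : p k + 1 + m k = p (k + 1) := by rw [h.succ]; omega
    rw [e1, h.letter] at hs
    exact ⟨rfl, (Option.some.inj hs).symm, e1⟩

theorem exists_of_some (h : IsSpelling y p e m) {t : ℕ} {e' : E} (hs : y t = some e') :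
    ∃ k, t = p k ∧ e' = e k := by
  obtain _ | t := t
  · refine ⟨0, h.zero.symm, ?_⟩
    rw [← h.zero, h.letter] at hs
    exact (Option.some.inj hs).symm
  · obtain ⟨k, i, hi, ht⟩ := h.exists_pos t
    rw [ht] at hs
    obtain ⟨-, h2, h3⟩ := h.eq_of_some hi hs
    exact ⟨k + 1, ht.trans h3, h2⟩

end IsSpelling

/-! #### Accepted executions have chains -/

/-- The counterpart of `CInv` for two equal tapes: the length of the block in front of the first
head takes the place of the counter. -/
def TInv (S : OpSystem E) (n : ℕ) (y : ℕ → Option E) (p : ℕ → ℕ) (e : ℕ → E) (m : ℕ → ℕ)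
    (h₁ h₂ : ℕ) : TState E K → Prop
  | .sink => False
  | .start => False
  | .skip => h₁ = h₂ ∧ 0 < h₁
  | .quiet => True
  | .fol e' => ∃ k i, i ≤ m k ∧ h₁ = p k + 1 + i ∧ e' = e k
  | .hold j => ∃ k i, i ≤ m k ∧ h₂ = p k + 1 + i ∧ IsBlock y h₁ (S.regs e m (k + 1) j)
  | .cmp δ => ∃ k i c, i ≤ m k ∧ h₂ = p k + 1 + i ∧ IsBlock y h₁ c ∧ c + δ.toNat + i = m k
  | .br _ _ => True
  | .bcmp _ => True
  | .pre i' => (i' ≤ n ∧ h₁ = p 0 + 1 + i') ∨ i' = n + 1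

theorem tInv_start (hy : IsSpelling y p e m) (he : S.IsExec n e m) {z : TState E K × ℕ × ℕ}
    (h : TStep S n K y y (.start, 0, 0) z) : TInv S n y p e m z.2.1 z.2.2 z.1 := by
  obtain ⟨q, h₁, h₂⟩ := z
  obtain ⟨u, v, ht, hu, hv, e1, e2⟩ := h
  have y0 : y 0 = some S.init := by have := hy.letter 0; rwa [hy.zero, he.init] at this
  have hb := hy.isBlock 0
  have hb0 := hy.isBlock_zero
  have hz := hy.zero
  have hi := he.init
  simp only at ht e1 e2 hu hv
  cases ht with
  | start_load j h =>
    refine ⟨0, 0, Nat.zero_le _, by simp [e2, hz], ?_⟩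
    rw [OpSystem.regs, hi, h, Function.update_self]
    simpa [e1, hz] using hb
  | start_hold j h =>
    refine ⟨0, 0, Nat.zero_le _, by simp [e2, hz], ?_⟩
    rw [OpSystem.regs, hi, Function.update_of_ne (Ne.symm h)]
    simpa [e1, OpSystem.regs] using hb0
  | start_fol => exact ⟨0, 0, Nat.zero_le _, by simp [e1, hz], hi.symm⟩
  | _ => simp_all [TInv, Reads]

theorem tInv_step (hy : IsSpelling y p e m) (he : S.IsExec n e m) {z z' : TState E K × ℕ × ℕ}
    (h : TStep S n K y y z z') (hz : TInv S n y p e m z.2.1 z.2.2 z.1) :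
    TInv S n y p e m z'.2.1 z'.2.2 z'.1 := by
  obtain ⟨q, h₁, h₂⟩ := z
  obtain ⟨q', h₁', h₂'⟩ := z'
  obtain ⟨u, v, ht, hu, hv, e1, e2⟩ := h
  simp only at ht e1 e2 hu hv hz ⊢
  have hin := he.input
  cases ht with
  | skip => simp_all [TInv]
  | skip_copy h =>
    obtain ⟨rfl, -⟩ := hz
    exact h (hu.1.symm.trans hv.1)
  | skip_fol e' =>
    obtain ⟨k, rfl, hk⟩ := hy.exists_of_some hu.1
    exact ⟨k, 0, Nat.zero_le _, by simp [e1], hk⟩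
  | skip_load e' j h =>
    obtain ⟨rfl, -⟩ := hz
    obtain ⟨k, rfl, rfl⟩ := hy.exists_of_some hu.1
    refine ⟨k, 0, Nat.zero_le _, by simp [e2], ?_⟩
    rw [OpSystem.regs, h, Function.update_self]
    simpa [e1] using hy.isBlock k
  | fol_tick e' =>
    obtain ⟨k, i, hi, rfl, h⟩ := hz
    exact ⟨k, i + 1, hy.lt_of_none hi hu.1, by simp [e1]; omega, h⟩
  | fol_sink h =>
    obtain ⟨k, i, hi, rfl, rfl⟩ := hz
    obtain ⟨-, rfl, -⟩ := hy.eq_of_some hi hu.1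
    exact h (he.follow k)
  | hold_tick j =>
    obtain ⟨k, i, hi, rfl, h⟩ := hz
    exact ⟨k, i + 1, hy.lt_of_none hi hv.1, by simp [e2]; omega, by simpa [e1] using h⟩
  | hold_op j h =>
    obtain ⟨k, i, hi, rfl, hb⟩ := hz
    obtain ⟨-, rfl, h3⟩ := hy.eq_of_some hi hv.1
    refine ⟨k + 1, 0, Nat.zero_le _, by rw [e2, h3]; simp, ?_⟩
    rw [OpSystem.regs, Function.update_of_ne (Ne.symm h)]
    simpa [e1] using hb
  | hold_cmp j h =>
    obtain ⟨k, i, hi, rfl, hb⟩ := hz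
    obtain ⟨-, rfl, h3⟩ := hy.eq_of_some hi hv.1
    refine ⟨k + 1, 0, _, Nat.zero_le _, by rw [e2, h3]; simp, by simpa [e1] using hb, ?_⟩
    exact (he.ok (k + 1) _ h).symm
  | cmp_succ =>
    obtain ⟨k, i, c, hi, rfl, hb, hc⟩ := hz
    refine ⟨k, i + 1, c, hy.lt_of_none hi hv.1, by simp [e2]; omega, by simpa [e1] using hb, ?_⟩
    simp at hc ⊢
    omega
  | cmp_succ_sink e' =>
    obtain ⟨k, i, c, hi, rfl, hb, hc⟩ := hz
    obtain ⟨rfl, -, -⟩ := hy.eq_of_some hi hv.1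
    simp at hc
  | cmp_tick =>
    obtain ⟨k, i, c, hi, rfl, hb, hc⟩ := hz
    obtain ⟨c, rfl, hb'⟩ := hb.of_none hu.1
    refine ⟨k, i + 1, c, hy.lt_of_none hi hv.1, by simp [e2]; omega, by simpa [e1] using hb', ?_⟩
    simp at hc ⊢
    omega
  | cmp_tick_sink e' =>
    obtain ⟨k, i, c, hi, rfl, hb, hc⟩ := hz
    have := hb.of_some hu.1
    have := hy.lt_of_none hi hv.1
    simp at hc
    omega
  | cmp_op_sink e' =>
    obtain ⟨k, i, c, hi, rfl, hb, hc⟩ := hz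
    obtain ⟨c, rfl, -⟩ := hb.of_none hu.1
    obtain ⟨rfl, -, -⟩ := hy.eq_of_some hi hv.1
    simp at hc
  | @pre_next i a h ha =>
    by_cases hlt : i < n
    · rcases hz with ⟨-, rfl⟩ | hz
      · exact .inl ⟨hlt, by simp [e1]; omega⟩
      · omega
    · exact .inr (by omega)
  | @pre_sink i a h ha =>
    rcases hz with ⟨-, rfl⟩ | hz
    · by_cases hlt : i < n
      · exact ha (iff_of_true hlt (hu.1.symm.trans (hy.tick 0 i (by omega))))
      · refine ha (iff_of_false hlt ?_)
        rintro rfl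
        have := hy.lt_of_none (k := 0) (by omega) hu.1
        omega
    · omega
  | _ => trivial

theorem TTrans.isBranch_iff {q q' : TState E K} {u v} (h : TTrans S n K q u v q')
    (hq : q ≠ .start) : q'.IsBranch ↔ q.IsBranch := by
  cases h <;> simp_all [TState.IsBranch]

/-- In a branch state, the automaton has the number `v` in memory. -/
def TBranchInv (S : OpSystem E) (y : ℕ → Option E) (p : ℕ → ℕ) (e : ℕ → E) (m : ℕ → ℕ)
    (v h₁ h₂ : ℕ) : TState E K → Prop
  | .br true _ => IsBlock y h₁ v
  | .br false _ => IsBlock y h₂ v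
  | .bcmp true => ∃ k i c, e k = S.par ∧ i ≤ m k ∧ h₂ = p k + 1 + i ∧ IsBlock y h₁ c ∧ c + i = v
  | .bcmp false => ∃ k i c, e k = S.par ∧ i ≤ m k ∧ h₁ = p k + 1 + i ∧ IsBlock y h₂ c ∧ c + i = v
  | _ => False

theorem tBranchInv_step (hy : IsSpelling y p e m) {z z' : TState E K × ℕ × ℕ}
    (h : TStep S n K y y z z') {v : ℕ} (hz : TBranchInv S y p e m v z.2.1 z.2.2 z.1) :
    ∃ w, TBranchInv S y p e m w z'.2.1 z'.2.2 z'.1 ∧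
      (v = w ∧ ¬ z'.1.IsAccepting ∨ S.Linked e m v w) := by
  obtain ⟨q, h₁, h₂⟩ := z
  obtain ⟨q', h₁', h₂'⟩ := z'
  obtain ⟨a, b, ht, hu, hv, e1, e2⟩ := h
  simp only at ht e1 e2 hu hv hz ⊢
  cases ht with
  | br_move₁ => exact ⟨v, by simpa [TBranchInv, e1] using hz, .inl ⟨rfl, by rintro ⟨⟩⟩⟩
  | br_move₂ => exact ⟨v, by simpa [TBranchInv, e2] using hz, .inl ⟨rfl, by rintro ⟨⟩⟩⟩
  | br_par₁ =>
    obtain ⟨k, rfl, hk⟩ := hy.exists_of_some hv.1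
    exact ⟨v, ⟨k, 0, v, hk.symm, Nat.zero_le _, by simp [e2], by simpa [TBranchInv, e1] using hz,
      rfl⟩, .inl ⟨rfl, by rintro ⟨⟩⟩⟩
  | br_par₂ =>
    obtain ⟨k, rfl, hk⟩ := hy.exists_of_some hu.1
    exact ⟨v, ⟨k, 0, v, hk.symm, Nat.zero_le _, by simp [e1], by simpa [TBranchInv, e2] using hz,
      rfl⟩, .inl ⟨rfl, by rintro ⟨⟩⟩⟩
  | bcmp_tick mem =>
    refine ⟨v, ?_, .inl ⟨rfl, by rintro ⟨⟩⟩⟩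
    cases mem with
    | true =>
      obtain ⟨k, i, c, hk, hi, rfl, hb, hc⟩ := hz
      obtain ⟨c, rfl, hb'⟩ := hb.of_none hu.1
      exact ⟨k, i + 1, c, hk, hy.lt_of_none hi hv.1, by simp [e2]; omega, by simpa [e1] using hb',
        by omega⟩
    | false =>
      obtain ⟨k, i, c, hk, hi, rfl, hb, hc⟩ := hz
      obtain ⟨c, rfl, hb'⟩ := hb.of_none hv.1
      exact ⟨k, i + 1, c, hk, hy.lt_of_none hi hu.1, by simp [e1]; omega, by simpa [e2] using hb',
        by omega⟩
  | bcmp_chi₁ e' =>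
    obtain ⟨k, i, c, hk, hi, rfl, hb, hc⟩ := hz
    obtain ⟨rfl, h2, h3⟩ := hy.eq_of_some hi hv.1
    have := hb.of_some hu.1
    refine ⟨m (k + 1), ?_, .inr ⟨k, hk, h2.symm, by omega, rfl⟩⟩
    have hb' := hy.isBlock (k + 1)
    simpa [TBranchInv, e2, h3] using hb'
  | bcmp_chi₂ e' =>
    obtain ⟨k, i, c, hk, hi, rfl, hb, hc⟩ := hz
    obtain ⟨rfl, h2, h3⟩ := hy.eq_of_some hi hu.1
    have := hb.of_some hv.1
    refine ⟨m (k + 1), ?_, .inr ⟨k, hk, h2.symm, by omega, rfl⟩⟩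
    have hb' := hy.isBlock (k + 1)
    simpa [TBranchInv, e1, h3] using hb'
  | _ => exact hz.elim

theorem hasChain_of_tAccepts (hy : IsSpelling y p e m) (he : S.IsExec n e m)
    (h : TAccepts S n K y y) : S.HasChain e m := by
  obtain ⟨z, hr⟩ := h
  have inv : ∀ t, TInv S n y p e m (z (t + 1)).2.1 (z (t + 1)).2.2 (z (t + 1)).1 := by
    intro t
    induction t with
    | zero => exact tInv_start hy he (hr.zero ▸ hr.step 0)
    | succ t ih => exact tInv_step hy he (hr.step (t + 1)) ih
  have hne : ∀ t, (z (t + 1)).1 ≠ .start ∧ (z (t + 1)).1 ≠ .sink := by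
    intro t
    have h := inv t
    constructor <;> intro hq <;> rw [hq] at h <;> exact h
  have hbr : ∀ t, (z (t + 1)).1.IsBranch ↔ (z 1).1.IsBranch := by
    intro t
    induction t with
    | zero => rfl
    | succ t ih =>
      obtain ⟨u, v, ht, -⟩ := hr.step (t + 1)
      exact (ht.isBranch_iff (hne t).1).trans ih
  by_cases h1 : (z 1).1.IsBranch
  · have start : TBranchInv S y p e m 0 (z 1).2.1 (z 1).2.2 (z 1).1 := by
      have h := hr.step 0
      rw [hr.zero] at h
      change TStep S n K y y _ (z 1) at h
      generalize z 1 = z' at h h1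
      obtain ⟨q', h₁', h₂'⟩ := z'
      obtain ⟨u, v, ht, hu, hv, e1, e2⟩ := h
      simp only at ht e1 e2 h1 ⊢
      cases ht with
      | start_br => simpa [TBranchInv, e1] using hy.isBlock_zero
      | _ => exact h1.elim
    let P : ℕ × ℕ → Prop := fun a =>
      TBranchInv S y p e m a.2 (z a.1).2.1 (z a.1).2.2 (z a.1).1
    have climb : ∀ d (a : ℕ × ℕ), P a → (z (a.1 + 1 + d)).1.IsAccepting →
        ∃ b, P b ∧ S.Linked e m a.2 b.2 := by
      intro d
      induction d with
      | zero =>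
        rintro ⟨t, v⟩ hinv hacc
        obtain ⟨w, hinv', hl⟩ := tBranchInv_step hy (hr.step t) hinv
        rcases hl with ⟨-, hl⟩ | hl
        · exact absurd hacc hl
        · exact ⟨⟨_, w⟩, hinv', hl⟩
      | succ d ih =>
        rintro ⟨t, v⟩ hinv hacc
        obtain ⟨w, hinv', hl⟩ := tBranchInv_step hy (hr.step t) hinv
        rcases hl with ⟨rfl, hl⟩ | hl
        · exact ih ⟨t + 1, v⟩ hinv' (by
            rwa [show t + 1 + 1 + d = t + 1 + (d + 1) by omega])
        · exact ⟨⟨_, w⟩, hinv', hl⟩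
    obtain ⟨f, hf0, hf⟩ := exists_seq_of_step (P := P) (a := (1, 0))
      (R := fun a b => S.Linked e m a.2 b.2) start (by
      intro a ha
      obtain ⟨T, hT, hacc⟩ := frequently_atTop.1 hr.accepting (a.1 + 1)
      exact climb (T - (a.1 + 1)) a ha (by rwa [Nat.add_sub_cancel' hT]))
    exact ⟨fun i => (f i).2, by simp only [hf0], hf⟩
  · exfalso
    obtain ⟨T, hT, hacc⟩ := frequently_atTop.1 hr.accepting 1
    obtain ⟨t, rfl⟩ := Nat.exists_eq_add_of_le' hT
    have hquiet : (z (t + 1)).1 = .quiet := by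
      have h2 := (hne t).2
      have h3 := (hbr t).not.2 h1
      generalize (z (t + 1)).1 = q' at hacc h2 h3
      cases hacc with
      | sink => exact absurd rfl h2
      | quiet => rfl
      | br => exact absurd trivial h3
    -- In `quiet` the first head reads every letter, so it would meet a later `par`.
    have hstep : ∀ t, (z t).1 = .quiet → (z (t + 1)).1 = .quiet ∧ y (z t).2.1 ≠ some S.par ∧
        (z (t + 1)).2.1 = (z t).2.1 + 1 := by
      intro t ht
      obtain ⟨u, v, h, hu, -, e1, -⟩ := hr.step t
      rw [ht] at h
      generalize (z (t + 1)).1 = q' at h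
      cases h with
      | quiet h => exact ⟨rfl, hu.1 ▸ h, e1⟩
    have hstay : ∀ d, (z (t + 1 + d)).1 = .quiet ∧ (z (t + 1 + d)).2.1 = (z (t + 1)).2.1 + d := by
      intro d
      induction d with
      | zero => exact ⟨hquiet, rfl⟩
      | succ d ih =>
        obtain ⟨a, -, b⟩ := hstep _ ih.1
        exact ⟨a, b.trans (by rw [ih.2, add_assoc])⟩
    obtain ⟨t', ht', hp⟩ := hy.exists_par_ge he.par (z (t + 1)).2.1
    obtain ⟨d, rfl⟩ := Nat.exists_eq_add_of_le ht'
    refine (hstep _ (hstay d).1).2.1 ?_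
    rw [(hstay d).2, hp]

end TwoTape

/-! #### Violations and ordered chains are accepted by the 2-tape automaton -/

section TwoTapeComplete

variable {E : Type} {S : OpSystem E} {n K : ℕ} {y₁ y₂ y : ℕ → Option E} {p : ℕ → ℕ} {e : ℕ → E}
  {m : ℕ → ℕ}

/-- Steps may leave a head where it is, so the milestones must also show that both heads run through
their whole tapes. -/
theorem tAccepts_of_transGen {z : ℕ → TState E K × ℕ × ℕ} (h0 : z 0 = (.start, 0, 0))
    (h : ∀ i, Relation.TransGen (TStep S n K y₁ y₂) (z i) (z (i + 1)))
    (hacc : ∀ i, (z (i + 1)).1.IsAccepting) (h₁ : ∀ i, i ≤ (z (i + 1)).2.1)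
    (h₂ : ∀ i, i ≤ (z (i + 1)).2.2) : TAccepts S n K y₁ y₂ := by
  obtain ⟨p, w, hp, hp0, hwz, hw⟩ := exists_infinite_path h
  refine ⟨w, by rw [← h0, ← hwz, hp0], hw, ?_, fun N => ⟨p (N + 1), ?_⟩, fun N => ⟨p (N + 1), ?_⟩⟩
  · refine frequently_atTop.2 fun N => ⟨p (N + 1), (Nat.le_succ N).trans (hp.id_le (N + 1)), ?_⟩
    rw [hwz]
    exact hacc N
  · rw [hwz]
    exact h₁ N
  · rw [hwz]
    exact h₂ N

theorem TTrans.step {q q' : TState E K} {a b : Option E} (h : TTrans S n K q [a] [b] q')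
    {h₁ h₂ : ℕ} (ha : y₁ h₁ = a) (hb : y₂ h₂ = b) :
    TStep S n K y₁ y₂ (q, h₁, h₂) (q', h₁ + 1, h₂ + 1) :=
  ⟨_, _, h, ⟨ha, trivial⟩, ⟨hb, trivial⟩, rfl, rfl⟩

theorem TTrans.step_fst {q q' : TState E K} {a : Option E} (h : TTrans S n K q [a] [] q')
    {h₁ h₂ : ℕ} (ha : y₁ h₁ = a) : TStep S n K y₁ y₂ (q, h₁, h₂) (q', h₁ + 1, h₂) :=
  ⟨_, _, h, ⟨ha, trivial⟩, trivial, rfl, rfl⟩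

theorem TTrans.step_snd {q q' : TState E K} {b : Option E} (h : TTrans S n K q [] [b] q')
    {h₁ h₂ : ℕ} (hb : y₂ h₂ = b) : TStep S n K y₁ y₂ (q, h₁, h₂) (q', h₁, h₂ + 1) :=
  ⟨_, _, h, trivial, ⟨hb, trivial⟩, rfl, rfl⟩

/-- The configuration is reached from the initial one. -/
def TReach (S : OpSystem E) (n K : ℕ) (y₁ y₂ : ℕ → Option E) (q : TState E K) (h₁ h₂ : ℕ) : Prop :=
  Relation.TransGen (TStep S n K y₁ y₂) (.start, 0, 0) (q, h₁, h₂)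

theorem TReach.accepts_of_sink {h₁ h₂ : ℕ} (h : TReach S n K y₁ y₂ .sink h₁ h₂) :
    TAccepts S n K y₁ y₂ := by
  refine tAccepts_of_transGen
    (z := fun i => Nat.casesOn i (.start, 0, 0) fun i => (.sink, h₁ + i, h₂ + i)) rfl ?_
    (fun i => .sink) (fun i => Nat.le_add_left _ _) fun i => Nat.le_add_left _ _
  rintro (_ | i)
  · exact h
  · exact .single ((TTrans.sink _ _).step rfl rfl)

theorem tAccepts_of_start (h0 : y₁ 0 ≠ some S.init) : TAccepts S n K y₁ y₂ :=
  TReach.accepts_of_sink (.single ((TTrans.start_sink h0 _).step rfl rfl))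

theorem tReach_skip (h0 : y₁ 0 = some S.init) {t : ℕ} (h : ∀ i < t + 1, y₁ i = y₂ i) :
    TReach S n K y₁ y₂ .skip (t + 1) (t + 1) := by
  induction t with
  | zero => exact .single (TTrans.start_skip.step h0 ((h 0 (by omega)).symm.trans h0))
  | succ t ih =>
    exact (ih fun i hi => h i (by omega)).tail
      ((TTrans.skip _).step rfl (h (t + 1) (by omega)).symm)

/-- The copies are read in parallel up to their first difference. -/
theorem tAccepts_of_ne (h0 : y₁ 0 = some S.init) (h : y₁ ≠ y₂) : TAccepts S n K y₁ y₂ := by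
  classical
  have ex : ∃ t, y₁ t ≠ y₂ t := Function.ne_iff.1 h
  have h1 := Nat.find_spec ex
  have h2 : ∀ i < Nat.find ex, y₁ i = y₂ i := fun i hi => not_not.1 (Nat.find_min ex hi)
  generalize Nat.find ex = t at h1 h2
  obtain _ | t := t
  · rw [h0] at h1
    exact TReach.accepts_of_sink (.single ((TTrans.start_copy h1.symm).step h0 rfl))
  · exact TReach.accepts_of_sink ((tReach_skip h0 h2).tail ((TTrans.skip_copy h1).step rfl rfl))

theorem tAccepts_of_quiet (h0 : y 0 = some S.init) (h : ¬ ∃ᶠ t in atTop, y t = some S.par) :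
    TAccepts S n K y y := by
  rw [not_frequently, eventually_atTop] at h
  obtain ⟨N, hN⟩ := h
  refine tAccepts_of_transGen (z := fun i => Nat.casesOn i (.start, 0, 0)
    fun i => (.quiet, N + 1 + 1 + i, N + 1 + 1 + i)) rfl ?_
    (fun i => .quiet) (fun i => Nat.le_add_left _ _) fun i => Nat.le_add_left _ _
  rintro (_ | i)
  · exact (tReach_skip h0 fun _ _ => rfl).tail ((TTrans.skip_quiet _ _).step rfl rfl)
  · exact .single ((TTrans.quiet (hN _ (by omega)) _).step rfl rfl)

theorem tReach_fol (hy : IsSpelling y p e m) (hinit : e 0 = S.init) (k : ℕ) :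
    TReach S n K y y (.fol (e k)) (p k + 1) (p k + 1) := by
  have h0 : y 0 = some S.init := by have := hy.letter 0; rwa [hy.zero, hinit] at this
  obtain _ | k := k
  · rw [hy.zero, hinit]
    exact .single ((TTrans.start_fol _).step h0 rfl)
  · have h := tReach_skip (n := n) (K := K) h0 (t := p k + m k) fun _ _ => rfl
    rw [← hy.succ] at h
    exact h.tail ((TTrans.skip_fol _ _).step (hy.letter _) rfl)

theorem tAccepts_of_not_follow (hy : IsSpelling y p e m) (hinit : e 0 = S.init) {k : ℕ}
    (h : ¬ S.Follow (e k) (e (k + 1))) : TAccepts S n K y y := by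
  have hr : ∀ i ≤ m k, TReach S n K y y (.fol (e k)) (p k + 1 + i) (p k + 1 + i) := by
    intro i
    induction i with
    | zero => intro _; exact tReach_fol hy hinit k
    | succ i ih =>
      intro hi
      exact (ih (by omega)).tail ((TTrans.fol_tick _ _).step (hy.tick k i hi) rfl)
  have h1 := hr _ le_rfl
  rw [add_right_comm, ← hy.succ] at h1
  exact TReach.accepts_of_sink (h1.tail ((TTrans.fol_sink h _).step (hy.letter _) rfl))

theorem tAccepts_of_input (hy : IsSpelling y p e m) (hinit : e 0 = S.init) (h : m 0 ≠ n) :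
    TAccepts S n K y y := by
  have h0 : y 0 = some S.init := by have := hy.letter 0; rwa [hy.zero, hinit] at this
  have hp : ∀ i, i ≤ m 0 → i ≤ n → TReach S n K y y (.pre i) (1 + i) 1 := by
    intro i
    induction i with
    | zero => intro _ _; exact .single ((TTrans.start_pre _).step h0 rfl)
    | succ i ih =>
      intro h1 h2
      have hyi := hy.tick 0 i h1
      rw [hy.zero, zero_add] at hyi
      exact (ih (by omega) (by omega)).tail
        ((TTrans.pre_next (by omega) (iff_of_true (by omega) rfl)).step_fst hyi)
  rcases lt_or_gt_of_ne h with h | h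
  · have hyi := hy.letter 1
    have hs := hy.succ 0
    rw [show p 1 = 1 + m 0 by rw [hs, hy.zero]; omega] at hyi
    exact TReach.accepts_of_sink ((hp _ le_rfl h.le).tail
      ((TTrans.pre_sink h.le (by simp [h])).step_fst hyi))
  · have hyi := hy.tick 0 n h
    rw [hy.zero, zero_add] at hyi
    exact TReach.accepts_of_sink ((hp n h.le le_rfl).tail
      ((TTrans.pre_sink le_rfl (by simp)).step_fst hyi))

theorem tReach_hold (hy : IsSpelling y p e m) (hinit : e 0 = S.init) (j : Fin K) (k : ℕ) :
    ∃ h₁, TReach S n K y y (.hold j) h₁ (p (k + 1)) ∧ IsBlock y h₁ (S.regs e m (k + 1) j) := by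
  have h0 : y 0 = some S.init := by have := hy.letter 0; rwa [hy.zero, hinit] at this
  have ticks : ∀ k h₁, TReach S n K y y (.hold j) h₁ (p k + 1) →
      TReach S n K y y (.hold j) h₁ (p (k + 1)) := by
    intro k h₁ h
    have hr : ∀ i ≤ m k, TReach S n K y y (.hold j) h₁ (p k + 1 + i) := by
      intro i
      induction i with
      | zero => intro _; exact h
      | succ i ih =>
        intro hi
        exact (ih (by omega)).tail ((TTrans.hold_tick j).step_snd (hy.tick k i hi))
    have h1 := hr _ le_rfl
    rwa [add_right_comm, ← hy.succ] at h1
  have load : ∀ k, (S.op (e k)).1 = j → IsBlock y (p k + 1) (S.regs e m (k + 1) j) := by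
    intro k hk
    rw [OpSystem.regs, ← hk, Function.update_self]
    exact hy.isBlock k
  have keep : ∀ k, (S.op (e k)).1 ≠ j → S.regs e m (k + 1) j = S.regs e m k j := by
    intro k hk
    rw [OpSystem.regs, Function.update_of_ne (Ne.symm hk)]
  induction k with
  | zero =>
    by_cases hk : (S.op (e 0)).1 = j
    · refine ⟨p 0 + 1, ticks 0 _ ?_, load 0 hk⟩
      rw [hy.zero]
      exact .single ((TTrans.start_load j (hinit ▸ hk)).step h0 h0)
    · refine ⟨0, ticks 0 _ ?_, ?_⟩
      · rw [hy.zero]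
        exact .single ((TTrans.start_hold j (hinit ▸ hk)).step_snd h0)
      · rw [keep 0 hk]
        exact hy.isBlock_zero
  | succ k ih =>
    by_cases hk : (S.op (e (k + 1))).1 = j
    · have h := tReach_skip (n := n) (K := K) h0 (t := p k + m k) fun _ _ => rfl
      rw [← hy.succ] at h
      exact ⟨_, ticks _ _ (h.tail ((TTrans.skip_load _ j hk).step (hy.letter _) (hy.letter _))),
        load _ hk⟩
    · obtain ⟨h₁, h, hb⟩ := ih
      refine ⟨h₁, ticks _ _ (h.tail ((TTrans.hold_op j hk).step_snd (hy.letter _))), ?_⟩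
      rwa [keep _ hk]

theorem TReach.accepts_of_cmp {d : ℕ} : ∀ {h₁ h₂ c : ℕ} {δ : Bool},
    TReach S n K y y (.cmp δ) h₁ h₂ → IsBlock y h₁ c → IsBlock y h₂ d →
    d ≠ c + δ.toNat → TAccepts S n K y y := by
  induction d with
  | zero =>
    rintro h₁ h₂ c δ h h1 ⟨-, e', he⟩ hd
    cases δ with
    | false =>
      have : y h₁ = none := h1.1 0 (Nat.pos_of_ne_zero fun hc => hd (by simp [hc]))
      exact accepts_of_sink (h.tail ((TTrans.cmp_op_sink _).step this he))
    | true => exact accepts_of_sink (h.tail ((TTrans.cmp_succ_sink _).step_snd he))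
  | succ d ih =>
    intro h₁ h₂ c δ h h1 h2 hd
    have h0 : y h₂ = none := h2.1 0 (by omega)
    obtain ⟨d', hd', h2'⟩ := h2.of_none h0
    obtain rfl : d = d' := by omega
    cases δ with
    | true => exact ih (h.tail (TTrans.cmp_succ.step_snd h0)) h1 h2' (by simp at hd ⊢; omega)
    | false =>
      obtain _ | c := c
      · obtain ⟨-, e', he⟩ := h1
        exact accepts_of_sink (h.tail ((TTrans.cmp_tick_sink _).step he h0))
      · have h3 : y h₁ = none := h1.1 0 (by omega)
        obtain ⟨c', hc', h1'⟩ := h1.of_none h3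
        exact ih (h.tail (TTrans.cmp_tick.step h3 h0)) h1' h2' (by simp at hd ⊢; omega)

theorem tAccepts_of_not_ok (hK : ∀ e, ∀ x ∈ (S.op e).2, x.1 < K) (hy : IsSpelling y p e m)
    (hinit : e 0 = S.init) {k : ℕ} (h : ¬ (S.op (e k)).Ok (S.regs e m k) (m k)) :
    TAccepts S n K y y := by
  simp only [Op.Ok, not_forall] at h
  obtain ⟨⟨j, δ⟩, hmem, hne⟩ := h
  obtain _ | k := k
  · rw [hinit, S.op_init] at hmem
    cases hmem
  obtain ⟨h₁, hr, hb⟩ := tReach_hold (n := n) hy hinit ⟨j, hK _ _ hmem⟩ k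
  exact TReach.accepts_of_cmp (hr.tail ((TTrans.hold_cmp _ hmem).step_snd (hy.letter _))) hb
    (hy.isBlock _) hne

/-- The configuration in which the first head is at `a` and the second one at `b` if `mem = true`,
and the other way round if `mem = false`. -/
def TConf (mem : Bool) (q : TState E K) (a b : ℕ) : TState E K × ℕ × ℕ :=
  if mem then (q, a, b) else (q, b, a)

theorem tStep_br {mem acc : Bool} {a b : ℕ} :
    TStep S n K y y (TConf mem (.br mem acc) a b) (TConf mem (.br mem false) a (b + 1)) := by
  cases mem
  · exact (TTrans.br_move₂ _ _).step_fst rfl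
  · exact (TTrans.br_move₁ _ _).step_snd rfl

theorem tStep_par {mem acc : Bool} {a b : ℕ} (h : y b = some S.par) :
    TStep S n K y y (TConf mem (.br mem acc) a b) (TConf mem (.bcmp mem) a (b + 1)) := by
  cases mem
  · exact (TTrans.br_par₂ _).step_fst h
  · exact (TTrans.br_par₁ _).step_snd h

theorem tStep_bcmp {mem : Bool} {a b : ℕ} (ha : y a = none) (hb : y b = none) :
    TStep S n K y y (TConf mem (.bcmp mem) a b) (TConf mem (.bcmp mem) (a + 1) (b + 1)) := by
  cases mem
  · exact (TTrans.bcmp_tick _).step hb ha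
  · exact (TTrans.bcmp_tick _).step ha hb

theorem tStep_chi {mem : Bool} {a b : ℕ} {e' : E} (ha : y a = some e') (hb : y b = some S.chi) :
    TStep S n K y y (TConf mem (.bcmp mem) a b) (TConf (!mem) (.br (!mem) true) (b + 1) (a + 1)) := by
  cases mem
  · exact (TTrans.bcmp_chi₂ _).step hb ha
  · exact (TTrans.bcmp_chi₁ _).step ha hb

theorem tStep_br_moves {mem acc : Bool} {a b : ℕ} (d : ℕ) :
    ∃ acc', Relation.ReflTransGen (TStep S n K y y) (TConf mem (.br mem acc) a b)
      (TConf mem (.br mem acc') a (b + d)) := by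
  induction d with
  | zero => exact ⟨acc, .refl⟩
  | succ d ih =>
    obtain ⟨acc', h⟩ := ih
    exact ⟨false, h.tail tStep_br⟩

theorem tStep_bcmp_ticks {mem : Bool} {a b : ℕ} (d : ℕ) (ha : ∀ i < d, y (a + i) = none)
    (hb : ∀ i < d, y (b + i) = none) :
    Relation.ReflTransGen (TStep S n K y y) (TConf mem (.bcmp mem) a b)
      (TConf mem (.bcmp mem) (a + d) (b + d)) := by
  induction d with
  | zero => exact .refl
  | succ d ih =>
    exact (ih (fun i hi => ha i (by omega)) fun i hi => hb i (by omega)).tail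
      (tStep_bcmp (ha d (by omega)) (hb d (by omega)))

/-- After the match the former memory head has read its block and the letter behind it; hence its
new position `a + m k + 1`. -/
theorem tStep_match (hy : IsSpelling y p e m) {k a b : ℕ} {mem acc : Bool} (h1 : e k = S.par)
    (h2 : e (k + 1) = S.chi) (ha : IsBlock y a (m k)) (hb : b ≤ p k) :
    Relation.TransGen (TStep S n K y y) (TConf mem (.br mem acc) a b)
      (TConf (!mem) (.br (!mem) true) (p (k + 1) + 1) (a + m k + 1)) := by
  obtain ⟨d, hd⟩ := Nat.exists_eq_add_of_le hb
  obtain ⟨acc', hm⟩ := tStep_br_moves (S := S) (n := n) (K := K) (y := y) (mem := mem)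
    (acc := acc) (a := a) (b := b) d
  rw [← hd] at hm
  obtain ⟨ha, e', he'⟩ := ha
  have hc := tStep_bcmp_ticks (S := S) (n := n) (K := K) (mem := mem) (m k) ha (hy.tick k)
  rw [add_right_comm (p k), ← hy.succ] at hc
  exact .trans_right hm (.head' (tStep_par (h1 ▸ hy.letter k))
    (hc.tail (tStep_chi he' (h2 ▸ hy.letter (k + 1)))))

/-- The heads alternate as memory, whence the parity `bodd`. The searching head restarts behind the
number just matched, which still lies before the next `par` of the chain. -/
theorem tAccepts_of_hasOrderedChain (hy : IsSpelling y p e m) (hinit : e 0 = S.init)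
    (h : S.HasOrderedChain e m) : TAccepts S n K y y := by
  obtain ⟨k, hk, hpc, hm0, hm⟩ := h
  have h0 : y 0 = some S.init := by have := hy.letter 0; rwa [hy.zero, hinit] at this
  -- The position of the searching head after match `i`. The first match compares with the empty
  -- block at `0`; later ones end just behind the letter that follows the block of the previous
  -- `chi`.
  let b : ℕ → ℕ := fun i => Nat.casesOn i 1 fun i => p (k i + 1 + 1) + 1
  have hb1 : ∀ i, i ≤ b i := by
    rintro (_ | i)
    · exact Nat.zero_le _
    · have h1 := hk.id_le i
      have h2 := hy.strictMono.id_le (k i + 1 + 1)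
      simp only [b, id] at h1 h2 ⊢
      omega
  have hb2 : ∀ i, b i ≤ p (k (i + 1)) := by
    rintro (_ | i)
    · have h1 : k 0 < k 1 := hk Nat.zero_lt_one
      have h2 : k 1 ≤ p (k 1) := hy.strictMono.id_le (k 1)
      change 1 ≤ p (k 1)
      omega
    · have h1 := OpSystem.lt_of_par_chi (hpc i).2 (hpc (i + 1)).1 (hk (Nat.lt_succ_self i))
      exact hy.strictMono (lt_of_le_of_lt h1 (hk (Nat.lt_succ_self (i + 1))))
  have hp : ∀ i, i ≤ p (k i + 1) + 1 := by
    intro i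
    have h1 := hk.id_le i
    have h2 := hy.strictMono.id_le (k i + 1)
    simp only [id] at h1 h2
    omega
  have hconf : ∀ i, i ≤ (TConf (K := K) (E := E) i.bodd (.br i.bodd true) (p (k i + 1) + 1) (b i)).2.1 ∧
      i ≤ (TConf (K := K) (E := E) i.bodd (.br i.bodd true) (p (k i + 1) + 1) (b i)).2.2 := by
    intro i
    cases i.bodd
    · exact ⟨hb1 i, hp i⟩
    · exact ⟨hp i, hb1 i⟩
  refine tAccepts_of_transGen (z := fun i => Nat.casesOn i (.start, 0, 0)
    fun i => TConf i.bodd (.br i.bodd true) (p (k i + 1) + 1) (b i)) rfl ?_ (fun i => ?_)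
    (fun i => (hconf i).1) fun i => (hconf i).2
  · rintro (_ | i)
    · have hk0 : k 0 ≠ 0 := by
        intro h
        have := (hpc 0).1
        rw [h, hinit] at this
        exact S.par_ne_init this.symm
      have h2 := hy.strictMono.id_le (k 0)
      have := tStep_match (n := n) (K := K) (mem := true) (acc := false) (a := 0) (b := 1) hy
        (hpc 0).1 (hpc 0).2 (by rw [hm0]; exact hy.isBlock_zero) (by simp only [id] at h2; omega)
      rw [hm0] at this
      exact .head (TTrans.start_br.step_snd h0) this
    · have := tStep_match (n := n) (K := K) (mem := i.bodd) (acc := true) hy (hpc (i + 1)).1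
        (hpc (i + 1)).2 (hm i ▸ hy.isBlock (k i + 1)) (hb2 i)
      rw [← hm, add_right_comm (p _) 1, ← hy.succ] at this
      simpa only [Nat.bodd_succ] using this
  · change (TConf (E := E) (K := K) i.bodd (.br i.bodd true) (p (k i + 1) + 1) (b i)).1.IsAccepting
    cases i.bodd <;> exact .br _

theorem tAccepts_of_forall (hK : ∀ e, ∀ x ∈ (S.op e).2, x.1 < K)
    (h : ∀ e m, S.IsExec n e m → S.HasOrderedChain e m) (y₁ y₂ : ℕ → Option E) :
    TAccepts S n K y₁ y₂ := by
  by_cases h0 : y₁ 0 = some S.init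
  swap
  · exact tAccepts_of_start h0
  by_cases hne : y₁ = y₂
  swap
  · exact tAccepts_of_ne h0 hne
  subst hne
  by_cases hpar : ∃ᶠ t in atTop, y₁ t = some S.par
  swap
  · exact tAccepts_of_quiet h0 hpar
  obtain ⟨p, e, m, hy⟩ := exists_isSpelling_of_word (y := y₁) (by rw [h0]; simp)
    (hpar.mono fun t ht => by rw [ht]; simp)
  have hinit : e 0 = S.init := by
    have := hy.letter 0
    rw [hy.zero, h0] at this
    exact (Option.some.inj this).symm
  by_contra hacc
  have hexec : S.IsExec n e m := by
    refine ⟨hinit, ?_, fun k => ?_, fun k => ?_, hy.frequently_par hpar⟩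
    · by_contra hn
      exact hacc (tAccepts_of_input hy hinit hn)
    · by_contra hn
      exact hacc (tAccepts_of_not_follow hy hinit hn)
    · by_contra hn
      exact hacc (tAccepts_of_not_ok hK hy hinit hn)
  exact hacc (tAccepts_of_hasOrderedChain hy hinit (h e m hexec))

theorem exists_not_tAccepts (h : ∃ e m, S.IsExec n e m ∧ ¬ S.HasChain e m) :
    ∃ y : ℕ → Option E, ¬ TAccepts S n K y y := by
  obtain ⟨e, m, he, hc⟩ := h
  obtain ⟨y, p, hy⟩ := exists_isSpelling e m
  exact ⟨y, fun hacc => hc (hasChain_of_tAccepts hy he hacc)⟩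

end TwoTapeComplete

/-! ### The 2-tape automata of the games -/

theorem TState.pre_injective (E : Type) (K : ℕ) :
    Function.Injective (TState.pre : ℕ → TState E K) := fun _ _ h => by cases h; rfl

theorem TState.finite_notMem_range_pre (E : Type) [Finite E] (K : ℕ) :
    {q : TState E K | q ∉ Set.range TState.pre}.Finite := by
  refine (Set.finite_range (fun x : Fin 4 ⊕ E ⊕ Fin K ⊕ Bool ⊕ (Bool × Bool) ⊕ Bool =>
    match x with
    | .inl i => ![TState.sink, .start, .skip, .quiet] i
    | .inr (.inl e) => .fol e
    | .inr (.inr (.inl j)) => .hold j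
    | .inr (.inr (.inr (.inl b))) => .cmp b
    | .inr (.inr (.inr (.inr (.inl (b, b'))))) => .br b b'
    | .inr (.inr (.inr (.inr (.inr b)))) => .bcmp b)).subset ?_
  rintro (_ | _ | _ | _ | e | j | b | ⟨b, b'⟩ | b | i) hq
  · exact ⟨.inl 0, rfl⟩
  · exact ⟨.inl 1, rfl⟩
  · exact ⟨.inl 2, rfl⟩
  · exact ⟨.inl 3, rfl⟩
  · exact ⟨.inr (.inl e), rfl⟩
  · exact ⟨.inr (.inr (.inl j)), rfl⟩
  · exact ⟨.inr (.inr (.inr (.inl b))), rfl⟩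
  · exact ⟨.inr (.inr (.inr (.inr (.inl (b, b'))))), rfl⟩
  · exact ⟨.inr (.inr (.inr (.inr (.inr b)))), rfl⟩
  · exact absurd ⟨i, rfl⟩ hq

theorem TState.isAccepting_iff {E : Type} {K : ℕ} {q : TState E K} : q.IsAccepting ↔
    q ∈ [TState.sink, .quiet, .br false true, .br true true] := by
  constructor
  · rintro (_ | _ | (_ | _)) <;> simp
  · intro h
    simp only [List.mem_cons, List.not_mem_nil, or_false] at h
    rcases h with rfl | rfl | rfl | rfl <;> constructor

theorem TState.IsAccepting.notMem {E : Type} {K : ℕ} {q : TState E K} (h : q.IsAccepting) :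
    q ∉ Set.range TState.pre := by
  rintro ⟨i, rfl⟩
  cases h

/-! #### Infinite concatenations -/

theorem reads_iff {α : Type} {y : ℕ → α} {u : List α} {h : ℕ} :
    Reads y h u ↔ u = (List.range u.length).map fun i => y (h + i) := by
  induction u generalizing h with
  | nil => simp [Reads]
  | cons a u ih =>
    rw [Reads, ih, List.length_cons, List.range_succ_eq_map, List.map_cons, List.map_map,
      List.cons.injEq, eq_comm (a := a)]
    simp only [Function.comp_def, Nat.succ_eq_add_one, Nat.add_zero, add_assoc, add_comm 1]

/-- The infinite concatenation of the words `w i` is `x`, and `h i` is the position of `w i`. -/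
structure IsFactorization {α : Type} (w : ℕ → List α) (x : ℕ → α) (h : ℕ → ℕ) : Prop where
  zero : h 0 = 0
  succ : ∀ i, h (i + 1) = h i + (w i).length
  reads : ∀ i, Reads x (h i) (w i)
  unbounded : ∀ N, ∃ m, N ≤ h m

theorem concatUpTo_succ (w : ℕ → List ℕ) (m : ℕ) :
    concatUpTo w (m + 1) = concatUpTo w m ++ w m := by
  simp [concatUpTo, List.range_succ]

/-- Recording where each factor starts turns the condition on prefixes into local ones, which are
those on head positions. -/
theorem isInfiniteConcat_iff {w : ℕ → List ℕ} {x : ℕ → ℕ} :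
    IsInfiniteConcat w x ↔ ∃ h, IsFactorization w x h := by
  constructor
  · rintro ⟨h1, h2⟩
    refine ⟨fun m => (concatUpTo w m).length, rfl, fun i => by simp [concatUpTo_succ],
      fun i => ?_, h2⟩
    have h3 := h1 (i + 1)
    rw [concatUpTo_succ, List.length_append, List.range_add, List.map_append, List.map_map] at h3
    exact reads_iff.2 (List.append_inj h3 (by simp)).2
  · rintro ⟨h, h0, h1, h2, h3⟩
    have key : ∀ m, concatUpTo w m = (List.range (h m)).map x := by
      intro m
      induction m with
      | zero => simp [concatUpTo, h0]
      | succ m ih =>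
        rw [concatUpTo_succ, h1, List.range_add, List.map_append, List.map_map, ih]
        exact congrArg _ (reads_iff.1 (h2 m))
    have hlen : ∀ m, (concatUpTo w m).length = h m := fun m => by simp [key]
    refine ⟨fun m => by rw [hlen]; exact key m, fun N => ?_⟩
    simpa only [hlen] using h3 N

/-- The word `w` consists of the letters of `u`, each preceded by an arbitrary one. -/
inductive IsPadding {α β : Type} (f : α → β) : List α → List β → Prop
  | nil : IsPadding f [] []
  | cons (a : α) (c : β) {u : List α} {w : List β} (h : IsPadding f u w) :
      IsPadding f (a :: u) (c :: f a :: w)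

/-! ### Removing and inserting the letters of Player 1 -/

section Padding

variable {E : Type} {k : ℕ} {ε : Option E ≃ Fin k}

theorem IsPadding.length_eq {α β : Type} {f : α → β} {u : List α} {w : List β}
    (h : IsPadding f u w) : w.length = 2 * u.length := by
  induction h with
  | nil => rfl
  | cons a c h ih => simp only [List.length_cons, ih]; omega

theorem IsPadding.reads {u : List (Option E)} {w : List (Fin k)} (hw : IsPadding ε u w)
    {x : ℕ → Fin k} {h : ℕ} (hx : Reads (fun i => (x i : ℕ)) (2 * h) (w.map Fin.val)) :
    Reads (fun t => ε.symm (x (2 * t + 1))) h u := by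
  induction hw generalizing h with
  | nil => trivial
  | cons a c _ ih =>
    obtain ⟨-, h2, h3⟩ := hx
    exact ⟨(Equiv.symm_apply_eq ε).2 (Fin.ext h2), ih h3⟩

theorem exists_isPadding {u : List (Option E)} {x : ℕ → Fin k} {h : ℕ}
    (hx : Reads (fun t => ε.symm (x (2 * t + 1))) h u) :
    ∃ w, IsPadding ε u w ∧ Reads (fun i => (x i : ℕ)) (2 * h) (w.map Fin.val) := by
  induction u generalizing h with
  | nil => exact ⟨[], .nil, trivial⟩
  | cons a u ih =>
    obtain ⟨w, h1, h2⟩ := ih hx.2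
    exact ⟨_, .cons a (x (2 * h)) h1, rfl, by rw [← hx.1, Equiv.apply_symm_apply], h2⟩

/-- Padded factors have even length, so all of them start at even positions, and halving gives the
positions in the word of Player 2. -/
theorem IsInfiniteConcat.exists_isFactorization {u : ℕ → List (Option E)} {w : ℕ → List (Fin k)}
    (hw : ∀ i, IsPadding ε (u i) (w i)) {x : ℕ → Fin k}
    (hx : IsInfiniteConcat (fun i => (w i).map Fin.val) fun i => (x i : ℕ)) :
    ∃ h, IsFactorization u (fun t => ε.symm (x (2 * t + 1))) h := by
  obtain ⟨H, h0, h1, h2, h3⟩ := isInfiniteConcat_iff.1 hx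
  have heven : ∀ i, H i = 2 * (H i / 2) := by
    intro i
    induction i with
    | zero => rw [h0]
    | succ i ih =>
      rw [h1, List.length_map, (hw i).length_eq]
      omega
  refine ⟨fun i => H i / 2, by simp [h0], fun i => ?_, fun i => (hw i).reads ?_, fun N => ?_⟩
  · simp only [h1, List.length_map, (hw i).length_eq]
    omega
  · rw [← heven]
    exact h2 i
  · obtain ⟨m, hm⟩ := h3 (2 * N)
    exact ⟨m, by omega⟩

theorem IsFactorization.exists_isInfiniteConcat {u : ℕ → List (Option E)} {x : ℕ → Fin k}
    {h : ℕ → ℕ} (hu : IsFactorization u (fun t => ε.symm (x (2 * t + 1))) h) :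
    ∃ w : ℕ → List (Fin k), (∀ i, IsPadding ε (u i) (w i)) ∧
      IsInfiniteConcat (fun i => (w i).map Fin.val) fun i => (x i : ℕ) := by
  choose w hw1 hw2 using fun i => exists_isPadding (hu.reads i)
  refine ⟨w, hw1, isInfiniteConcat_iff.2 ⟨fun i => 2 * h i, ?_, fun i => ?_, hw2, fun N => ?_⟩⟩
  · rw [hu.zero]
  · rw [hu.succ, List.length_map, (hw1 i).length_eq, mul_add]
  · obtain ⟨m, hm⟩ := hu.unbounded N
    exact ⟨m, by omega⟩

end Padding

section TwoTapeGame

variable {E : Type} (S : OpSystem E) {K k : ℕ} (ε : Option E ≃ Fin k) (num : TState E K → ℕ)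

/-- The transitions of the game automaton, which ignores the letters of Player 1. -/
inductive HTrans (n : ℕ) (q q' : TState E K) : List ℕ × List ℕ → Prop
  | intro {u v : List (Option E)} {w w' : List (Fin k)} (h : TTrans S n K q u v q')
      (hw : IsPadding ε u w) (hw' : IsPadding ε v w') :
      HTrans n q q' (w.map Fin.val, w'.map Fin.val)

/-- The transitions that do not depend on `n`. -/
def fixedTrans₂ : Set (ℕ × List ℕ × List ℕ × ℕ) :=
  {x | ∃ q r, q ∉ Set.range TState.pre ∧ HTrans S ε 0 q r (x.2.1, x.2.2.1) ∧
    x.1 = num q ∧ x.2.2.2 = num r}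

/-- The transitions from the states `pre i` with `i ≤ n`. -/
def chainTrans₂ (k B tick sink n : ℕ) : List (ℕ × List ℕ × List ℕ × ℕ) :=
  (List.range (n + 1)).flatMap fun i =>
    ((List.range k).product (List.range k)).map fun x => (B + i, [x.1, x.2], [],
      if i < n then (if x.2 = tick then B + (i + 1) else sink)
      else (if x.2 = tick then sink else B + (i + 1)))

theorem primrec_chainTrans₂ (k B tick sink : ℕ) : Primrec (chainTrans₂ k B tick sink) := by
  unfold chainTrans₂
  have hi : Primrec fun p : (ℕ × ℕ) × (ℕ × ℕ) => B + p.1.2 :=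
    Primrec.nat_add.comp (Primrec.const _) (Primrec.snd.comp Primrec.fst)
  have hi' : Primrec fun p : (ℕ × ℕ) × (ℕ × ℕ) => B + (p.1.2 + 1) := Primrec.succ.comp hi
  have hc : Primrec fun p : (ℕ × ℕ) × (ℕ × ℕ) => p.2.1 := Primrec.fst.comp Primrec.snd
  have ha : Primrec fun p : (ℕ × ℕ) × (ℕ × ℕ) => p.2.2 := Primrec.snd.comp Primrec.snd
  have hlt : PrimrecPred fun p : (ℕ × ℕ) × (ℕ × ℕ) => p.1.2 < p.1.1 :=
    Primrec.nat_lt.comp (Primrec.snd.comp Primrec.fst) (Primrec.fst.comp Primrec.fst)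
  have ht : PrimrecPred fun p : (ℕ × ℕ) × (ℕ × ℕ) => p.2.2 = tick :=
    Primrec.eq.comp ha (Primrec.const _)
  refine Primrec.list_flatMap (Primrec.list_range.comp Primrec.succ)
    (Primrec.list_map (Primrec.const _) ?_)
  exact hi.pair ((Primrec.list_cons.comp hc (Primrec.list_cons.comp ha (Primrec.const _))).pair
    ((Primrec.const _).pair (Primrec.ite hlt (Primrec.ite ht hi' (Primrec.const _))
      (Primrec.ite ht (Primrec.const _) hi'))))

variable {S num ε}

theorem TTrans.of_notMem {n n' : ℕ} {q q' : TState E K} {u v} (h : TTrans S n K q u v q')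
    (hq : q ∉ Set.range TState.pre) : TTrans S n' K q u v q' := by
  cases h with
  | pre_next => exact absurd ⟨_, rfl⟩ hq
  | pre_sink => exact absurd ⟨_, rfl⟩ hq
  | start_copy h => exact .start_copy h
  | _ => constructor <;> assumption

theorem TTrans.target {n : ℕ} {q q' : TState E K} {u v} (h : TTrans S n K q u v q')
    (hq : q ∉ Set.range TState.pre) : q' ∉ Set.range TState.pre ∨ q' = .pre 0 := by
  cases h with
  | pre_next => exact absurd ⟨_, rfl⟩ hq
  | pre_sink => exact absurd ⟨_, rfl⟩ hq
  | start_pre => exact .inr rfl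
  | _ => left; rintro ⟨i, hi⟩; cases hi

theorem TTrans.length_le {n : ℕ} {q q' : TState E K} {u v} (h : TTrans S n K q u v q') :
    u.length ≤ 1 ∧ v.length ≤ 1 := by
  cases h <;> simp

theorem mem_fixedTrans₂_or_chainTrans₂ {B : ℕ} (hB : ∀ i, num (.pre i) = B + i) {n : ℕ}
    {x : ℕ × List ℕ × List ℕ × ℕ} :
    (x ∈ fixedTrans₂ S ε num ∨ x ∈ chainTrans₂ k B (ε none) (num .sink) n) ↔
      ∃ q q', HTrans S ε n q q' (x.2.1, x.2.2.1) ∧ x.1 = num q ∧ x.2.2.2 = num q' := by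
  obtain ⟨r, w, w', r'⟩ := x
  constructor
  · rintro (⟨q, q', hq, h, h1⟩ | h)
    · refine ⟨q, q', ?_, h1⟩
      simp only at h ⊢
      cases h with
      | intro h hw hw' => exact .intro (h.of_notMem hq) hw hw'
    · simp only [chainTrans₂, List.mem_flatMap, List.mem_range, List.mem_map, Prod.exists,
        List.pair_mem_product, Prod.mk.injEq] at h
      obtain ⟨i, hi, c, a, ⟨hc, ha⟩, rfl, rfl, rfl, rfl⟩ := h
      have htick : ε.symm ⟨a, ha⟩ = none ↔ a = (ε none : ℕ) := by
        rw [Equiv.symm_apply_eq, Fin.ext_iff]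
      have hpad := IsPadding.cons (f := ε) (ε.symm ⟨a, ha⟩) ⟨c, hc⟩ .nil
      rw [Equiv.apply_symm_apply] at hpad
      by_cases h : i < n ↔ ε.symm ⟨a, ha⟩ = none
      · refine ⟨.pre i, .pre (i + 1), .intro (.pre_next (by omega) h) hpad .nil, (hB i).symm, ?_⟩
        rw [htick] at h
        by_cases hin : i < n <;> simp [hB, hin, ← h]
      · refine ⟨.pre i, .sink, .intro (.pre_sink (by omega) h) hpad .nil, (hB i).symm, ?_⟩
        rw [htick] at h
        by_cases hin : i < n <;> by_cases ht : a = (ε none : ℕ) <;> simp_all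
  · rintro ⟨q, q', h, h1, h2⟩
    simp only at h h1 h2
    subst h1 h2
    by_cases hq : q ∈ Set.range TState.pre
    · right
      obtain ⟨i, rfl⟩ := hq
      simp only [chainTrans₂, List.mem_flatMap, List.mem_range, List.mem_map, Prod.exists,
        List.pair_mem_product, Prod.mk.injEq]
      have htick : ∀ a, a = none ↔ (ε a : ℕ) = (ε none : ℕ) := fun a => by
        rw [← Fin.ext_iff, ε.injective.eq_iff]
      cases h with
      | intro h hw hw' =>
        cases h with
        | @pre_next _ a h hc =>
          cases hw' with | nil => ?_
          cases hw with | cons _ c hw => ?_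
          cases hw with | nil => ?_
          refine ⟨i, Nat.lt_succ_of_le h, c, ε a, ⟨c.is_lt, Fin.is_lt _⟩, (hB i).symm, rfl, rfl, ?_⟩
          rw [htick] at hc
          by_cases hin : i < n <;> simp [hB, hin, ← hc]
        | @pre_sink _ a h hc =>
          cases hw' with | nil => ?_
          cases hw with | cons _ c hw => ?_
          cases hw with | nil => ?_
          refine ⟨i, Nat.lt_succ_of_le h, c, ε a, ⟨c.is_lt, Fin.is_lt _⟩, (hB i).symm, rfl, rfl, ?_⟩
          rw [htick] at hc
          by_cases hin : i < n <;> by_cases ht : (ε a : ℕ) = (ε none : ℕ) <;> simp_all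
    · left
      refine ⟨q, q', hq, ?_, rfl, rfl⟩
      cases h with
      | intro h hw hw' => exact .intro (h.of_notMem hq) hw hw'

theorem finite_fixedTrans₂ {B : ℕ} (hB : ∀ i, num (.pre i) = B + i)
    (hlt : ∀ q, q ∉ Set.range TState.pre → num q < B) : (fixedTrans₂ S ε num).Finite := by
  -- At most one letter is read per tape and step, and padding doubles the length.
  have hwords := (List.finite_length_le (Fin k) 2).image (List.map Fin.val)
  refine ((Set.finite_lt_nat (B + 1)).prod (hwords.prod (hwords.prod
    (Set.finite_lt_nat (B + 1))))).subset ?_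
  rintro ⟨r, w, w', r'⟩ ⟨q, q', hq, h, h1, h2⟩
  simp only at h h1 h2
  subst h1 h2
  cases h with
  | @intro u v w w' h hw hw' =>
    have h3 : num q' ≤ B := by
      rcases h.target hq with h | rfl
      · exact (hlt _ h).le
      · simp [hB]
    have h4 := h.length_le
    have h5 := hw.length_eq
    have h6 := hw'.length_eq
    refine ⟨(hlt q hq).trans (Nat.lt_succ_self B), ⟨w, ?_, rfl⟩, ⟨w', ?_, rfl⟩,
      Nat.lt_succ_of_le h3⟩
    · change w.length ≤ 2
      omega
    · change w'.length ≤ 2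
      omega

/-- The automaton of the game with the parameter `n`. -/
noncomputable def gameAutomaton₂ {B : ℕ} (hB : ∀ i, num (.pre i) = B + i)
    (hlt : ∀ q, q ∉ Set.range TState.pre → num q < B) (S : OpSystem E) (ε : Option E ≃ Fin k)
    (n : ℕ) : TwoTapeAutomaton where
  numStates := B + n + 2
  numLetters₁ := k
  numLetters₂ := k
  trans := (finite_fixedTrans₂ (S := S) (ε := ε) hB hlt).toFinset.toList ++
    chainTrans₂ k B (ε none) (num .sink) n
  init := num .start
  accept := [TState.sink, .quiet, .br false true, .br true true].map num
  numLetters₁_pos := Fin.pos (ε none)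
  numLetters₂_pos := Fin.pos (ε none)
  init_lt := by
    have := hlt .start (by rintro ⟨i, hi⟩; cases hi)
    omega
  accept_lt := by
    intro q hq
    obtain ⟨q, hq', rfl⟩ := List.mem_map.1 hq
    have := hlt q (TState.isAccepting_iff.2 hq').notMem
    omega
  trans_valid := by
    intro r w w' r' h
    rw [List.mem_append, Finset.mem_toList, Set.Finite.mem_toFinset,
      mem_fixedTrans₂_or_chainTrans₂ hB] at h
    obtain ⟨q, q', h, h1, h2⟩ := h
    simp only at h h1 h2
    subst h1 h2
    have hbound : ∀ q : TState E K, (∀ i, q = .pre i → i ≤ n + 1) → num q < B + n + 2 := by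
      intro q hq
      by_cases h : q ∈ Set.range TState.pre
      · obtain ⟨i, rfl⟩ := h
        have := hq i rfl
        rw [hB]
        omega
      · have := hlt q h
        omega
    cases h with
    | @intro u v w w' h hw hw' =>
      refine ⟨hbound _ ?_, by simp, by simp, hbound _ ?_⟩
      · rintro i rfl
        cases h <;> omega
      · rintro i rfl
        cases h <;> omega

variable {B : ℕ} {hB : ∀ i, num (.pre i) = B + i}
    {hlt : ∀ q, q ∉ Set.range TState.pre → num q < B}

theorem computable_gameAutomaton₂ : Computable fun n => (gameAutomaton₂ hB hlt S ε n).code := by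
  refine Primrec.to_comp (Primrec.pair ?_ (Primrec.pair (Primrec.const _) (Primrec.pair
    (Primrec.const _) (Primrec.pair ?_ (Primrec.pair (Primrec.const _) (Primrec.const _))))))
  · exact Primrec.succ.comp (Primrec.succ.comp
      (Primrec.nat_add.comp (Primrec.const B) Primrec.id))
  · exact Primrec.list_append.comp (Primrec.const _) (primrec_chainTrans₂ _ _ _ _)

theorem mem_trans_gameAutomaton₂ {n : ℕ} {x : ℕ × List ℕ × List ℕ × ℕ} :
    x ∈ (gameAutomaton₂ hB hlt S ε n).trans ↔
      ∃ q q', HTrans S ε n q q' (x.2.1, x.2.2.1) ∧ x.1 = num q ∧ x.2.2.2 = num q' := by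
  rw [← mem_fixedTrans₂_or_chainTrans₂ hB, ← Set.Finite.mem_toFinset (finite_fixedTrans₂ hB hlt),
    ← Finset.mem_toList, ← List.mem_append]
  rfl

theorem mem_language_gameAutomaton₂ (hnum : Function.Injective num) {n : ℕ}
    (x : ℕ → Fin k × Fin k) :
    x ∈ (gameAutomaton₂ hB hlt S ε n).language ↔
      TAccepts S n K (fun t => ε.symm (x (2 * t + 1)).1) fun t => ε.symm (x (2 * t + 1)).2 := by
  have hacc : (gameAutomaton₂ hB hlt S ε n).accept =
    [TState.sink, .quiet, .br false true, .br true true].map num := rfl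
  constructor
  · rintro ⟨q, w, w', hq0, hstep, ⟨r, hr, hfreq⟩, hw, hw'⟩
    rw [hacc, List.mem_map] at hr
    obtain ⟨r, hr, rfl⟩ := hr
    have hstep' : ∀ t, ∃ s s' u v v₁ v₂, q t = num s ∧ q (t + 1) = num s' ∧
        TTrans S n K s u v s' ∧ IsPadding ε u v₁ ∧ IsPadding ε v v₂ ∧
        w t = v₁.map Fin.val ∧ w' t = v₂.map Fin.val := by
      intro t
      obtain ⟨s, s', h, h1, h2⟩ := mem_trans_gameAutomaton₂.1 (hstep t)
      simp only at h h1 h2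
      generalize w t = a at h
      generalize w' t = b at h
      cases h with
      | intro h hw hw' => exact ⟨s, s', _, _, _, _, h1, h2, h, hw, hw', rfl, rfl⟩
    choose s s' u v v₁ v₂ h1 h2 h3 h4 h5 h6 h7 using hstep'
    have hs : ∀ t, s' t = s (t + 1) := fun t => hnum ((h2 t).symm.trans (h1 (t + 1)))
    simp only [hs] at h3
    rw [funext h6] at hw
    rw [funext h7] at hw'
    obtain ⟨a, ha⟩ := IsInfiniteConcat.exists_isFactorization (x := fun t => (x t).1) h4 hw
    obtain ⟨b, hb⟩ := IsInfiniteConcat.exists_isFactorization (x := fun t => (x t).2) h5 hw'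
    refine ⟨fun t => (s t, a t, b t), ?_, fun t => ⟨u t, v t, h3 t, ha.reads t, hb.reads t,
      ha.succ t, hb.succ t⟩, ?_, ha.unbounded, hb.unbounded⟩
    · rw [ha.zero, hb.zero, show s 0 = .start from hnum ((h1 0).symm.trans hq0)]
    · refine hfreq.mono fun t ht => ?_
      rw [show s t = r from hnum ((h1 t).symm.trans ht)]
      exact TState.isAccepting_iff.2 hr
  · rintro ⟨z, h0, hstep, hfreq, hu, hv⟩
    simp only [TState.isAccepting_iff] at hfreq
    obtain ⟨r, hr, hfreq⟩ := frequently_mem_list.1 hfreq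
    choose u v h1 h2 h3 h4 h5 using hstep
    obtain ⟨w, hw, hw'⟩ := IsFactorization.exists_isInfiniteConcat (x := fun t => (x t).1)
      ⟨by rw [h0], h4, h2, hu⟩
    obtain ⟨c, hc, hc'⟩ := IsFactorization.exists_isInfiniteConcat (x := fun t => (x t).2)
      ⟨by rw [h0], h5, h3, hv⟩
    refine ⟨fun t => num (z t).1, _, _, congrArg (fun z => num z.1) h0, fun t => ?_,
      ⟨num r, ?_, hfreq.mono fun t ht => congrArg num ht⟩, hw', hc'⟩
    · exact mem_trans_gameAutomaton₂.2 ⟨_, _, .intro (h1 t) (hw t) (hc t), rfl, rfl⟩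
    · rw [hacc]
      exact List.mem_map.2 ⟨r, hr, rfl⟩

end TwoTapeGame

theorem exists_twoTapeAutomata : ∃ B : ℕ → TwoTapeAutomaton,
    Computable (fun n => (B n).code) ∧ (∀ n, Determined (B n).language) ∧
      IsPi12Complete {n | Player1Wins (B n).language} := by
  obtain ⟨E, _, S, hin, hout⟩ := exists_opSystem
  obtain ⟨K, hK⟩ := exists_register_bound S
  obtain ⟨B, num, hnum, hB, hlt⟩ := exists_numbering (TState.pre_injective E K)
    (TState.finite_notMem_range_pre E K)
  let ε := Finite.equivFin (Option E)
  let L : ℕ → Set (ℕ → Fin (Nat.card (Option E)) × Fin (Nat.card (Option E))) := fun n =>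
    {y | TAccepts S n K (fun t => ε.symm (y t).1) fun t => ε.symm (y t).2}
  have hL : ∀ n x, x ∈ (gameAutomaton₂ hB hlt S ε n).language ↔ (fun t => x (2 * t + 1)) ∈ L n :=
    fun n x => mem_language_gameAutomaton₂ hnum x
  have h1 : ∀ n ∈ universalSet, Player1Wins (gameAutomaton₂ hB hlt S ε n).language := fun n hn =>
    @player1Wins_of_forall _ ⟨(ε none, ε none)⟩ _ _ (hL n) fun y =>
      tAccepts_of_forall hK (hin n hn) _ _
  have h2 : ∀ n ∉ universalSet, ∃ y, y ∉ L n := fun n hn => by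
    obtain ⟨y, hy⟩ := exists_not_tAccepts (K := K) (hout n hn)
    exact ⟨fun t => (ε (y t), ε (y t)), by simpa [L] using hy⟩
  refine ⟨gameAutomaton₂ hB hlt S ε, computable_gameAutomaton₂, fun n => ?_, ?_⟩
  · by_cases hn : n ∈ universalSet
    · exact .inl (h1 n hn)
    · obtain ⟨y, hy⟩ := h2 n hn
      exact .inr (player2Wins_of_notMem (hL n) hy)
  · convert isPi12Complete_universalSet using 1
    ext n
    refine ⟨fun h => ?_, h1 n⟩
    by_contra hn
    obtain ⟨y, hy⟩ := h2 n hn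
    exact hy (mem_of_player1Wins (hL n) h y)

end AutomataGames

theorem theorem3p20 :
    (∃ A : ℕ → AutomataGames.CounterAutomaton,
      Computable (fun n => (A n).code) ∧
      (∀ n, AutomataGames.Determined (A n).language) ∧
      AutomataGames.IsPi12Complete {n | AutomataGames.Player1Wins (A n).language}) ∧
    (∃ B : ℕ → AutomataGames.TwoTapeAutomaton,
      Computable (fun n => (B n).code) ∧
      (∀ n, AutomataGames.Determined (B n).language) ∧
      AutomataGames.IsPi12Complete {n | AutomataGames.Player1Wins (B n).language}) := by
  exact ⟨AutomataGames.exists_counterAutomata, AutomataGames.exists_twoTapeAutomata⟩
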